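/- Let $N\ge 1$ be an integer, $p\ge 2$ and $\alpha\in(0,N)$ real numbers. Consider the lattice graph on $\mathbb Z^N$, where $x\sim y$ iff $\sum_{i}|x_i-y_i|=1$, with graph distance $|x-y|$. For $u,v:\mathbb Z^N\to\mathbb R$ put $$\nabla u\nabla v(x)=\tfrac12\sum_{y\sim x}(u(y)-u(x))(v(y)-v(x)),\qquad |\nabla u|(x)=\sqrt{\nabla u\nabla u(x)},$$ $$\Delta_p u(x)=\tfrac12\sum_{y\sim x}\bigl(|\nabla u|^{p-2}(y)+|\nabla u|^{p-2}(x)\bigr)(u(y)-u(x)).$$ Let $\mu(k)=2N-2\sum_{j=1}^N\cos k_j$ and $$R_\alpha(x,y)=\frac{K_\alpha}{(2\pi)^N}\int_{[0,2\pi]^N}e^{i(x-y)\cdot k}\mu(k)^{-\alpha/2}\,dk,\qquad K_\alpha=\frac1{(2\pi)^N}\int_{[0,2\pi]^N}\mu(k)^{\alpha/2}\,dk,$$ and $(R_\alpha*g)(x)=\sum_{y\in\mathbb Z^N}R_\alpha(x,y)g(y)$. Let $h:\mathbb Z^N\to\mathbb R$ and $f:\mathbb R\to\mathbb R$, and put $F(t)=\int_0^tf(s)\,ds$.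 Let $W^{1,p}(\mathbb Z^N)$ be the completion of the finitely supported functions for the norm $\bigl(\sum_x(|\nabla u|^p+|u|^p)\bigr)^{1/p}$ (a space of functions on $\mathbb Z^N$), and $$H=\Bigl\{u\in W^{1,p}(\mathbb Z^N):\sum_xh(x)|u(x)|^p<\infty\Bigr\},\qquad \|u\|=\Bigl(\sum_x\bigl(|\nabla u|^p+h|u|^p\bigr)(x)\Bigr)^{1/p}.$$ Assume: - $(h_1)$ there is $h_0>0$ with $h(x)\ge h_0$ for all $x\in\mathbb Z^N$; - $(h_3)$ there is $x_0\in\mathbb Z^N$ such that $h(x)\to\infty$ as $|x-x_0|\to\infty$; - $(f_1)$ $f$ is continuous and $f(t)=o(|t|^{p-1})$ as $t\to0$; - $(f_2)$ there are $C>0$ and $\tau>\frac{(N+\alpha)p}{2N}$ with $|f(t)|\le C(1+|t|^{\tau-1})$ for all $t\in\mathbb R$; - $(f_3)$ there is $\theta>p$ with $0\le\theta F(t)\le 2f(t)t$ for all $t\in\mathbb R$; - $(f_4)$ for every $u\in H\setminus\{0\}$ the function $t\mapsto t^{-p}\sum_x(R_\alpha*F(tu))(x)f(tu(x))u(x)$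 is strictly increasing on $(0,\infty)$. Let $$J(u)=\frac1p\sum_x\bigl(|\nabla u|^p+h|u|^p\bigr)(x)-\frac12\sum_x(R_\alpha*F(u))(x)F(u(x)),\qquad u\in H,$$ and $\mathcal M=\{v\in H\setminus\{0\}:\langle J'(v),v\rangle=0\}$, where $J'$ is the Fréchet derivative. Then the equation $$-\Delta_pu+h(x)|u|^{p-2}u=(R_\alpha*F(u))f(u)\quad\text{on }\mathbb Z^N$$ has a ground state solution: there is $u\in H\setminus\{0\}$ with $J'(u)=0$ and $J(u)=\inf_{v\in\mathcal M}J(v)$; moreover $u$ satisfies the equation at every point of $\mathbb Z^N$. -/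

import Mathlib

noncomputable section

namespace LatticeChoquard

/-! ### The lattice graph `ℤ^N` and its difference operators -/

/-- The integer lattice graph `ℤ^N`: `x ∼ y` iff `∑ |x i - y i| = 1`. -/
def latticeGraph (N : ℕ) : SimpleGraph (Fin N → ℤ) where
  Adj x y := ∑ i, |x i - y i| = 1
  symm := ⟨fun x y hxy => by
    simpa only [abs_sub_comm] using hxy⟩
  loopless := ⟨fun x hx => by simp at hx⟩

instance latticeGraph_locallyFinite (N : ℕ) : (latticeGraph N).LocallyFinite := fun x =>
  Set.Finite.fintype <| (Set.finite_Icc (fun i => x i - 1) (fun i => x i + 1)).subset <| by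
    intro y hy
    have hy' : ∑ i, |x i - y i| = 1 := hy
    have key : ∀ i, |x i - y i| ≤ 1 := fun i => by
      rw [← hy']
      exact Finset.single_le_sum (f := fun i => |x i - y i|) (fun j _ => abs_nonneg _)
        (Finset.mem_univ i)
    refine ⟨fun i => ?_, fun i => ?_⟩
    · have := abs_le.1 (key i); simp only; omega
    · have := abs_le.1 (key i); simp only; omega

variable {N : ℕ}

/-- The gradient form `Γ(u,v)(x) = ½ ∑_{y ∼ x} (u y - u x)(v y - v x)`. -/
def gradForm (u v : (Fin N → ℤ) → ℝ) (x : Fin N → ℤ) : ℝ :=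
  (1 / 2) * ∑ y ∈ (latticeGraph N).neighborFinset x, (u y - u x) * (v y - v x)

/-- The length of the gradient `|∇u|(x) = √Γ(u,u)(x)`. -/
def gradLen (u : (Fin N → ℤ) → ℝ) (x : Fin N → ℤ) : ℝ :=
  √(gradForm u u x)

/-- The `p`-Laplacian
`Δ_p u(x) = ½ ∑_{y ∼ x} (|∇u|^{p-2}(y) + |∇u|^{p-2}(x)) (u y - u x)`. -/
def pLaplacian (p : ℝ) (u : (Fin N → ℤ) → ℝ) (x : Fin N → ℤ) : ℝ :=
  (1 / 2) * ∑ y ∈ (latticeGraph N).neighborFinset x,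
    (gradLen u y ^ (p - 2) + gradLen u x ^ (p - 2)) * (u y - u x)

/-! ### The Green's function of the discrete fractional Laplacian -/

/-- `μ(k) = 2N - 2 ∑ cos k_j`. -/
def symbol (k : Fin N → ℝ) : ℝ :=
  2 * N - 2 * ∑ j, Real.cos (k j)

/-- The torus `[0, 2π]^N`. -/
def torus (N : ℕ) : Set (Fin N → ℝ) :=
  Set.Icc (fun _ => 0) (fun _ => 2 * Real.pi)

/-- The fractional degree `K_α = (2π)^{-N} ∫ μ(k)^{α/2} dk`. -/
def fracDegree (N : ℕ) (α : ℝ) : ℝ :=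
  1 / (2 * Real.pi) ^ N * ∫ k in torus N, symbol k ^ (α / 2)

/-- The Green's function
`R_α(x,y) = K_α (2π)^{-N} ∫ e^{i (x-y)·k} μ(k)^{-α/2} dk`. The integral is a real number by the
symmetry `k ↦ 2π - k`, so taking the real part only changes the type. -/
def green (α : ℝ) (x y : Fin N → ℤ) : ℝ :=
  (((fracDegree N α / (2 * Real.pi) ^ N : ℝ) : ℂ) *
    ∫ k in torus N,
      Complex.exp (Complex.I * ((∑ j, ((x j - y j : ℤ) : ℝ) * k j : ℝ) : ℂ)) *
        ((symbol k ^ (-(α / 2)) : ℝ) : ℂ)).re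

/-- The convolution `(R_α * g)(x) = ∑_y R_α(x,y) g(y)`. -/
def greenConv (α : ℝ) (g : (Fin N → ℤ) → ℝ) (x : Fin N → ℤ) : ℝ :=
  ∑' y, green α x y * g y

/-! ### The spaces `W^{1,p}(ℤ^N)` and `H` -/

/-- The density `|∇u|^p + h |u|^p`. -/
def energyDensity (p : ℝ) (h u : (Fin N → ℤ) → ℝ) (x : Fin N → ℤ) : ℝ :=
  gradLen u x ^ p + h x * |u x| ^ p

/-- `(∑_x (|∇u|^p + h |u|^p))^{1/p}`. -/
def energyNorm (p : ℝ) (h u : (Fin N → ℤ) → ℝ) : ℝ :=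
  (∑' x, energyDensity p h u x) ^ (1 / p)

/-- Membership in `W^{1,p}(ℤ^N)`, the completion of the finitely supported functions for the norm
`(∑ (|∇u|^p + |u|^p))^{1/p}`, realized as a space of functions: `u` has finite norm and is a limit
in this norm of finitely supported functions. -/
def MemW1p (p : ℝ) (u : (Fin N → ℤ) → ℝ) : Prop :=
  Summable (energyDensity p (fun _ => 1) u) ∧
    ∀ ε > 0, ∃ v : (Fin N → ℤ) → ℝ, (Function.support v).Finite ∧
      energyNorm p (fun _ => 1) (u - v) < ε

/-- The potential is bounded below by a positive constant. -/
def BoundedBelow (h : (Fin N → ℤ) → ℝ) : Prop :=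
  ∃ h₀ : ℝ, 0 < h₀ ∧ ∀ x, h₀ ≤ h x

/-! Auxiliary facts: the energy norm is a norm. -/

theorem gradForm_self_nonneg (u : (Fin N → ℤ) → ℝ) (x : Fin N → ℤ) : 0 ≤ gradForm u u x :=
  mul_nonneg (by norm_num) (Finset.sum_nonneg fun _ _ => mul_self_nonneg _)

theorem gradLen_nonneg (u : (Fin N → ℤ) → ℝ) (x : Fin N → ℤ) : 0 ≤ gradLen u x :=
  Real.sqrt_nonneg _

theorem gradLen_add_le (u v : (Fin N → ℤ) → ℝ) (x : Fin N → ℤ) :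
    gradLen (u + v) x ≤ gradLen u x + gradLen v x := by
  have hcs : gradForm u v x ≤ gradLen u x * gradLen v x := by
    unfold gradLen
    rw [← Real.sqrt_mul (gradForm_self_nonneg u x)]
    apply Real.le_sqrt_of_sq_le
    have := Finset.sum_mul_sq_le_sq_mul_sq ((latticeGraph N).neighborFinset x)
      (fun y => u y - u x) (fun y => v y - v x)
    simp only [gradForm, ← pow_two]
    nlinarith [this]
  have hexp : gradForm (u + v) (u + v) x
      = gradForm u u x + 2 * gradForm u v x + gradForm v v x := by
    simp only [gradForm, Finset.mul_sum, ← Finset.sum_add_distrib]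
    refine Finset.sum_congr rfl fun y _ => ?_
    simp only [Pi.add_apply]
    ring
  have hu : gradLen u x ^ 2 = gradForm u u x := Real.sq_sqrt (gradForm_self_nonneg u x)
  have hv : gradLen v x ^ 2 = gradForm v v x := Real.sq_sqrt (gradForm_self_nonneg v x)
  refine Real.sqrt_le_iff.2 ⟨add_nonneg (gradLen_nonneg u x) (gradLen_nonneg v x), ?_⟩
  rw [hexp]
  nlinarith

theorem gradLen_smul (c : ℝ) (u : (Fin N → ℤ) → ℝ) (x : Fin N → ℤ) :
    gradLen (c • u) x = |c| * gradLen u x := by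
  have : gradForm (c • u) (c • u) x = c ^ 2 * gradForm u u x := by
    simp only [gradForm, Finset.mul_sum]
    refine Finset.sum_congr rfl fun y _ => ?_
    simp only [Pi.smul_apply, smul_eq_mul]
    ring
  rw [gradLen, this, Real.sqrt_mul (sq_nonneg c), Real.sqrt_sq_eq_abs, gradLen]

theorem energyDensity_nonneg (p : ℝ) {h : (Fin N → ℤ) → ℝ} (hh : ∀ x, 0 ≤ h x)
    (u : (Fin N → ℤ) → ℝ) (x : Fin N → ℤ) : 0 ≤ energyDensity p h u x :=
  add_nonneg (Real.rpow_nonneg (gradLen_nonneg u x) p)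
    (mul_nonneg (hh x) (Real.rpow_nonneg (abs_nonneg _) p))

theorem energyDensity_zero {p : ℝ} (hp : 2 ≤ p) (h : (Fin N → ℤ) → ℝ) :
    energyDensity p h (0 : (Fin N → ℤ) → ℝ) = 0 := by
  have hp0 : p ≠ 0 := by linarith
  funext x
  simp [energyDensity, gradLen, gradForm, Real.zero_rpow hp0]

theorem energyDensity_smul (p : ℝ) (h : (Fin N → ℤ) → ℝ) (c : ℝ) (u : (Fin N → ℤ) → ℝ)
    (x : Fin N → ℤ) : energyDensity p h (c • u) x = |c| ^ p * energyDensity p h u x := by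
  simp only [energyDensity, gradLen_smul, Pi.smul_apply, smul_eq_mul, abs_mul]
  rw [Real.mul_rpow (abs_nonneg _) (gradLen_nonneg _ _), Real.mul_rpow (abs_nonneg _) (abs_nonneg _)]
  ring

theorem energyDensity_add_le {p : ℝ} (hp : 2 ≤ p) {h : (Fin N → ℤ) → ℝ} (hh : ∀ x, 0 ≤ h x)
    (u v : (Fin N → ℤ) → ℝ) (x : Fin N → ℤ) :
    energyDensity p h (u + v) x ≤
      (energyDensity p h u x ^ (1 / p) + energyDensity p h v x ^ (1 / p)) ^ p := by
  have hp0 : 0 < p := by linarith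
  have hw : ∀ t : ℝ, 0 ≤ t → h x * t ^ p = (h x ^ (1 / p) * t) ^ p := fun t ht => by
    rw [Real.mul_rpow (Real.rpow_nonneg (hh x) _) ht, ← Real.rpow_mul (hh x),
      one_div_mul_cancel hp0.ne', Real.rpow_one]
  have hc : 0 ≤ h x ^ (1 / p) := Real.rpow_nonneg (hh x) _
  have key := Real.Lp_add_le_of_nonneg (s := (Finset.univ : Finset (Fin 2))) (p := p)
    (f := ![gradLen u x, h x ^ (1 / p) * |u x|]) (g := ![gradLen v x, h x ^ (1 / p) * |v x|])
    (by linarith)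
    (by
      intro i _
      fin_cases i
      · exact gradLen_nonneg u x
      · exact mul_nonneg hc (abs_nonneg _))
    (by
      intro i _
      fin_cases i
      · exact gradLen_nonneg v x
      · exact mul_nonneg hc (abs_nonneg _))
  simp only [Fin.sum_univ_two, Matrix.cons_val_zero, Matrix.cons_val_one] at key
  rw [← hw _ (abs_nonneg _), ← hw _ (abs_nonneg _), ← mul_add,
    ← hw _ (add_nonneg (abs_nonneg _) (abs_nonneg _))] at key
  have hle : energyDensity p h (u + v) x ≤
      (gradLen u x + gradLen v x) ^ p + h x * (|u x| + |v x|) ^ p := by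
    refine add_le_add ?_ (mul_le_mul_of_nonneg_left ?_ (hh x))
    · exact Real.rpow_le_rpow (gradLen_nonneg _ _) (gradLen_add_le u v x) hp0.le
    · exact Real.rpow_le_rpow (abs_nonneg _) (abs_add_le _ _) hp0.le
  refine hle.trans ?_
  have hnn : 0 ≤ (gradLen u x + gradLen v x) ^ p + h x * (|u x| + |v x|) ^ p :=
    (energyDensity_nonneg p hh (u + v) x).trans hle
  have h2 := Real.rpow_le_rpow (Real.rpow_nonneg hnn _) key hp0.le
  rwa [← Real.rpow_mul hnn, one_div_mul_cancel hp0.ne', Real.rpow_one] at h2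

theorem energy_add {p : ℝ} (hp : 2 ≤ p) {h : (Fin N → ℤ) → ℝ} (hh : ∀ x, 0 ≤ h x)
    {u v : (Fin N → ℤ) → ℝ} (hu : Summable (energyDensity p h u))
    (hv : Summable (energyDensity p h v)) :
    Summable (energyDensity p h (u + v)) ∧
      energyNorm p h (u + v) ≤ energyNorm p h u + energyNorm p h v := by
  have hp0 : 0 < p := by linarith
  have hnn := fun w x => energyDensity_nonneg (N := N) p hh w x
  have hpow : ∀ w x, (energyDensity p h w x ^ (1 / p)) ^ p = energyDensity p h w x :=
    fun w x => by rw [← Real.rpow_mul (hnn w x), one_div_mul_cancel hp0.ne', Real.rpow_one]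
  obtain ⟨h1, h2⟩ := Real.Lp_add_le_tsum_of_nonneg (p := p) (by linarith)
    (fun x => Real.rpow_nonneg (hnn u x) (1 / p)) (fun x => Real.rpow_nonneg (hnn v x) (1 / p))
    (by simpa only [hpow] using hu) (by simpa only [hpow] using hv)
  have hle := energyDensity_add_le hp hh u v
  have hs : Summable (energyDensity p h (u + v)) := Summable.of_nonneg_of_le (hnn _) hle h1
  refine ⟨hs, ?_⟩
  simp only [hpow] at h2
  refine le_trans ?_ h2
  exact Real.rpow_le_rpow (tsum_nonneg (hnn _)) (hs.tsum_le_tsum hle h1)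
    (by positivity)

theorem energyNorm_smul {p : ℝ} (hp : 2 ≤ p) {h : (Fin N → ℤ) → ℝ} (hh : ∀ x, 0 ≤ h x)
    (c : ℝ) (u : (Fin N → ℤ) → ℝ) : energyNorm p h (c • u) = |c| * energyNorm p h u := by
  have hp0 : 0 < p := by linarith
  simp only [energyNorm, energyDensity_smul, tsum_mul_left]
  rw [Real.mul_rpow (Real.rpow_nonneg (abs_nonneg _) _)
    (tsum_nonneg (energyDensity_nonneg p hh u)), ← Real.rpow_mul (abs_nonneg _),
    mul_one_div_cancel hp0.ne', Real.rpow_one]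

theorem summable_energyDensity_smul {p : ℝ} {h : (Fin N → ℤ) → ℝ}
    (c : ℝ) {u : (Fin N → ℤ) → ℝ} (hu : Summable (energyDensity p h u)) :
    Summable (energyDensity p h (c • u)) :=
  (hu.mul_left (|c| ^ p)).congr fun x => (energyDensity_smul p h c u x).symm

/-- A finitely supported function has finite energy. -/
theorem summable_energyDensity_of_finite {p : ℝ} (hp : 2 ≤ p) (h : (Fin N → ℤ) → ℝ)
    {v : (Fin N → ℤ) → ℝ} (hv : (Function.support v).Finite) :
    Summable (energyDensity p h v) := by
  have hp0 : p ≠ 0 := by linarith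
  have hfin : (Function.support v ∪
      ⋃ y ∈ Function.support v, (latticeGraph N).neighborSet y).Finite :=
    hv.union (hv.biUnion fun y _ => Set.toFinite _)
  refine summable_of_hasFiniteSupport (hfin.subset fun x hx => ?_)
  by_contra hcon
  simp only [Set.mem_union, Set.mem_iUnion, not_or, not_exists] at hcon
  have hx0 : v x = 0 := by simpa using hcon.1
  have hy0 : ∀ y ∈ (latticeGraph N).neighborFinset x, v y = 0 := fun y hy => by
    by_contra hne
    exact hcon.2 y hne ((latticeGraph N).symm.symm _ _
      ((SimpleGraph.mem_neighborFinset _ _ _).1 hy))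
  apply hx
  have : gradForm v v x = 0 := by
    unfold gradForm
    rw [Finset.sum_eq_zero fun y hy => by rw [hy0 y hy, hx0]; ring, mul_zero]
  simp [energyDensity, gradLen, this, hx0, Real.zero_rpow hp0]

theorem summable_energyDensity_iff {p : ℝ} {h : (Fin N → ℤ) → ℝ} (hh : ∀ x, 0 ≤ h x)
    (u : (Fin N → ℤ) → ℝ) :
    Summable (energyDensity p h u) ↔
      Summable (fun x => gradLen u x ^ p) ∧ Summable (fun x => h x * |u x| ^ p) := by
  refine ⟨fun hs => ⟨?_, ?_⟩, fun hs => hs.1.add hs.2⟩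
  · exact Summable.of_nonneg_of_le (fun x => Real.rpow_nonneg (gradLen_nonneg u x) p)
      (fun x => le_add_of_nonneg_right (mul_nonneg (hh x) (Real.rpow_nonneg (abs_nonneg _) p))) hs
  · exact Summable.of_nonneg_of_le
      (fun x => mul_nonneg (hh x) (Real.rpow_nonneg (abs_nonneg _) p))
      (fun x => le_add_of_nonneg_left (Real.rpow_nonneg (gradLen_nonneg u x) p)) hs

theorem BoundedBelow.nonneg {h : (Fin N → ℤ) → ℝ} (hh : BoundedBelow h) (x : Fin N → ℤ) :
    0 ≤ h x := by
  obtain ⟨h₀, h0, hle⟩ := hh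
  exact h0.le.trans (hle x)

theorem MemW1p.add {p : ℝ} (hp : 2 ≤ p) {u v : (Fin N → ℤ) → ℝ} (hu : MemW1p p u)
    (hv : MemW1p p v) : MemW1p p (u + v) := by
  have h1 : ∀ x : Fin N → ℤ, (0 : ℝ) ≤ (fun _ => (1 : ℝ)) x := fun _ => zero_le_one
  have hsub : ∀ {a b : (Fin N → ℤ) → ℝ}, Summable (energyDensity p (fun _ => 1) a) →
      (Function.support b).Finite → Summable (energyDensity p (fun _ => 1) (a - b)) := by
    intro a b ha hb
    have := (energy_add hp h1 ha (summable_energyDensity_smul (-1)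
      (summable_energyDensity_of_finite hp (fun _ => 1) hb))).1
    rwa [neg_one_smul, ← sub_eq_add_neg] at this
  refine ⟨(energy_add hp h1 hu.1 hv.1).1, fun ε hε => ?_⟩
  obtain ⟨a, ha, hua⟩ := hu.2 (ε / 2) (by linarith)
  obtain ⟨b, hb, hvb⟩ := hv.2 (ε / 2) (by linarith)
  refine ⟨a + b, (ha.union hb).subset (Function.support_add a b), ?_⟩
  have := (energy_add hp h1 (hsub hu.1 ha) (hsub hv.1 hb)).2
  rw [add_sub_add_comm]
  linarith

theorem MemW1p.smul {p : ℝ} (hp : 2 ≤ p) (c : ℝ) {u : (Fin N → ℤ) → ℝ} (hu : MemW1p p u) :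
    MemW1p p (c • u) := by
  refine ⟨summable_energyDensity_smul c hu.1, fun ε hε => ?_⟩
  obtain ⟨a, ha, hua⟩ := hu.2 (ε / (|c| + 1)) (by positivity)
  refine ⟨c • a, ha.subset (Function.support_const_smul_subset c a), ?_⟩
  rw [← smul_sub, energyNorm_smul hp (fun _ => zero_le_one)]
  rw [lt_div_iff₀ (by positivity)] at hua
  have : 0 ≤ energyNorm p (fun _ => 1) (u - a) :=
    Real.rpow_nonneg (tsum_nonneg (energyDensity_nonneg p (fun _ => zero_le_one) _)) _
  nlinarith

theorem MemW1p.zero {p : ℝ} (hp : 2 ≤ p) : MemW1p p (0 : (Fin N → ℤ) → ℝ) := by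
  have hp0 : 1 / p ≠ 0 := by
    have : 0 < p := by linarith
    positivity
  refine ⟨by rw [energyDensity_zero hp]; exact summable_zero, fun ε hε => ⟨0, by simp, ?_⟩⟩
  rw [sub_zero, energyNorm, energyDensity_zero hp]
  simp only [Pi.zero_apply, tsum_zero, Real.zero_rpow hp0]
  exact hε

/-- `H = {u ∈ W^{1,p}(ℤ^N) : ∑ h |u|^p < ∞}` as a linear space of functions. -/
def HSubmodule (p : ℝ) (h : (Fin N → ℤ) → ℝ) (hp : 2 ≤ p) (hh : BoundedBelow h) :
    Submodule ℝ ((Fin N → ℤ) → ℝ) where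
  carrier := {u | MemW1p p u ∧ Summable fun x => h x * |u x| ^ p}
  zero_mem' := ⟨MemW1p.zero hp, by
    have hp0 : p ≠ 0 := by linarith
    simp [Real.zero_rpow hp0]⟩
  add_mem' := fun {u v} hu hv => by
    have hgrad : ∀ {w : (Fin N → ℤ) → ℝ}, MemW1p p w → Summable fun x => gradLen w x ^ p :=
      fun hw => ((summable_energyDensity_iff (fun _ => zero_le_one) _).1 hw.1).1
    exact ⟨hu.1.add hp hv.1, ((summable_energyDensity_iff hh.nonneg _).1
      (energy_add hp hh.nonneg ((summable_energyDensity_iff hh.nonneg _).2 ⟨hgrad hu.1, hu.2⟩)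
        ((summable_energyDensity_iff hh.nonneg _).2 ⟨hgrad hv.1, hv.2⟩)).1).2⟩
  smul_mem' := fun c u hu => ⟨hu.1.smul hp c, by
    refine (hu.2.mul_left (|c| ^ p)).congr fun x => ?_
    rw [Pi.smul_apply, smul_eq_mul, abs_mul, Real.mul_rpow (abs_nonneg _) (abs_nonneg _)]
    ring⟩

/-- The space `H`, to be equipped with the norm `(∑ (|∇u|^p + h |u|^p))^{1/p}`. -/
def HSpace (p : ℝ) (h : (Fin N → ℤ) → ℝ) (hp : 2 ≤ p) (hh : BoundedBelow h) : Type :=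
  ↥(HSubmodule p h hp hh)

variable {p : ℝ} {h : (Fin N → ℤ) → ℝ} {hp : 2 ≤ p} {hh : BoundedBelow h}

instance : AddCommGroup (HSpace p h hp hh) :=
  inferInstanceAs (AddCommGroup ↥(HSubmodule p h hp hh))

instance : Module ℝ (HSpace p h hp hh) :=
  inferInstanceAs (Module ℝ ↥(HSubmodule p h hp hh))

instance : CoeFun (HSpace p h hp hh) (fun _ => (Fin N → ℤ) → ℝ) :=
  ⟨fun u => Subtype.val (p := (· ∈ HSubmodule p h hp hh)) u⟩

instance : Norm (HSpace p h hp hh) :=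
  ⟨fun u => energyNorm p h u⟩

theorem HSpace.summable (u : HSpace p h hp hh) : Summable (energyDensity p h u) :=
  (summable_energyDensity_iff hh.nonneg _).2
    ⟨((summable_energyDensity_iff (fun _ => zero_le_one) _).1 u.2.1.1).1, u.2.2⟩

theorem HSpace.normCore : NormedSpace.Core ℝ (HSpace p h hp hh) where
  norm_nonneg u := Real.rpow_nonneg (tsum_nonneg (energyDensity_nonneg p hh.nonneg _)) _
  norm_smul c u := energyNorm_smul hp hh.nonneg c u
  norm_triangle u v := (energy_add hp hh.nonneg u.summable v.summable).2
  norm_eq_zero_iff u := by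
    have hp0 : 0 < p := by linarith
    have hp1 : 1 / p ≠ 0 := by positivity
    have hnn := energyDensity_nonneg p hh.nonneg (u : (Fin N → ℤ) → ℝ)
    constructor
    · intro hu
      have hu' : (∑' x, energyDensity p h u x) ^ (1 / p) = 0 := hu
      rw [Real.rpow_eq_zero (tsum_nonneg hnn) hp1] at hu'
      have hz := (hasSum_zero_iff_of_nonneg hnn).1 (hu' ▸ u.summable.hasSum)
      refine Subtype.ext (funext fun x => ?_)
      have hx : energyDensity p h u x = 0 := congrFun hz x
      have hpos : 0 < h x := by
        obtain ⟨h₀, h0, hle⟩ := hh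
        exact h0.trans_le (hle x)
      have h1 : 0 ≤ gradLen (u : (Fin N → ℤ) → ℝ) x ^ p := Real.rpow_nonneg (gradLen_nonneg _ x) p
      by_contra hne
      have : 0 < h x * |u x| ^ p := mul_pos hpos (Real.rpow_pos_of_pos (abs_pos.2 hne) p)
      unfold energyDensity at hx
      linarith
    · rintro rfl
      have : energyNorm p h (0 : (Fin N → ℤ) → ℝ) = 0 := by
        rw [energyNorm, energyDensity_zero hp]
        simp only [Pi.zero_apply, tsum_zero, Real.zero_rpow hp1]
      exact this

instance : NormedAddCommGroup (HSpace p h hp hh) :=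
  NormedAddCommGroup.ofCore HSpace.normCore

instance : NormedSpace ℝ (HSpace p h hp hh) :=
  NormedSpace.ofCore HSpace.normCore

/-! ### The energy functional, the Nehari manifold and ground states -/

/-- `F(t) = ∫_0^t f(s) ds`. -/
def primitive (f : ℝ → ℝ) (t : ℝ) : ℝ :=
  ∫ s in (0 : ℝ)..t, f s

/-- The energy functional
`J(u) = (1/p) ∑ (|∇u|^p + h |u|^p) - ½ ∑ (R_α * F(u)) F(u)` on `H`. -/
def energy (α : ℝ) (f : ℝ → ℝ) (u : HSpace p h hp hh) : ℝ :=
  (1 / p) * ∑' x, energyDensity p h u x -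
    (1 / 2) * ∑' x, greenConv α (fun y => primitive f (u y)) x * primitive f (u x)

/-- The Nehari manifold `{v ∈ H ∖ {0} : ⟨J'(v), v⟩ = 0}`, with `J'` the Fréchet derivative. -/
def nehari (α : ℝ) (f : ℝ → ℝ) : Set (HSpace p h hp hh) :=
  {v | v ≠ 0 ∧ fderiv ℝ (energy α f) v v = 0}

/-- `u` is a ground state: a nontrivial critical point of `J` with
`J(u) = inf` of `J` over the Nehari manifold. -/
def IsGroundState (α : ℝ) (f : ℝ → ℝ) (u : HSpace p h hp hh) : Prop :=
  u ≠ 0 ∧ HasFDerivAt (energy α f) (0 : HSpace p h hp hh →L[ℝ] ℝ) u ∧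
    IsGLB (energy α f '' (nehari α f : Set (HSpace p h hp hh))) (energy α f u)

/-- `u` solves `-Δ_p u + h |u|^{p-2} u = (R_α * F(u)) f(u)` at every point of `ℤ^N`. -/
def SolvesEquation (p α : ℝ) (h : (Fin N → ℤ) → ℝ) (f : ℝ → ℝ) (u : (Fin N → ℤ) → ℝ) : Prop :=
  ∀ x, -pLaplacian p u x + h x * |u x| ^ (p - 2) * u x =
    greenConv α (fun y => primitive f (u y)) x * f (u x)

end LatticeChoquard

end

noncomputable section

namespace LatticeChoquard

open MeasureTheory Set Filter Topology

/-! ### Positivity and boundedness of the Green's function -/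

/-! The ground state is a minimizer of `energy` on `nehari`. The kernel is symmetric, nonnegative
and bounded by its diagonal value (`green_nonneg`, `green_le_diag`), because the negative power of
`symbol` is a Gamma integral of the functions `exp (-(t * symbol k))`, whose Fourier coefficients
are nonnegative. The space `H` embeds in `ℓ^p`, whose elements are bounded, so continuity of `f` and
its smallness at `0` put `F(u)` and `f(u) w` in `ℓ^1`. A bounded kernel is a continuous bilinear
form on `ℓ^1` (`kernelForm`); hence the nonlocal term is strictly differentiable already in the
topology of `ℓ^p`. Coercivity of `h` makes the embedding compact (`exists_subseq_tendsto_toEll`).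

Along a ray, the derivative of `J(t u)` is `t^(p-1) (‖u‖^p - t g(t))`, where `g` is the function in
the monotonicity hypothesis. As `g` is nonnegative and strictly increasing, a point of `nehari` is
the strict maximum of `J` on its ray (`energy_smul_lt`). The nonlocal term is `O(t^(2p))` near `0`
and grows at least like `t^θ`, `θ > p`, so every ray meets `nehari` (`exists_smul_mem_nehari`), and
`J` controls the norm there (`mul_norm_rpow_le_energy`).

A minimizing sequence `v n` is thus bounded and converges along a subsequence, pointwise and in
`ℓ^p`, to some `u ≠ 0`. With `t u` in `nehari`, semicontinuity of the norm and continuity of the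
nonlocal term give `J(t u) ≤ liminf J(t v n) ≤ lim J(v n)`, so `t u` is a minimizer
(`exists_isMinOn_nehari`).

Since `f` is merely continuous, `nehari` need not be a `C^1` manifold and no Lagrange multiplier is
available. Instead, if `J'(u) v < 0`, the ray through `u + s v` has a point `t (u + s v)` of
`nehari` with `t` near `1`, and `J(t (u + s v)) < J(t u) ≤ J(u)` contradicts minimality
(`dirichletForm_sub_nonlocalForm_nonneg`). Testing `J'(u) = 0` against indicators of points gives
the equation. -/

theorem continuous_symbol {N : ℕ} : Continuous (symbol : (Fin N → ℝ) → ℝ) := by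
  unfold symbol; fun_prop

theorem symbol_eq_sum_sin_sq {N : ℕ} (k : Fin N → ℝ) :
    symbol k = 4 * ∑ j, Real.sin (k j / 2) ^ 2 := by
  have : ∀ j, Real.cos (k j) = 1 - 2 * Real.sin (k j / 2) ^ 2 := fun j => by
    have h1 := Real.cos_two_mul (k j / 2)
    have h2 := Real.sin_sq_add_cos_sq (k j / 2)
    rw [mul_div_cancel₀ _ two_ne_zero] at h1
    linarith
  simp only [symbol, this, Finset.sum_sub_distrib, ← Finset.mul_sum]
  simp
  ring

theorem symbol_nonneg {N : ℕ} (k : Fin N → ℝ) : 0 ≤ symbol k := by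
  rw [symbol_eq_sum_sin_sq]
  positivity

theorem torus_eq_pi_Icc (N : ℕ) : torus N = univ.pi fun _ : Fin N => Icc 0 (2 * Real.pi) :=
  (pi_univ_Icc _ _).symm

theorem isCompact_torus (N : ℕ) : IsCompact (torus N) := by
  rw [torus_eq_pi_Icc]
  exact isCompact_univ_pi fun _ => isCompact_Icc

theorem volume_restrict_torus (N : ℕ) :
    (volume : Measure (Fin N → ℝ)).restrict (torus N) =
      volume.restrict (univ.pi fun _ : Fin N => Ioo 0 (2 * Real.pi)) :=
  Measure.restrict_congr_set Measure.univ_pi_Ioo_ae_eq_Icc.symm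

/-! ### Integrability of the singular symbol. -/

theorem integrableOn_torus_of_continuous {N : ℕ} {g : (Fin N → ℝ) → ℝ} (hg : Continuous g) :
    IntegrableOn g (torus N) :=
  hg.continuousOn.integrableOn_compact (isCompact_torus N)

/-- Jordan's inequality bounds `sin (k / 2)` below by `k / π` on the left half of the interval and
by `(2π - k) / π` on the right half; both resulting singularities are integrable since `a < 1`. -/
theorem integrableOn_sin_half_rpow {a : ℝ} (ha : 0 < a) (ha1 : a < 1) :
    IntegrableOn (fun k : ℝ => Real.sin (k / 2) ^ (-a)) (Ioo 0 (2 * Real.pi)) := by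
  have hpi := Real.pi_pos
  have hI1 : IntegrableOn (fun k : ℝ => k ^ (-a)) (Ioo 0 (2 * Real.pi)) := by
    have := (intervalIntegral.intervalIntegrable_rpow' (a := 0) (b := 2 * Real.pi) (r := -a)
      (by linarith))
    rw [intervalIntegrable_iff_integrableOn_Ioo_of_le (by positivity)] at this
    exact this
  have hI2 : IntegrableOn (fun k : ℝ => (2 * Real.pi - k) ^ (-a)) (Ioo 0 (2 * Real.pi)) := by
    have := ((intervalIntegral.intervalIntegrable_rpow' (a := 0) (b := 2 * Real.pi) (r := -a)
      (by linarith)).comp_sub_left (2 * Real.pi)).symm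
    simp only [sub_self, sub_zero] at this
    rw [intervalIntegrable_iff_integrableOn_Ioo_of_le (by positivity)] at this
    exact this
  have hI := ((hI1.add hI2).const_mul (Real.pi⁻¹ ^ (-a)))
  refine Integrable.mono' hI ?_ ?_
  · refine (Measurable.aestronglyMeasurable ?_)
    fun_prop
  · refine (ae_restrict_iff' measurableSet_Ioo).2 (ae_of_all _ fun k hk => ?_)
    obtain ⟨hk0, hk1⟩ := hk
    have key : ∀ t, 0 < t → t ≤ Real.sin (k / 2) * Real.pi →
        Real.sin (k / 2) ^ (-a) ≤ Real.pi⁻¹ ^ (-a) * t ^ (-a) := fun t ht hle => by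
      rw [← Real.mul_rpow (by positivity) ht.le]
      refine Real.rpow_le_rpow_of_nonpos (by positivity) ?_ (by linarith)
      rw [inv_mul_le_iff₀ hpi]; linarith
    have hp1 : 0 ≤ Real.pi⁻¹ ^ (-a) * k ^ (-a) := by positivity
    have hp2 : 0 ≤ Real.pi⁻¹ ^ (-a) * (2 * Real.pi - k) ^ (-a) :=
      mul_nonneg (by positivity) (Real.rpow_nonneg (by linarith) _)
    rw [Real.norm_of_nonneg (Real.rpow_nonneg
      (Real.sin_nonneg_of_nonneg_of_le_pi (by linarith) (by linarith)) _)]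
    simp only [Pi.add_apply, mul_add]
    rcases le_total k Real.pi with h | h
    · have := Real.mul_le_sin (x := k / 2) (by linarith) (by linarith)
      have h2 := key k hk0 (by
        have := mul_le_mul_of_nonneg_right this hpi.le
        field_simp at this
        linarith)
      linarith
    · have := Real.mul_le_sin (x := Real.pi - k / 2) (by linarith) (by linarith)
      rw [Real.sin_pi_sub] at this
      have h2 := key (2 * Real.pi - k) (by linarith) (by
        have := mul_le_mul_of_nonneg_right this hpi.le
        field_simp at this
        linarith)
      linarith

theorem sin_half_pos {k : ℝ} (hk : k ∈ Ioo 0 (2 * Real.pi)) : 0 < Real.sin (k / 2) :=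
  Real.sin_pos_of_pos_of_lt_pi (by linarith [hk.1]) (by linarith [hk.2])

/-- AM-GM with equal weights. A product lower bound separates the variables, so integrability on the
torus becomes a one-dimensional question. -/
theorem prod_sin_le_symbol {N : ℕ} (hN : 0 < N) {k : Fin N → ℝ}
    (hk : ∀ j, k j ∈ Ioo 0 (2 * Real.pi)) :
    ∏ j, Real.sin (k j / 2) ^ (2 / N : ℝ) ≤ symbol k := by
  have hN' : (1 : ℝ) ≤ N := by exact_mod_cast hN
  have h := Real.geom_mean_le_arith_mean_weighted Finset.univ (fun _ : Fin N => (1 / N : ℝ))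
    (fun j => Real.sin (k j / 2) ^ 2) (fun _ _ => by positivity)
    (by simp; field_simp) (fun _ _ => by positivity)
  rw [symbol_eq_sum_sin_sq]
  calc ∏ j, Real.sin (k j / 2) ^ (2 / N : ℝ)
      = ∏ j, (Real.sin (k j / 2) ^ 2) ^ (1 / N : ℝ) := by
        refine Finset.prod_congr rfl fun j _ => ?_
        rw [← Real.rpow_natCast, ← Real.rpow_mul (sin_half_pos (hk j)).le]
        congr 1; push_cast; ring
    _ ≤ _ := h
    _ = (1 / N) * ∑ j, Real.sin (k j / 2) ^ 2 := by rw [Finset.mul_sum]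
    _ ≤ 4 * ∑ j, Real.sin (k j / 2) ^ 2 := by
        refine mul_le_mul_of_nonneg_right ?_ (by positivity)
        rw [div_le_iff₀ (by positivity)]; linarith

theorem prod_sin_pos {N : ℕ} {k : Fin N → ℝ} (hk : ∀ j, k j ∈ Ioo 0 (2 * Real.pi)) :
    0 < ∏ j, Real.sin (k j / 2) ^ (2 / N : ℝ) :=
  Finset.prod_pos fun j _ => Real.rpow_pos_of_pos (sin_half_pos (hk j)) _

theorem ae_torus_mem_Ioo (N : ℕ) :
    ∀ᵐ k ∂(volume : Measure (Fin N → ℝ)).restrict (torus N), ∀ j, k j ∈ Ioo 0 (2 * Real.pi) := by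
  rw [volume_restrict_torus]
  refine (ae_restrict_iff' (MeasurableSet.univ_pi fun _ => measurableSet_Ioo)).2
    (ae_of_all _ fun k hk j => hk j (mem_univ j))

/-- The dominating product has exponent `-(α / N)` in each variable, integrable precisely because `α
< N`. -/
theorem integrableOn_symbol_rpow {N : ℕ} {α : ℝ} (hα : 0 < α) (hαN : α < N) :
    IntegrableOn (fun k : Fin N → ℝ => symbol k ^ (-(α / 2))) (torus N) := by
  have hN' : (0 : ℝ) < N := hα.trans hαN
  have hN : 0 < N := by exact_mod_cast hN'
  have hprod : IntegrableOn (fun k : Fin N → ℝ => ∏ j, Real.sin (k j / 2) ^ (-(α / N)))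
      (torus N) := by
    unfold IntegrableOn
    rw [volume_restrict_torus, volume_pi, Measure.restrict_pi_pi]
    exact Integrable.fintype_prod (f := fun _ (t : ℝ) => Real.sin (t / 2) ^ (-(α / N)))
      fun _ => integrableOn_sin_half_rpow (by positivity) ((div_lt_one hN').2 hαN)
  refine Integrable.mono' hprod (continuous_symbol.measurable.pow_const _).aestronglyMeasurable ?_
  filter_upwards [ae_torus_mem_Ioo N] with k hk
  rw [Real.norm_of_nonneg (Real.rpow_nonneg (symbol_nonneg k) _)]
  refine (Real.rpow_le_rpow_of_nonpos (prod_sin_pos hk) (prod_sin_le_symbol hN hk)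
    (by linarith)).trans_eq ?_
  rw [← Real.finsetProd_rpow _ _ fun j _ => Real.rpow_nonneg (sin_half_pos (hk j)).le _]
  refine Finset.prod_congr rfl fun j _ => ?_
  rw [← Real.rpow_mul (sin_half_pos (hk j)).le]
  congr 1; field_simp

/-- The pairing `x · k` of a lattice point with a frequency. -/
def pairing {N : ℕ} (x : Fin N → ℤ) (k : Fin N → ℝ) : ℝ := ∑ j, (x j : ℝ) * k j

theorem continuous_pairing {N : ℕ} (x : Fin N → ℤ) : Continuous (pairing x) := by
  unfold pairing; fun_prop

/-! ### Nonnegativity of Fourier coefficients. -/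

theorem integral_exp_int_mul (n : ℤ) :
    ∫ t in Icc 0 (2 * Real.pi), Complex.exp (Complex.I * ((n * t : ℝ) : ℂ)) =
      ((if n = 0 then 2 * Real.pi else 0 : ℝ) : ℂ) := by
  rw [integral_Icc_eq_integral_Ioc, ← intervalIntegral.integral_of_le (by positivity)]
  by_cases hn : n = 0
  · simp [hn]
  · rw [if_neg hn]
    have hc : Complex.I * n ≠ 0 := mul_ne_zero Complex.I_ne_zero (by exact_mod_cast hn)
    have := integral_exp_mul_complex (a := 0) (b := 2 * Real.pi) hc
    simp only [Complex.ofReal_mul, Complex.ofReal_intCast, ← mul_assoc]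
    rw [this]
    have h1 : Complex.exp (Complex.I * n * ((2 * Real.pi : ℝ) : ℂ)) = 1 := by
      rw [← Complex.exp_int_mul_two_pi_mul_I n]
      congr 1; push_cast; ring
    rw [h1]; simp

/-- The integral factors over the coordinates, and each factor is `2π` or `0` by orthogonality of
characters. -/
theorem integral_cos_pairing_nonneg {N : ℕ} (x : Fin N → ℤ) :
    0 ≤ ∫ k in torus N, Real.cos (pairing x k) := by
  have hcos : ∀ k, Real.cos (pairing x k) =
      (∏ j, Complex.exp (Complex.I * (((x j : ℝ) * k j : ℝ) : ℂ))).re := fun k => by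
    rw [← Complex.exp_sum, ← Finset.mul_sum, ← Complex.ofReal_sum, mul_comm,
      Complex.exp_ofReal_mul_I_re, pairing]
  have hint : IntegrableOn
      (fun k : Fin N → ℝ => ∏ j, Complex.exp (Complex.I * (((x j : ℝ) * k j : ℝ) : ℂ)))
      (torus N) := by
    refine ContinuousOn.integrableOn_compact (isCompact_torus N) (Continuous.continuousOn ?_)
    fun_prop
  simp only [hcos]
  have h1 := integral_re (𝕜 := ℂ) hint
  simp only [RCLike.re_to_complex] at h1
  rw [h1, torus_eq_pi_Icc, volume_pi, Measure.restrict_pi_pi,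
    integral_fintype_prod_eq_prod
      (f := fun j (t : ℝ) => Complex.exp (Complex.I * (((x j : ℝ) * t : ℝ) : ℂ)))]
  simp only [integral_exp_int_mul, ← Complex.ofReal_prod, Complex.ofReal_re]
  refine Finset.prod_nonneg fun j _ => ?_
  split_ifs <;> positivity

theorem pairing_single {N : ℕ} (j : Fin N) (k : Fin N → ℝ) :
    pairing (Pi.single j 1) k = k j := by
  simp [pairing, Pi.single_apply]

theorem pairing_add {N : ℕ} (x y : Fin N → ℤ) (k : Fin N → ℝ) :
    pairing (x + y) k = pairing x k + pairing y k := by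
  simp [pairing, add_mul, Finset.sum_add_distrib]

theorem pairing_neg {N : ℕ} (x : Fin N → ℤ) (k : Fin N → ℝ) :
    pairing (-x) k = -pairing x k := by
  simp [pairing]

/-- Multiplication by `2 cos k_j` replaces the frequency `x` by the two frequencies `x ± e_j`, with
coefficient `1` each, so nonnegativity propagates by induction. -/
theorem integral_cos_pairing_mul_pow_nonneg {N : ℕ} (n : ℕ) (x : Fin N → ℤ) :
    0 ≤ ∫ k in torus N, Real.cos (pairing x k) * (2 * ∑ j, Real.cos (k j)) ^ n := by
  induction n generalizing x with
  | zero => simpa using integral_cos_pairing_nonneg x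
  | succ n ih =>
    have hint : ∀ y : Fin N → ℤ, IntegrableOn
        (fun k : Fin N → ℝ => Real.cos (pairing y k) * (2 * ∑ j, Real.cos (k j)) ^ n)
        (torus N) := fun y => by
      refine integrableOn_torus_of_continuous ?_
      have := continuous_pairing y
      fun_prop
    have hexp : ∀ k : Fin N → ℝ, Real.cos (pairing x k) * (2 * ∑ j, Real.cos (k j)) ^ (n + 1) =
        ∑ j, (Real.cos (pairing (x + Pi.single j 1) k) * (2 * ∑ j, Real.cos (k j)) ^ n +
          Real.cos (pairing (x + -Pi.single j 1) k) * (2 * ∑ j, Real.cos (k j)) ^ n) := fun k => by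
      simp only [pairing_add, pairing_neg, pairing_single, Real.cos_add, Real.cos_neg, Real.sin_neg]
      rw [pow_succ, Finset.mul_sum, mul_comm (_ ^ n), ← mul_assoc, Finset.mul_sum,
        Finset.sum_mul]
      refine Finset.sum_congr rfl fun j _ => ?_
      ring
    simp only [hexp]
    rw [integral_finsetSum]
    swap
    · exact fun j _ => (hint _).add (hint _)
    refine Finset.sum_nonneg fun j _ => ?_
    rw [integral_add (hint _) (hint _)]
    exact add_nonneg (ih _) (ih _)

/-- Positivity of the heat kernel: up to the factor `exp (-2Nt)`, the exponential is the power
series of `exp (t S)` with `S = 2 ∑ cos k_j`, and its coefficients are nonnegative. -/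
theorem integral_cos_pairing_mul_exp_nonneg {N : ℕ} (x : Fin N → ℤ) {t : ℝ} (ht : 0 ≤ t) :
    0 ≤ ∫ k in torus N, Real.cos (pairing x k) * Real.exp (-(symbol k * t)) := by
  set S : (Fin N → ℝ) → ℝ := fun k => 2 * ∑ j, Real.cos (k j) with hS
  have hScont : Continuous S := by fun_prop
  have hSb : ∀ k, |S k| ≤ 2 * N := fun k => by
    rw [hS, abs_mul, abs_two]
    refine mul_le_mul_of_nonneg_left ((Finset.abs_sum_le_sum_abs _ _).trans ?_) (by norm_num)
    exact (Finset.sum_le_sum fun j _ => Real.abs_cos_le_one (k j)).trans (by simp)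
  have hcp := continuous_pairing x
  have hexp : ∀ k : Fin N → ℝ, Real.cos (pairing x k) * Real.exp (-(symbol k * t)) =
      Real.exp (-(2 * N * t)) * ∑' n : ℕ, Real.cos (pairing x k) * (t * S k) ^ n / n.factorial := by
    intro k
    have h1 : Real.exp (-(symbol k * t)) = Real.exp (-(2 * N * t)) * Real.exp (t * S k) := by
      rw [← Real.exp_add]; congr 1; simp only [symbol, hS]; ring
    have h2 := (NormedSpace.expSeries_div_hasSum_exp (t * S k)).mul_left (Real.cos (pairing x k))
    rw [← Real.exp_eq_exp_ℝ] at h2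
    simp only [← mul_div_assoc] at h2
    rw [h2.tsum_eq, h1]; ring
  simp only [hexp]
  rw [integral_const_mul]
  refine mul_nonneg (Real.exp_pos _).le ?_
  have hcont : ∀ n : ℕ, Continuous fun k => Real.cos (pairing x k) * (t * S k) ^ n / n.factorial :=
    fun n => by fun_prop
  -- Since `|S| ≤ 2N`, the exponential series of `2Nt` dominates and permits termwise integration.
  have hsum := hasSum_integral_of_summable_integral_norm (μ := volume.restrict (torus N))
    (F := fun (n : ℕ) k => Real.cos (pairing x k) * (t * S k) ^ n / n.factorial)
    (fun n => integrableOn_torus_of_continuous (hcont n)) (by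
      refine Summable.of_nonneg_of_le (fun n => integral_nonneg fun _ => norm_nonneg _) (fun n => ?_)
        ((Real.summable_pow_div_factorial (t * (2 * N))).mul_left
          ((volume : Measure (Fin N → ℝ)).real (torus N)))
      calc ∫ k in torus N, ‖Real.cos (pairing x k) * (t * S k) ^ n / n.factorial‖
          ≤ ∫ k in torus N, (t * (2 * N)) ^ n / n.factorial := by
            refine integral_mono (integrableOn_torus_of_continuous (hcont n).norm)
              (integrableOn_torus_of_continuous continuous_const) fun k => ?_
            simp only [norm_div, norm_mul, norm_pow, Real.norm_eq_abs, Nat.abs_cast, abs_of_nonneg ht]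
            refine div_le_div_of_nonneg_right ?_ (by positivity)
            refine (mul_le_of_le_one_left (by positivity) (Real.abs_cos_le_one _)).trans ?_
            exact pow_le_pow_left₀ (by positivity) (mul_le_mul_of_nonneg_left (hSb k) ht) n
        _ = _ := by simp)
  rw [← hsum.tsum_eq]
  refine tsum_nonneg fun n => ?_
  have : ∀ k, Real.cos (pairing x k) * (t * S k) ^ n / n.factorial =
      t ^ n / n.factorial * (Real.cos (pairing x k) * S k ^ n) := fun k => by
    rw [mul_pow]; ring
  simp only [this]
  rw [integral_const_mul]
  exact mul_nonneg (by positivity) (integral_cos_pairing_mul_pow_nonneg n x)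

/-- Subordination: `Γ(s) μ^(-s) = ∫ t^(s-1) exp (-(μ t)) dt` with `s = α / 2`, and Fubini reduces
the claim to the heat kernel at each time `t`. -/
theorem integral_cos_pairing_mul_symbol_nonneg {N : ℕ} {α : ℝ} (hα : 0 < α) (hαN : α < N)
    (x : Fin N → ℤ) :
    0 ≤ ∫ k in torus N, Real.cos (pairing x k) * symbol k ^ (-(α / 2)) := by
  have hN' : (0 : ℝ) < N := hα.trans hαN
  have hN : 0 < N := by exact_mod_cast hN'
  set s := α / 2 with hs
  have hs0 : 0 < s := by positivity
  have hG := Real.Gamma_pos_of_pos hs0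
  -- The Gamma formula needs a positive symbol; its zeros lie on the boundary of the torus, a null
  -- set.
  have hpos : ∀ᵐ k ∂(volume : Measure (Fin N → ℝ)).restrict (torus N), 0 < symbol k := by
    filter_upwards [ae_torus_mem_Ioo N] with k hk
    exact (prod_sin_pos hk).trans_le (prod_sin_le_symbol hN hk)
  have hcp := continuous_pairing x
  have hcs := continuous_symbol (N := N)
  have hmeas : Measurable fun q : (Fin N → ℝ) × ℝ =>
      Real.cos (pairing x q.1) * (q.2 ^ (s - 1) * Real.exp (-(symbol q.1 * q.2))) := by
    have := hcp.measurable
    have := hcs.measurable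
    fun_prop
  have hGam : ∀ k : Fin N → ℝ, 0 < symbol k →
      ∫ t in Ioi (0 : ℝ), t ^ (s - 1) * Real.exp (-(symbol k * t)) =
        symbol k ^ (-s) * Real.Gamma s := fun k hk => by
    rw [Real.integral_rpow_mul_exp_neg_mul_Ioi hs0 hk, one_div, Real.inv_rpow hk.le,
      Real.rpow_neg hk.le]
  have hint : Integrable (Function.uncurry fun (k : Fin N → ℝ) (t : ℝ) =>
      Real.cos (pairing x k) * (t ^ (s - 1) * Real.exp (-(symbol k * t))))
      ((volume.restrict (torus N)).prod (volume.restrict (Ioi 0))) := by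
    refine (integrable_prod_iff hmeas.aestronglyMeasurable).2 ⟨?_, ?_⟩
    · filter_upwards [hpos] with k hk
      have := integrableOn_rpow_mul_exp_neg_mul_rpow (s := s - 1) (p := 1) (b := symbol k)
        (by linarith) one_pos hk
      simp only [Real.rpow_one, neg_mul] at this
      exact this.const_mul _
    · have hI := ((integrableOn_symbol_rpow hα hαN).mul_const (Real.Gamma s)).bdd_mul (c := 1)
        (f := fun k => |Real.cos (pairing x k)|)
        (Continuous.aestronglyMeasurable (by fun_prop))
        (ae_of_all _ fun k => by simpa using Real.abs_cos_le_one _)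
      refine hI.congr ?_
      filter_upwards [hpos] with k hk
      rw [← hGam k hk, ← integral_const_mul]
      refine setIntegral_congr_fun measurableSet_Ioi fun t ht => ?_
      have ht' : (0 : ℝ) < t := ht
      simp only [norm_mul, Real.norm_eq_abs, Real.abs_exp]
      rw [abs_of_nonneg (Real.rpow_nonneg ht'.le _)]
  have hswap := integral_integral_swap hint
  have hleft : ∫ k in torus N, ∫ t in Ioi (0 : ℝ),
      Real.cos (pairing x k) * (t ^ (s - 1) * Real.exp (-(symbol k * t))) =
      (∫ k in torus N, Real.cos (pairing x k) * symbol k ^ (-s)) * Real.Gamma s := by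
    rw [← integral_mul_const]
    refine integral_congr_ae ?_
    filter_upwards [hpos] with k hk
    rw [integral_const_mul, hGam k hk, mul_assoc]
  rw [hleft] at hswap
  refine nonneg_of_mul_nonneg_left ?_ hG
  rw [hswap]
  refine setIntegral_nonneg measurableSet_Ioi fun t ht => ?_
  have ht' : (0 : ℝ) < t := ht
  have : ∀ k, Real.cos (pairing x k) * (t ^ (s - 1) * Real.exp (-(symbol k * t))) =
      t ^ (s - 1) * (Real.cos (pairing x k) * Real.exp (-(symbol k * t))) := fun k => by ring
  simp only [this]
  rw [integral_const_mul]
  exact mul_nonneg (Real.rpow_nonneg ht'.le _) (integral_cos_pairing_mul_exp_nonneg x ht'.le)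

/-! ### Symmetry and bounds of the Green's function. -/

theorem fracDegree_nonneg (N : ℕ) (α : ℝ) : 0 ≤ fracDegree N α := by
  unfold fracDegree
  exact mul_nonneg (by positivity) (integral_nonneg fun k => Real.rpow_nonneg (symbol_nonneg k) _)

theorem integrableOn_cos_pairing_mul_symbol {N : ℕ} {α : ℝ} (hα : 0 < α) (hαN : α < N)
    (x : Fin N → ℤ) :
    IntegrableOn (fun k => Real.cos (pairing x k) * symbol k ^ (-(α / 2))) (torus N) :=
  (integrableOn_symbol_rpow hα hαN).bdd_mul (c := 1)
    (Real.continuous_cos.comp (continuous_pairing x)).aestronglyMeasurable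
    (ae_of_all _ fun _ => by simpa using Real.abs_cos_le_one _)

theorem green_eq {N : ℕ} {α : ℝ} (hα : 0 < α) (hαN : α < N) (x y : Fin N → ℤ) :
    green α x y = fracDegree N α / (2 * Real.pi) ^ N *
      ∫ k in torus N, Real.cos (pairing (x - y) k) * symbol k ^ (-(α / 2)) := by
  have hint : IntegrableOn (fun k : Fin N → ℝ =>
      Complex.exp (Complex.I * ((∑ j, ((x j - y j : ℤ) : ℝ) * k j : ℝ) : ℂ)) *
        ((symbol k ^ (-(α / 2)) : ℝ) : ℂ)) (torus N) := by
    refine (integrableOn_symbol_rpow hα hαN).ofReal.bdd_mul (c := 1)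
      (Continuous.aestronglyMeasurable (by fun_prop)) (ae_of_all _ fun k => ?_)
    rw [mul_comm, Complex.norm_exp_ofReal_mul_I]
  have h1 := integral_re (𝕜 := ℂ) hint
  simp only [RCLike.re_to_complex] at h1
  rw [green, Complex.re_ofReal_mul, ← h1]
  congr 2
  funext k
  rw [Complex.re_mul_ofReal, mul_comm Complex.I, Complex.exp_ofReal_mul_I_re]
  rfl

theorem green_nonneg {N : ℕ} {α : ℝ} (hα : 0 < α) (hαN : α < N) (x y : Fin N → ℤ) :
    0 ≤ green α x y := by
  rw [green_eq hα hαN]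
  exact mul_nonneg (div_nonneg (fracDegree_nonneg N α) (by positivity))
    (integral_cos_pairing_mul_symbol_nonneg hα hαN _)

theorem green_comm {N : ℕ} {α : ℝ} (hα : 0 < α) (hαN : α < N) (x y : Fin N → ℤ) :
    green α x y = green α y x := by
  rw [green_eq hα hαN, green_eq hα hαN, ← neg_sub]
  simp only [pairing_neg, Real.cos_neg]

theorem green_le_diag {N : ℕ} {α : ℝ} (hα : 0 < α) (hαN : α < N) (x y : Fin N → ℤ) :
    green α x y ≤ green α (0 : Fin N → ℤ) 0 := by
  rw [green_eq hα hαN, green_eq hα hαN]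
  refine mul_le_mul_of_nonneg_left ?_ (div_nonneg (fracDegree_nonneg N α) (by positivity))
  refine integral_mono (integrableOn_cos_pairing_mul_symbol hα hαN _)
    (integrableOn_cos_pairing_mul_symbol hα hαN _) fun k => ?_
  refine mul_le_mul_of_nonneg_right ?_ (Real.rpow_nonneg (symbol_nonneg k) _)
  simpa [pairing] using Real.cos_le_one _

/-! ### Sums of mixed powers -/

/-- A crude Young inequality, through the maximum of the two numbers; sharp constants play no role
below. -/
theorem rpow_mul_rpow_le_add {x y r s p : ℝ} (hx : 0 ≤ x) (hy : 0 ≤ y) (hr : 0 ≤ r) (hs : 0 ≤ s)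
    (hp : 0 < p) (hrs : r + s = p) : x ^ r * y ^ s ≤ x ^ p + y ^ p := by
  have hm : 0 ≤ max x y := hx.trans (le_max_left _ _)
  calc x ^ r * y ^ s ≤ max x y ^ r * max x y ^ s := by gcongr <;> simp
    _ = max x y ^ p := by rw [← Real.rpow_add' hm (by rw [hrs]; exact hp.ne'), hrs]
    _ ≤ x ^ p + y ^ p := by
      rcases max_choice x y with h | h <;> rw [h]
      · exact le_add_of_nonneg_right (Real.rpow_nonneg hy _)
      · exact le_add_of_nonneg_left (Real.rpow_nonneg hx _)

theorem summable_rpow_mul_rpow {ι : Type*} {a b : ι → ℝ} {r s p : ℝ} (ha : ∀ i, 0 ≤ a i)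
    (hb : ∀ i, 0 ≤ b i) (hr : 0 ≤ r) (hs : 0 ≤ s) (hp : 0 < p) (hrs : r + s = p)
    (hsa : Summable fun i => a i ^ p) (hsb : Summable fun i => b i ^ p) :
    Summable fun i => a i ^ r * b i ^ s :=
  Summable.of_nonneg_of_le
    (fun i => mul_nonneg (Real.rpow_nonneg (ha i) _) (Real.rpow_nonneg (hb i) _))
    (fun i => rpow_mul_rpow_le_add (ha i) (hb i) hr hs hp hrs) (hsa.add hsb)

/-- A Hölder inequality, up to a factor `2`, for exponents `r + s = p`. -/
theorem tsum_rpow_mul_rpow_le {ι : Type*} {a b : ι → ℝ} {r s p A B : ℝ} (ha : ∀ i, 0 ≤ a i)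
    (hb : ∀ i, 0 ≤ b i) (hr : 0 ≤ r) (hs : 0 < s) (hp : 0 < p) (hrs : r + s = p)
    (hsa : Summable fun i => a i ^ p) (hsb : Summable fun i => b i ^ p)
    (hA : 0 ≤ A) (hB : 0 ≤ B) (haA : ∑' i, a i ^ p ≤ A ^ p) (hbB : ∑' i, b i ^ p ≤ B ^ p) :
    ∑' i, a i ^ r * b i ^ s ≤ 2 * A ^ r * B ^ s := by
  have hvanish : ∀ {c : ι → ℝ} {C : ℝ}, (∀ i, 0 ≤ c i) → (Summable fun i => c i ^ p) →
      ∑' i, c i ^ p ≤ C ^ p → C = 0 → ∀ i, c i = 0 := by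
    intro c C hc hsc hle hC i
    rw [hC, Real.zero_rpow hp.ne'] at hle
    have h1 : c i ^ p ≤ 0 :=
      (hsc.le_tsum i fun j _ => Real.rpow_nonneg (hc j) _).trans hle
    have h2 : c i ^ p = 0 := le_antisymm h1 (Real.rpow_nonneg (hc i) _)
    exact (Real.rpow_eq_zero (hc i) hp.ne').1 h2
  rcases hB.eq_or_lt with hB0 | hB0
  · have := hvanish hb hsb hbB hB0.symm
    simp only [this, Real.zero_rpow hs.ne', mul_zero, tsum_zero]
    positivity
  rcases hA.eq_or_lt with hA0 | hA0
  · have h0 := hvanish ha hsa haA hA0.symm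
    -- For `r = 0` the vanishing of `a` does not kill the sum, because `0 ^ 0 = 1`.
    rcases hr.eq_or_lt with hr0 | hr0
    · have hsp : s = p := by linarith
      rw [← hr0, hsp]
      simp only [Real.rpow_zero, one_mul, mul_one]
      have : 0 ≤ B ^ p := Real.rpow_nonneg hB _
      linarith
    · simp only [h0, Real.zero_rpow hr0.ne', zero_mul, tsum_zero]
      positivity
  -- Young's inequality for the normalized numbers `a i / A` and `b i / B`; the two normalized sums
  -- are at most `1`, whence the factor `2`.
  have hterm : ∀ i, a i ^ r * b i ^ s ≤
      A ^ r * B ^ s * (A ^ (-p) * a i ^ p + B ^ (-p) * b i ^ p) := fun i => by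
    have h1 := rpow_mul_rpow_le_add (div_nonneg (ha i) hA) (div_nonneg (hb i) hB) hr hs.le hp hrs
    rw [Real.div_rpow (ha i) hA, Real.div_rpow (hb i) hB, Real.div_rpow (ha i) hA,
      Real.div_rpow (hb i) hB] at h1
    have hAr : 0 < A ^ r := Real.rpow_pos_of_pos hA0 _
    have hBs : 0 < B ^ s := Real.rpow_pos_of_pos hB0 _
    have h2 := mul_le_mul_of_nonneg_left h1 (mul_pos hAr hBs).le
    rw [Real.rpow_neg hA, Real.rpow_neg hB]
    calc a i ^ r * b i ^ s = A ^ r * B ^ s * (a i ^ r / A ^ r * (b i ^ s / B ^ s)) := by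
          field_simp
      _ ≤ _ := h2
      _ = _ := by simp only [div_eq_mul_inv]; ring
  have hsum : Summable fun i => A ^ r * B ^ s * (A ^ (-p) * a i ^ p + B ^ (-p) * b i ^ p) :=
    ((hsa.mul_left _).add (hsb.mul_left _)).mul_left _
  refine ((summable_rpow_mul_rpow ha hb hr hs.le hp hrs hsa hsb).tsum_le_tsum hterm hsum).trans ?_
  rw [tsum_mul_left, Summable.tsum_add (hsa.mul_left _) (hsb.mul_left _), tsum_mul_left,
    tsum_mul_left]
  have e1 : A ^ (-p) * ∑' i, a i ^ p ≤ 1 := by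
    rw [Real.rpow_neg hA, inv_mul_le_iff₀ (Real.rpow_pos_of_pos hA0 _)]; linarith
  have e2 : B ^ (-p) * ∑' i, b i ^ p ≤ 1 := by
    rw [Real.rpow_neg hB, inv_mul_le_iff₀ (Real.rpow_pos_of_pos hB0 _)]; linarith
  have : 0 ≤ A ^ r * B ^ s := by positivity
  nlinarith

/-! ### Growth of the nonlinearity on bounded sets -/

section Growth

variable {f : ℝ → ℝ} {p : ℝ}

/-- The punctured neighbourhood says nothing about `f 0`; continuity carries the inequality to the
origin. -/
theorem exists_growth_near_zero (hf : Continuous f)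
    (hf0 : f =o[𝓝[≠] 0] fun t : ℝ => |t| ^ (p - 1)) (hp : 2 ≤ p) {ε : ℝ} (hε : 0 < ε) :
    ∃ δ > 0, ∀ t, |t| ≤ δ → |f t| ≤ ε * |t| ^ (p - 1) := by
  have h1 := hf0.def hε
  rw [eventually_nhdsWithin_iff, Metric.eventually_nhds_iff] at h1
  obtain ⟨δ, hδ, h⟩ := h1
  have hne : ∀ t, t ≠ 0 → |t| < δ → |f t| ≤ ε * |t| ^ (p - 1) := fun t ht htd => by
    have := h (y := t) (by simpa using htd) ht
    simpa [Real.norm_eq_abs, abs_of_nonneg (Real.rpow_nonneg (abs_nonneg t) _)] using this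
  have hpos : 0 < p - 1 := by linarith
  have h0 : |f 0| ≤ ε * |(0 : ℝ)| ^ (p - 1) := by
    have hc : Continuous fun t : ℝ => ε * |t| ^ (p - 1) - |f t| :=
      (continuous_const.mul (continuous_abs.rpow_const fun _ => Or.inr hpos.le)).sub hf.abs
    have hlim : Tendsto (fun t : ℝ => ε * |t| ^ (p - 1) - |f t|) (𝓝[≠] 0)
        (𝓝 (ε * |(0 : ℝ)| ^ (p - 1) - |f 0|)) := (hc.tendsto 0).mono_left nhdsWithin_le_nhds
    have := ge_of_tendsto hlim (b := 0) (by
      rw [eventually_nhdsWithin_iff, Metric.eventually_nhds_iff]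
      exact ⟨δ, hδ, fun t htd ht => sub_nonneg.2 (hne t ht (by simpa using htd))⟩)
    linarith
  refine ⟨δ / 2, by positivity, fun t ht => ?_⟩
  by_cases htz : t = 0
  · subst htz; exact h0
  · exact hne t htz (by linarith)

theorem exists_growth_bound (hf : Continuous f)
    (hf0 : f =o[𝓝[≠] 0] fun t : ℝ => |t| ^ (p - 1)) (hp : 2 ≤ p) (M : ℝ) :
    ∃ C, 0 ≤ C ∧ ∀ t, |t| ≤ M → |f t| ≤ C * |t| ^ (p - 1) := by
  obtain ⟨δ, hδ, h⟩ := exists_growth_near_zero hf hf0 hp one_pos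
  obtain ⟨B, hB⟩ := (isCompact_Icc (a := -M) (b := M)).exists_bound_of_continuousOn hf.continuousOn
  have hδp : 0 < δ ^ (p - 1) := Real.rpow_pos_of_pos hδ _
  refine ⟨1 + |B| / δ ^ (p - 1), by positivity, fun t ht => ?_⟩
  have h0 : 0 ≤ |t| ^ (p - 1) := Real.rpow_nonneg (abs_nonneg _) _
  rcases le_total |t| δ with h' | h'
  · refine (h t h').trans (mul_le_mul_of_nonneg_right ?_ h0)
    exact le_add_of_nonneg_right (by positivity)
  · have h1 : |f t| ≤ |B| := (hB t (abs_le.1 ht)).trans (le_abs_self _)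
    have h2 : δ ^ (p - 1) ≤ |t| ^ (p - 1) := Real.rpow_le_rpow hδ.le h' (by linarith)
    calc |f t| ≤ |B| / δ ^ (p - 1) * δ ^ (p - 1) := by rwa [div_mul_cancel₀ _ hδp.ne']
      _ ≤ |B| / δ ^ (p - 1) * |t| ^ (p - 1) := mul_le_mul_of_nonneg_left h2 (by positivity)
      _ ≤ _ := mul_le_mul_of_nonneg_right (by linarith) h0

/-- A plain error `ε` would not be summable over the lattice; this form can be paired with an
element of `ℓ^p` by Hölder. For small `a` both values of `f` are small by the behaviour at `0`; for
`|a| ≥ δ / 2` the modulus of uniform continuity is absorbed in `ε |a|^(p-1)`. -/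
theorem exists_modulus (hf : Continuous f)
    (hf0 : f =o[𝓝[≠] 0] fun t : ℝ => |t| ^ (p - 1)) (hp : 2 ≤ p) (M : ℝ) {ε : ℝ} (hε : 0 < ε) :
    ∃ η > 0, ∀ a ξ, |a| ≤ M → |ξ - a| ≤ η →
      |f ξ - f a| ≤ ε * (|a| ^ (p - 1) + |ξ - a| ^ (p - 1)) := by
  have hp1 : 0 < p - 1 := by linarith
  -- The `1` pays for `f a` and the `2 ^ (p - 1)` for `f ξ`, through `|ξ| ≤ 2 max |a| |ξ - a|`.
  set ε' := ε / (1 + 2 ^ (p - 1)) with hε'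
  have h2p : (0 : ℝ) < 2 ^ (p - 1) := by positivity
  have hε'0 : 0 < ε' := by positivity
  obtain ⟨δ, hδ, h⟩ := exists_growth_near_zero hf hf0 hp hε'0
  have hδ2 : 0 < (δ / 2) ^ (p - 1) := by positivity
  have huc := (isCompact_Icc (a := -(M + 1)) (b := M + 1)).uniformContinuousOn_of_continuous
    hf.continuousOn
  rw [Metric.uniformContinuousOn_iff] at huc
  obtain ⟨η, hη, hu⟩ := huc (ε * (δ / 2) ^ (p - 1)) (by positivity)
  refine ⟨min (min (δ / 2) 1) (η / 2), by positivity, fun a ξ ha hξ => ?_⟩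
  have hξ1 : |ξ - a| ≤ δ / 2 := hξ.trans ((min_le_left _ _).trans (min_le_left _ _))
  have hξ2 : |ξ - a| ≤ 1 := hξ.trans ((min_le_left _ _).trans (min_le_right _ _))
  have hξ3 : |ξ - a| ≤ η / 2 := hξ.trans (min_le_right _ _)
  have hξa : |ξ| ≤ |a| + |ξ - a| := by
    have := abs_add_le a (ξ - a); rwa [add_sub_cancel] at this
  have hA := Real.rpow_nonneg (abs_nonneg a) (p - 1)
  have hX := Real.rpow_nonneg (abs_nonneg (ξ - a)) (p - 1)
  rcases le_total |a| (δ / 2) with h' | h'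
  · have b1 := h a (by linarith)
    have b2 := h ξ (by linarith)
    have b3 : |ξ| ^ (p - 1) ≤ 2 ^ (p - 1) * (|a| ^ (p - 1) + |ξ - a| ^ (p - 1)) := by
      have hm : |ξ| ≤ 2 * max |a| |ξ - a| := by
        linarith [le_max_left |a| |ξ - a|, le_max_right |a| |ξ - a|]
      refine (Real.rpow_le_rpow (abs_nonneg _) hm hp1.le).trans ?_
      rw [Real.mul_rpow (by norm_num) (le_max_of_le_left (abs_nonneg _))]
      refine mul_le_mul_of_nonneg_left ?_ h2p.le
      rcases max_choice |a| |ξ - a| with hc | hc <;> rw [hc] <;> linarith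
    have b4 : |f ξ - f a| ≤ |f ξ| + |f a| := abs_sub _ _
    have b5 : ε = ε' * (1 + 2 ^ (p - 1)) := by rw [hε']; field_simp
    rw [b5]
    nlinarith [mul_le_mul_of_nonneg_left b3 hε'0.le, mul_nonneg hε'0.le hX]
  · have hxm : ξ ∈ Icc (-(M + 1)) (M + 1) := abs_le.1 (by linarith)
    have ham : a ∈ Icc (-(M + 1)) (M + 1) := abs_le.1 (by linarith)
    have := hu ξ hxm a ham (by rw [Real.dist_eq]; linarith)
    rw [Real.dist_eq] at this
    refine this.le.trans (mul_le_mul_of_nonneg_left ?_ hε.le)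
    have := Real.rpow_le_rpow (by positivity) h' hp1.le
    linarith

theorem hasDerivAt_primitive (hf : Continuous f) (t : ℝ) : HasDerivAt (primitive f) (f t) t :=
  intervalIntegral.integral_hasDerivAt_right (hf.intervalIntegrable _ _)
    (hf.stronglyMeasurableAtFilter _ _) hf.continuousAt

/-- The mean value inequality for `primitive f t - c * t`. -/
theorem abs_primitive_sub_le (hf : Continuous f) {c C a b : ℝ}
    (h : ∀ ξ ∈ uIcc a b, |f ξ - c| ≤ C) :
    |primitive f a - primitive f b - c * (a - b)| ≤ C * |a - b| := by
  have := Convex.norm_image_sub_le_of_norm_hasDerivWithin_le (s := uIcc a b)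
    (f := fun t => primitive f t - c * t) (f' := fun t => f t - c) (x := b) (y := a) (C := C)
    (fun x _ => ((hasDerivAt_primitive hf x).sub
      (by simpa using (hasDerivAt_id x).const_mul c)).hasDerivWithinAt)
    h (convex_uIcc a b) right_mem_uIcc left_mem_uIcc
  simp only [Real.norm_eq_abs] at this
  convert this using 2
  ring

theorem primitive_zero : primitive f 0 = 0 := by simp [primitive]

theorem exists_primitive_growth_bound (hf : Continuous f)
    (hf0 : f =o[𝓝[≠] 0] fun t : ℝ => |t| ^ (p - 1)) (hp : 2 ≤ p) (M : ℝ) :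
    ∃ C, 0 ≤ C ∧ ∀ t, |t| ≤ M → |primitive f t| ≤ C * |t| ^ p := by
  obtain ⟨C, hC, h⟩ := exists_growth_bound hf hf0 hp M
  refine ⟨C, hC, fun t ht => ?_⟩
  have key := abs_primitive_sub_le hf (c := 0) (C := C * |t| ^ (p - 1)) (a := t) (b := 0) (by
    intro ξ hξ
    have hle : |ξ| ≤ |t| := by
      have := abs_sub_left_of_mem_uIcc (uIcc_comm t 0 ▸ hξ)
      simpa using this
    rw [sub_zero]
    refine (h ξ (hle.trans ht)).trans (mul_le_mul_of_nonneg_left ?_ hC)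
    exact Real.rpow_le_rpow (abs_nonneg _) hle (by linarith))
  rw [primitive_zero] at key
  simp only [sub_zero, zero_mul] at key
  refine key.trans_eq ?_
  rw [mul_assoc]
  congr 1
  nth_rewrite 2 [← Real.rpow_one |t|]
  rw [← Real.rpow_add' (abs_nonneg _) (by linarith)]
  congr 1; ring

end Growth

/-! ### Superposition operators from `ℓ^p` to `ℓ^1` -/

/-- The sequence space `ℓ^p` over an index type, for a real exponent. -/
abbrev Ell (ι : Type*) (p : ℝ) := lp (fun _ : ι => ℝ) (ENNReal.ofReal p)

/-- The sequence space `ℓ^1`. -/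
abbrev EllOne (ι : Type*) := lp (fun _ : ι => ℝ) 1

section Superposition

variable {ι : Type*} {p : ℝ}

theorem EllOne.norm_eq (a : EllOne ι) : ‖a‖ = ∑' i, |a i| := by
  have := lp.norm_rpow_eq_tsum (p := 1) (by simp) a
  simpa using this

theorem EllOne.summable_abs (a : EllOne ι) : Summable fun i => |a i| := by
  have := (lp.memℓp a).summable (by simp)
  simpa using this

theorem EllOne.memℓp {a : ι → ℝ} (ha : Summable fun i => |a i|) : Memℓp a 1 :=
  memℓp_gen (by simpa using ha)

theorem Ell.summable_rpow (hp : 2 ≤ p) (u : Ell ι p) : Summable fun i => |u i| ^ p := by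
  have hp0 : 0 ≤ p := by linarith
  have := (lp.memℓp u).summable (by rw [ENNReal.toReal_ofReal hp0]; linarith)
  simpa [ENNReal.toReal_ofReal hp0] using this

theorem Ell.tsum_rpow (hp : 2 ≤ p) (u : Ell ι p) : ∑' i, |u i| ^ p = ‖u‖ ^ p := by
  have hp0 : 0 ≤ p := by linarith
  have := lp.norm_rpow_eq_tsum (by rw [ENNReal.toReal_ofReal hp0]; linarith) u
  simpa [ENNReal.toReal_ofReal hp0] using this.symm

theorem Ell.memℓp (hp : 2 ≤ p) {u : ι → ℝ} (hu : Summable fun i => |u i| ^ p) :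
    Memℓp u (ENNReal.ofReal p) :=
  memℓp_gen (by simpa [ENNReal.toReal_ofReal (show (0 : ℝ) ≤ p by linarith)] using hu)

theorem Ell.abs_apply_le (hp : 2 ≤ p) (u : Ell ι p) (i : ι) : |u i| ≤ ‖u‖ :=
  lp.norm_apply_le_norm (by
    rw [Ne, ENNReal.ofReal_eq_zero, not_le]; linarith) u i

theorem Ell.summable_rpow_mul [Fact (1 ≤ ENNReal.ofReal p)] (hp : 2 ≤ p) (u w : Ell ι p) :
    Summable fun i => |u i| ^ (p - 1) * |w i| := by
  simpa using summable_rpow_mul_rpow (r := p - 1) (s := 1) (fun i => abs_nonneg (u i))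
    (fun i => abs_nonneg (w i)) (by linarith) zero_le_one (by linarith) (by ring)
    (Ell.summable_rpow hp u) (Ell.summable_rpow hp w)

theorem Ell.tsum_rpow_mul_le [Fact (1 ≤ ENNReal.ofReal p)] (hp : 2 ≤ p) (u w : Ell ι p) :
    ∑' i, |u i| ^ (p - 1) * |w i| ≤ 2 * ‖u‖ ^ (p - 1) * ‖w‖ := by
  simpa using tsum_rpow_mul_rpow_le (r := p - 1) (s := 1) (fun i => abs_nonneg (u i))
    (fun i => abs_nonneg (w i)) (by linarith) one_pos (by linarith) (by ring)
    (Ell.summable_rpow hp u) (Ell.summable_rpow hp w) (norm_nonneg u) (norm_nonneg w)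
    (Ell.tsum_rpow hp u).le (Ell.tsum_rpow hp w).le

/-- A locally uniform growth bound `|g t| ≤ C |t|^q` on bounded sets. -/
def GrowthBound (g : ℝ → ℝ) (q : ℝ) : Prop :=
  ∀ M, ∃ C, 0 ≤ C ∧ ∀ t, |t| ≤ M → |g t| ≤ C * |t| ^ q

theorem GrowthBound.summable_comp {g : ℝ → ℝ} (hp : 2 ≤ p) (hg : GrowthBound g p) (u : Ell ι p) :
    Summable fun i => |g (u i)| := by
  obtain ⟨C, _, h⟩ := hg ‖u‖
  exact Summable.of_nonneg_of_le (fun _ => abs_nonneg _)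
    (fun i => h _ (Ell.abs_apply_le hp u i)) ((Ell.summable_rpow hp u).mul_left C)

theorem GrowthBound.summable_comp_mul {g : ℝ → ℝ} [Fact (1 ≤ ENNReal.ofReal p)] (hp : 2 ≤ p)
    (hg : GrowthBound g (p - 1)) (u w : Ell ι p) : Summable fun i => |g (u i) * w i| := by
  obtain ⟨C, _, h⟩ := hg ‖u‖
  refine Summable.of_nonneg_of_le (fun _ => abs_nonneg _) (fun i => ?_)
    ((Ell.summable_rpow_mul hp u w).mul_left C)
  rw [abs_mul, ← mul_assoc]
  exact mul_le_mul_of_nonneg_right (h _ (Ell.abs_apply_le hp u i)) (abs_nonneg _)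

/-- The superposition operator `u ↦ g ∘ u` from `ℓ^p` to `ℓ^1`. -/
def superposition {g : ℝ → ℝ} (hp : 2 ≤ p) (hg : GrowthBound g p) (u : Ell ι p) : EllOne ι :=
  ⟨fun i => g (u i), EllOne.memℓp (hg.summable_comp hp u)⟩

/-- The multiplication operator `w ↦ g(u) w` from `ℓ^p` to `ℓ^1`. -/
def mulSuperposition [Fact (1 ≤ ENNReal.ofReal p)] {g : ℝ → ℝ} (hp : 2 ≤ p)
    (hg : GrowthBound g (p - 1)) (u : Ell ι p) : Ell ι p →L[ℝ] EllOne ι :=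
  LinearMap.mkContinuousOfExistsBound
    { toFun := fun w => ⟨fun i => g (u i) * w i, EllOne.memℓp (hg.summable_comp_mul hp u w)⟩
      map_add' := fun v w => by ext i; exact mul_add _ _ _
      map_smul' := fun c w => by ext i; exact mul_left_comm _ _ _ } (by
    obtain ⟨C, hC, h⟩ := hg ‖u‖
    refine ⟨C * (2 * ‖u‖ ^ (p - 1)), fun w => ?_⟩
    rw [EllOne.norm_eq]
    refine (Summable.tsum_le_tsum (fun i => ?_) (hg.summable_comp_mul hp u w)
      ((Ell.summable_rpow_mul hp u w).mul_left C)).trans ?_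
    · rw [abs_mul, ← mul_assoc]
      exact mul_le_mul_of_nonneg_right (h _ (Ell.abs_apply_le hp u i)) (abs_nonneg _)
    · rw [tsum_mul_left, mul_assoc]
      exact mul_le_mul_of_nonneg_left (Ell.tsum_rpow_mul_le hp u w) hC)

theorem mulSuperposition_apply [Fact (1 ≤ ENNReal.ofReal p)] {g : ℝ → ℝ} (hp : 2 ≤ p)
    (hg : GrowthBound g (p - 1)) (u w : Ell ι p) (i : ι) :
    mulSuperposition hp hg u w i = g (u i) * w i := rfl

/-- At each site the mean value inequality and `exists_modulus` bound the error; Hölder then sums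
it. Strictness is needed later to compare two points that both move near `u`. -/
theorem hasStrictFDerivAt_superposition [Fact (1 ≤ ENNReal.ofReal p)] {f : ℝ → ℝ} (hp : 2 ≤ p)
    (hf : Continuous f) (hf0 : f =o[𝓝[≠] 0] fun t : ℝ => |t| ^ (p - 1))
    (hF : GrowthBound (primitive f) p) (hfg : GrowthBound f (p - 1)) (u : Ell ι p) :
    HasStrictFDerivAt (superposition (ι := ι) hp hF) (mulSuperposition hp hfg u) u := by
  rw [hasStrictFDerivAt_iff_isLittleO, Asymptotics.isLittleO_iff]
  intro c hc
  have hp1 : 0 < p - 1 := by linarith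
  -- Hölder's factor `2` times bounds for the three powers: `‖u‖ ^ (p - 1)`, and `1` each for `a -
  -- u` and `b - u`.
  set A := 2 * (‖u‖ ^ (p - 1) + 1 + 1) with hA
  have hA0 : 0 < A := by positivity
  obtain ⟨η, hη, hmod⟩ := exists_modulus hf hf0 hp ‖u‖ (ε := c / A) (by positivity)
  have hr : 0 < min η 1 := by positivity
  have hball : Metric.ball u (min η 1) ×ˢ Metric.ball u (min η 1) ∈ 𝓝 (u, u) :=
    prod_mem_nhds (Metric.ball_mem_nhds u hr) (Metric.ball_mem_nhds u hr)
  filter_upwards [hball] with q hq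
  obtain ⟨a, b⟩ := q
  obtain ⟨ha, hb⟩ := hq
  simp only [Metric.mem_ball, dist_eq_norm] at ha hb
  have hn1 : ∀ v : Ell ι p, ‖v‖ < min η 1 → ‖v‖ ^ (p - 1) ≤ 1 := fun v hv =>
    Real.rpow_le_one (norm_nonneg _) (hv.le.trans (min_le_right _ _)) hp1.le
  rw [EllOne.norm_eq]
  have hs1 := Ell.summable_rpow_mul hp u (a - b)
  have hs2 := Ell.summable_rpow_mul hp (a - u) (a - b)
  have hs3 := Ell.summable_rpow_mul hp (b - u) (a - b)
  have hbound : ∀ i, |(superposition hp hF a - superposition hp hF b -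
      mulSuperposition hp hfg u (a - b)) i| ≤ c / A * (|u i| ^ (p - 1) * |(a - b) i| +
        |(a - u) i| ^ (p - 1) * |(a - b) i| + |(b - u) i| ^ (p - 1) * |(a - b) i|) := fun i => by
    have h1 := abs_primitive_sub_le hf (c := f (u i)) (a := a i) (b := b i)
      (C := c / A * (|u i| ^ (p - 1) + |a i - u i| ^ (p - 1) + |b i - u i| ^ (p - 1))) (by
        intro ξ hξ
        -- A point between `a i` and `b i` is no farther from `u i` than the worse endpoint.
        have hle : |ξ - u i| ≤ max |a i - u i| |b i - u i| := by
          rw [mem_uIcc] at hξ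
          rcases hξ with ⟨h1, h2⟩ | ⟨h1, h2⟩
          · exact abs_le_max_abs_abs (by linarith) (by linarith)
          · rw [max_comm]; exact abs_le_max_abs_abs (by linarith) (by linarith)
        have ha' : |a i - u i| < min η 1 := (Ell.abs_apply_le hp (a - u) i).trans_lt ha
        have hb' : |b i - u i| < min η 1 := (Ell.abs_apply_le hp (b - u) i).trans_lt hb
        refine (hmod (u i) ξ (Ell.abs_apply_le hp u i)
          (hle.trans ((max_lt ha' hb').le.trans (min_le_left _ _)))).trans ?_
        refine mul_le_mul_of_nonneg_left ?_ (by positivity)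
        have e1 := Real.rpow_le_rpow (abs_nonneg _) hle hp1.le
        have e2 := Real.rpow_nonneg (abs_nonneg (a i - u i)) (p - 1)
        have e3 := Real.rpow_nonneg (abs_nonneg (b i - u i)) (p - 1)
        rcases max_choice |a i - u i| |b i - u i| with hm | hm <;> rw [hm] at e1 <;> linarith)
    refine h1.trans_eq ?_
    simp only [lp.coeFn_sub, Pi.sub_apply]
    ring
  refine (Summable.tsum_le_tsum hbound (EllOne.summable_abs _)
    (((hs1.add hs2).add hs3).mul_left _)).trans ?_
  rw [tsum_mul_left, Summable.tsum_add (hs1.add hs2) hs3, Summable.tsum_add hs1 hs2]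
  have t1 := Ell.tsum_rpow_mul_le hp u (a - b)
  have t2 := Ell.tsum_rpow_mul_le hp (a - u) (a - b)
  have t3 := Ell.tsum_rpow_mul_le hp (b - u) (a - b)
  have n0 := norm_nonneg (a - b)
  have m2 := mul_le_mul_of_nonneg_right (hn1 _ ha) n0
  have m3 := mul_le_mul_of_nonneg_right (hn1 _ hb) n0
  calc _ ≤ c / A * (A * ‖a - b‖) := by
        refine mul_le_mul_of_nonneg_left ?_ (by positivity)
        rw [hA]; nlinarith
    _ = c * ‖a - b‖ := by field_simp

end Superposition

/-! ### The bilinear form of a bounded kernel on `ℓ^1` -/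

section Kernel

variable {ι : Type*} {K : ι → ι → ℝ} {R : ℝ}

theorem summable_kernel_mul (hK : ∀ x y, |K x y| ≤ R) (a : EllOne ι) (x : ι) :
    Summable fun y => K x y * a y := by
  refine Summable.of_norm_bounded ((EllOne.summable_abs a).mul_left R) fun y => ?_
  rw [Real.norm_eq_abs, abs_mul]
  exact mul_le_mul_of_nonneg_right (hK x y) (abs_nonneg _)

theorem abs_tsum_kernel_mul_le (hK : ∀ x y, |K x y| ≤ R) (a : EllOne ι) (x : ι) :
    |∑' y, K x y * a y| ≤ R * ‖a‖ := by
  rw [EllOne.norm_eq, ← tsum_mul_left, ← Real.norm_eq_abs]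
  refine tsum_of_norm_bounded ((EllOne.summable_abs a).mul_left R).hasSum fun y => ?_
  rw [Real.norm_eq_abs, abs_mul]
  exact mul_le_mul_of_nonneg_right (hK x y) (abs_nonneg _)

theorem summable_tsum_kernel_mul (hK : ∀ x y, |K x y| ≤ R) (a b : EllOne ι) :
    Summable fun x => (∑' y, K x y * a y) * b x := by
  refine Summable.of_norm_bounded ((EllOne.summable_abs b).mul_left (R * ‖a‖)) fun x => ?_
  rw [Real.norm_eq_abs, abs_mul]
  exact mul_le_mul_of_nonneg_right (abs_tsum_kernel_mul_le hK a x) (abs_nonneg _)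

/-- The bilinear form `(a, b) ↦ ∑_x (∑_y K(x,y) a(y)) b(x)` on `ℓ^1`. -/
def kernelForm (hK : ∀ x y, |K x y| ≤ R) : EllOne ι →L[ℝ] EllOne ι →L[ℝ] ℝ :=
  LinearMap.mkContinuous₂
    (LinearMap.mk₂ ℝ (fun a b => ∑' x, (∑' y, K x y * a y) * b x)
      (fun a a' b => by
        rw [← Summable.tsum_add (summable_tsum_kernel_mul hK a b)
          (summable_tsum_kernel_mul hK a' b)]
        refine tsum_congr fun x => ?_
        rw [← add_mul, ← Summable.tsum_add (summable_kernel_mul hK a x)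
          (summable_kernel_mul hK a' x)]
        simp only [lp.coeFn_add, Pi.add_apply, mul_add])
      (fun c a b => by
        rw [smul_eq_mul, ← tsum_mul_left]
        refine tsum_congr fun x => ?_
        rw [← mul_assoc, ← tsum_mul_left]
        simp only [lp.coeFn_smul, Pi.smul_apply, smul_eq_mul, mul_left_comm])
      (fun a b b' => by
        rw [← Summable.tsum_add (summable_tsum_kernel_mul hK a b)
          (summable_tsum_kernel_mul hK a b')]
        simp only [lp.coeFn_add, Pi.add_apply, mul_add])
      (fun c a b => by
        rw [smul_eq_mul, ← tsum_mul_left]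
        simp only [lp.coeFn_smul, Pi.smul_apply, smul_eq_mul, mul_left_comm]))
    R (fun a b => by
      simp only [LinearMap.mk₂_apply]
      rw [EllOne.norm_eq b, ← tsum_mul_left]
      refine tsum_of_norm_bounded ((EllOne.summable_abs b).mul_left (R * ‖a‖)).hasSum fun x => ?_
      rw [Real.norm_eq_abs, abs_mul]
      exact mul_le_mul_of_nonneg_right (abs_tsum_kernel_mul_le hK a x) (abs_nonneg _))

theorem kernelForm_apply (hK : ∀ x y, |K x y| ≤ R) (a b : EllOne ι) :
    kernelForm hK a b = ∑' x, (∑' y, K x y * a y) * b x := rfl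

theorem abs_kernelForm_le (hK : ∀ x y, |K x y| ≤ R) (a b : EllOne ι) :
    |kernelForm hK a b| ≤ R * ‖a‖ * ‖b‖ := by
  rw [kernelForm_apply, EllOne.norm_eq b, ← tsum_mul_left, ← Real.norm_eq_abs]
  refine tsum_of_norm_bounded ((EllOne.summable_abs b).mul_left (R * ‖a‖)).hasSum fun x => ?_
  rw [Real.norm_eq_abs, abs_mul]
  exact mul_le_mul_of_nonneg_right (abs_tsum_kernel_mul_le hK a x) (abs_nonneg _)

/-- Fubini, with the summable majorant `R |b x| |a y|`. -/
theorem kernelForm_comm (hK : ∀ x y, |K x y| ≤ R) (hsymm : ∀ x y, K x y = K y x)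
    (a b : EllOne ι) : kernelForm hK a b = kernelForm hK b a := by
  simp only [kernelForm_apply, ← tsum_mul_right]
  have hs : Summable (Function.uncurry fun x y => K x y * a y * b x) := by
    have h1 : Summable fun q : ι × ι => R * (|b q.1| * |a q.2|) :=
      ((EllOne.summable_abs b).mul_of_nonneg (EllOne.summable_abs a) (fun _ => abs_nonneg _)
        (fun _ => abs_nonneg _)).mul_left R
    refine Summable.of_norm_bounded h1 fun q => ?_
    simp only [Function.uncurry, Real.norm_eq_abs, abs_mul]
    have := mul_le_mul_of_nonneg_right (hK q.1 q.2) (mul_nonneg (abs_nonneg (b q.1))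
      (abs_nonneg (a q.2)))
    nlinarith
  refine hs.tsum_comm.symm.trans ?_
  refine tsum_congr fun y => tsum_congr fun x => ?_
  rw [hsymm x y]; ring

theorem kernelForm_mono (hK : ∀ x y, |K x y| ≤ R) (hnn : ∀ x y, 0 ≤ K x y) {a a' b b' : EllOne ι}
    (ha : ∀ i, 0 ≤ a i) (haa : ∀ i, a i ≤ a' i) (hb : ∀ i, 0 ≤ b i) (hbb : ∀ i, b i ≤ b' i) :
    kernelForm hK a b ≤ kernelForm hK a' b' := by
  simp only [kernelForm_apply]
  refine Summable.tsum_le_tsum (fun x => ?_) (summable_tsum_kernel_mul hK a b)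
    (summable_tsum_kernel_mul hK a' b')
  have h0 : 0 ≤ ∑' y, K x y * a y := tsum_nonneg fun y => mul_nonneg (hnn x y) (ha y)
  have h1 : ∑' y, K x y * a y ≤ ∑' y, K x y * a' y :=
    Summable.tsum_le_tsum (fun y => mul_le_mul_of_nonneg_left (haa y) (hnn x y))
      (summable_kernel_mul hK a x) (summable_kernel_mul hK a' x)
  exact mul_le_mul h1 (hbb x) (hb x) (h0.trans h1)

theorem diag_le_kernelForm (hK : ∀ x y, |K x y| ≤ R) (hnn : ∀ x y, 0 ≤ K x y) {a b : EllOne ι}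
    (ha : ∀ i, 0 ≤ a i) (hb : ∀ i, 0 ≤ b i) (x : ι) :
    K x x * a x * b x ≤ kernelForm hK a b := by
  rw [kernelForm_apply]
  have h0 : ∀ x, 0 ≤ ∑' y, K x y * a y := fun x => tsum_nonneg fun y => mul_nonneg (hnn x y) (ha y)
  refine le_trans ?_ ((summable_tsum_kernel_mul hK a b).le_tsum x fun z _ =>
    mul_nonneg (h0 z) (hb z))
  exact mul_le_mul_of_nonneg_right ((summable_kernel_mul hK a x).le_tsum x fun y _ =>
    mul_nonneg (hnn x y) (ha y)) (hb x)

/-- The strict derivative of `u ↦ ∑ (K * F(u)) F(u)` on `ℓ^p`. -/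
theorem hasStrictFDerivAt_kernelForm_superposition {p : ℝ} [Fact (1 ≤ ENNReal.ofReal p)]
    (hK : ∀ x y, |K x y| ≤ R) (hsymm : ∀ x y, K x y = K y x) {f : ℝ → ℝ} (hp : 2 ≤ p)
    (hf : Continuous f) (hf0 : f =o[𝓝[≠] 0] fun t : ℝ => |t| ^ (p - 1))
    (hF : GrowthBound (primitive f) p) (hfg : GrowthBound f (p - 1)) (u : Ell ι p) :
    HasStrictFDerivAt
      (fun v : Ell ι p => kernelForm hK (superposition hp hF v) (superposition hp hF v))
      ((2 : ℝ) • (kernelForm hK (superposition hp hF u)).comp (mulSuperposition hp hfg u)) u := by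
  have h1 := hasStrictFDerivAt_superposition hp hf hf0 hF hfg u
  refine ((kernelForm hK).hasStrictFDerivAt_of_bilinear h1 h1).congr_fderiv ?_
  ext w
  change kernelForm hK (superposition hp hF u) (mulSuperposition hp hfg u w) +
    kernelForm hK (mulSuperposition hp hfg u w) (superposition hp hF u) =
    2 * kernelForm hK (superposition hp hF u) (mulSuperposition hp hfg u w)
  rw [kernelForm_comm hK hsymm (mulSuperposition hp hfg u w)]
  ring

end Kernel

/-! ### A second-order estimate for powers -/

/-- Convexity of `w ↦ w ^ r`, from Bernoulli's inequality for `w / s`. -/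
theorem tangent_le_rpow {s w r : ℝ} (hs : 0 ≤ s) (hw : 0 ≤ w) (hr : 1 ≤ r) :
    s ^ r + r * s ^ (r - 1) * (w - s) ≤ w ^ r := by
  rcases hs.eq_or_lt with rfl | hs
  · rcases hr.eq_or_lt with rfl | hr
    · simp
    · rw [Real.zero_rpow (by linarith), Real.zero_rpow (by linarith)]
      simpa using Real.rpow_nonneg hw r
  have h1 := one_add_mul_self_le_rpow_one_add (s := w / s - 1) (p := r)
    (by have : 0 ≤ w / s := by positivity
        linarith) hr
  rw [add_sub_cancel, Real.div_rpow hw hs.le, le_div_iff₀ (Real.rpow_pos_of_pos hs _)] at h1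
  refine le_trans (le_of_eq ?_) h1
  have h2 : s ^ r = s ^ (r - 1) * s := by
    rw [← Real.rpow_add_one hs.ne']; congr 1; ring
  rw [h2]; field_simp

/-- By homogeneity this is `1 - x^q ≤ (1 + q) (1 - x)` for `x = s / w` in `[0, 1]`: Bernoulli when
`q ≥ 1`, and `x ≤ x^q` when `q ≤ 1`. -/
theorem rpow_sub_mul_le {s w q : ℝ} (hs : 0 ≤ s) (hsw : s ≤ w) (hq : 0 ≤ q) :
    (w ^ q - s ^ q) * w ≤ (1 + q) * w ^ q * (w - s) := by
  have hw : 0 ≤ w := hs.trans hsw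
  rcases hw.eq_or_lt with rfl | hw
  · have : s = 0 := le_antisymm hsw hs
    simp [this]
  have hx0 : 0 ≤ s / w := by positivity
  have hx1 : s / w ≤ 1 := (div_le_one hw).2 hsw
  have key : 1 - (s / w) ^ q ≤ (1 + q) * (1 - s / w) := by
    rcases le_total 1 q with h | h
    · have := one_add_mul_self_le_rpow_one_add (s := s / w - 1) (p := q) (by linarith) h
      rw [add_sub_cancel] at this
      nlinarith
    · have : s / w ≤ (s / w) ^ q := by
        conv_lhs => rw [← Real.rpow_one (s / w)]
        rcases hx0.eq_or_lt with h0 | h0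
        · rw [← h0, Real.rpow_one]; exact Real.rpow_nonneg le_rfl _
        · exact Real.rpow_le_rpow_of_exponent_ge h0 hx1 h
      nlinarith
  rw [Real.div_rpow hs hw.le] at key
  have hwq : 0 < w ^ q := Real.rpow_pos_of_pos hw _
  have := mul_le_mul_of_nonneg_left key (mul_pos hwq hw).le
  field_simp at this
  nlinarith

/-- Factoring `w - s` through square roots gives `(w - s)^2 ≤ 4 w b^2`; combined with
`rpow_sub_mul_le`, a factor `w` cancels. -/
theorem rpow_half_remainder_le {s w q b : ℝ} (hs : 0 ≤ s) (hw : 0 ≤ w) (hq : 0 ≤ q)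
    (hb : |√w - √s| ≤ b) :
    (w ^ q - s ^ q) * (w - s) ≤ 4 * (1 + q) * max w s ^ q * b ^ 2 := by
  wlog hsw : s ≤ w generalizing s w
  · have := this hw hs (by rwa [abs_sub_comm]) (le_of_not_ge hsw)
    rw [max_comm] at this
    linarith
  rw [max_eq_left hsw]
  rcases hw.eq_or_lt with rfl | hw'
  · have : s = 0 := le_antisymm hsw hs
    subst this
    simp only [sub_self, mul_zero]
    have := Real.rpow_nonneg (le_refl (0 : ℝ)) q
    positivity
  have h1 := rpow_sub_mul_le hs hsw hq
  have hwq : 0 < w ^ q := Real.rpow_pos_of_pos hw' _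
  have hd : (w - s) ^ 2 ≤ 4 * w * b ^ 2 := by
    have e1 : w - s = (√w - √s) * (√w + √s) := by
      have := Real.sq_sqrt hs; have := Real.sq_sqrt hw; nlinarith
    have e2 : √s ≤ √w := Real.sqrt_le_sqrt hsw
    have e3 : (√w - √s) ^ 2 ≤ b ^ 2 := sq_le_sq.2 (hb.trans (le_abs_self b))
    have e4 : (√w + √s) ^ 2 ≤ 4 * w := by
      have := Real.sq_sqrt hw; nlinarith [Real.sqrt_nonneg s]
    rw [e1, mul_pow]
    calc _ ≤ b ^ 2 * (4 * w) := mul_le_mul e3 e4 (sq_nonneg _) (sq_nonneg _)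
      _ = _ := by ring
  have h2 := mul_le_mul_of_nonneg_right h1 (sub_nonneg.2 hsw)
  have h3 : (1 + q) * w ^ q * (w - s) ^ 2 ≤ (1 + q) * w ^ q * (4 * w * b ^ 2) :=
    mul_le_mul_of_nonneg_left hd (by positivity)
  refine le_of_mul_le_mul_right ?_ hw'
  nlinarith

/-- Meant for `S = |∇u|`, `W = |∇(u+v)|`, `b = |∇v|`, `Γ = ∇u∇v`, and for the weighted values of `u`
and `v`. As `W ^ 2` is exactly quadratic in the increment, `W ^ p` is expanded in the variable `W ^
2`: the tangents at `S ^ 2` and at `W ^ 2` trap the remainder between `0` and `p/2 (W^(p-2) -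
S^(p-2)) (W^2 - S^2)`. -/
theorem rpow_remainder_le {S W b Γ p : ℝ} (hp : 2 ≤ p) (hS : 0 ≤ S) (hW : 0 ≤ W)
    (hWb : |W - S| ≤ b) (hΓ : W ^ 2 = S ^ 2 + 2 * Γ + b ^ 2) :
    |W ^ p - S ^ p - p * (S ^ (p - 2) * Γ)| ≤
      (p ^ 2 + p) * ((S + b) ^ (p - 2) * b ^ 2) := by
  have hb : 0 ≤ b := (abs_nonneg _).trans hWb
  have conv : ∀ {T : ℝ}, 0 ≤ T → ∀ e : ℝ, (T ^ 2) ^ (e / 2) = T ^ e := fun hT e => by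
    rw [← Real.rpow_natCast, ← Real.rpow_mul hT]; congr 1; push_cast; ring
  have e2 : p / 2 - 1 = (p - 2) / 2 := by ring
  have hl := tangent_le_rpow (sq_nonneg S) (sq_nonneg W) (r := p / 2) (by linarith)
  have hu := tangent_le_rpow (sq_nonneg W) (sq_nonneg S) (r := p / 2) (by linarith)
  have hr := rpow_half_remainder_le (sq_nonneg S) (sq_nonneg W) (q := (p - 2) / 2) (by linarith)
    (b := b) (by rwa [Real.sqrt_sq hW, Real.sqrt_sq hS])
  rw [e2, conv hS, conv hS, conv hW] at hl
  rw [e2, conv hS, conv hW, conv hW] at hu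
  rw [conv hS, conv hW] at hr
  have hWle : W ≤ S + b := by linarith [(abs_le.1 hWb).2]
  have hMx : max (W ^ 2) (S ^ 2) ^ ((p - 2) / 2) ≤ (S + b) ^ (p - 2) := by
    rw [← conv (add_nonneg hS hb)]
    refine Real.rpow_le_rpow (le_max_of_le_left (sq_nonneg _)) (max_le ?_ ?_) (by linarith)
    · exact pow_le_pow_left₀ hW hWle 2
    · exact pow_le_pow_left₀ hS (by linarith) 2
  have hSM : S ^ (p - 2) ≤ (S + b) ^ (p - 2) :=
    Real.rpow_le_rpow hS (by linarith) (by linarith)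
  have hM0 : 0 ≤ (S + b) ^ (p - 2) := Real.rpow_nonneg (by linarith) _
  have hr' : (W ^ (p - 2) - S ^ (p - 2)) * (W ^ 2 - S ^ 2) ≤
      2 * p * ((S + b) ^ (p - 2) * b ^ 2) := by
    refine hr.trans ?_
    have : 4 * (1 + (p - 2) / 2) = 2 * p := by ring
    rw [this]
    have := mul_le_mul_of_nonneg_left (mul_le_mul_of_nonneg_right hMx (sq_nonneg b))
      (show 0 ≤ 2 * p by linarith)
    linarith
  -- The tangent term involves `W ^ 2 - S ^ 2 = 2Γ + b ^ 2` while the claim keeps only `Γ`; this is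
  -- the cost of the `b ^ 2`.
  have hx0 : 0 ≤ p / 2 * (S ^ (p - 2) * b ^ 2) := by
    have := Real.rpow_nonneg hS (p - 2); positivity
  have hx1 : p / 2 * (S ^ (p - 2) * b ^ 2) ≤ p * ((S + b) ^ (p - 2) * b ^ 2) := by
    have h1 := mul_le_mul_of_nonneg_right hSM (sq_nonneg b)
    have h2 : 0 ≤ (S + b) ^ (p - 2) * b ^ 2 := by positivity
    nlinarith
  have hg : W ^ p - S ^ p - p * (S ^ (p - 2) * Γ) =
      (W ^ p - S ^ p - p / 2 * S ^ (p - 2) * (W ^ 2 - S ^ 2)) + p / 2 * (S ^ (p - 2) * b ^ 2) := by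
    rw [hΓ]; ring
  rw [hg, abs_of_nonneg (by linarith)]
  have hub : W ^ p - S ^ p - p / 2 * S ^ (p - 2) * (W ^ 2 - S ^ 2) ≤
      p / 2 * ((W ^ (p - 2) - S ^ (p - 2)) * (W ^ 2 - S ^ 2)) := by nlinarith
  have := mul_le_mul_of_nonneg_left hr' (show 0 ≤ p / 2 by linarith)
  nlinarith

/-! ### Differentiability of the energy norm -/

variable {N : ℕ}

theorem gradForm_add_right (u v w : (Fin N → ℤ) → ℝ) (x : Fin N → ℤ) :
    gradForm u (v + w) x = gradForm u v x + gradForm u w x := by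
  simp only [gradForm, ← mul_add, ← Finset.sum_add_distrib, Pi.add_apply]
  congr 1
  exact Finset.sum_congr rfl fun y _ => by ring

theorem gradForm_smul_right (c : ℝ) (u v : (Fin N → ℤ) → ℝ) (x : Fin N → ℤ) :
    gradForm u (c • v) x = c * gradForm u v x := by
  simp only [gradForm, Pi.smul_apply, smul_eq_mul, Finset.mul_sum]
  exact Finset.sum_congr rfl fun y _ => by ring

theorem gradForm_add_self (u v : (Fin N → ℤ) → ℝ) (x : Fin N → ℤ) :
    gradForm (u + v) (u + v) x = gradForm u u x + 2 * gradForm u v x + gradForm v v x := by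
  simp only [gradForm, Finset.mul_sum, ← Finset.sum_add_distrib]
  refine Finset.sum_congr rfl fun y _ => ?_
  simp only [Pi.add_apply]
  ring

theorem gradLen_sq (u : (Fin N → ℤ) → ℝ) (x : Fin N → ℤ) : gradLen u x ^ 2 = gradForm u u x :=
  Real.sq_sqrt (gradForm_self_nonneg u x)

theorem abs_gradForm_le (u v : (Fin N → ℤ) → ℝ) (x : Fin N → ℤ) :
    |gradForm u v x| ≤ gradLen u x * gradLen v x := by
  unfold gradLen
  rw [← Real.sqrt_mul (gradForm_self_nonneg u x)]
  apply Real.abs_le_sqrt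
  have := Finset.sum_mul_sq_le_sq_mul_sq ((latticeGraph N).neighborFinset x)
    (fun y => u y - u x) (fun y => v y - v x)
  simp only [gradForm, ← pow_two]
  nlinarith [this]

theorem abs_gradLen_add_sub_le (u v : (Fin N → ℤ) → ℝ) (x : Fin N → ℤ) :
    |gradLen (u + v) x - gradLen u x| ≤ gradLen v x := by
  have h1 := gradLen_add_le u v x
  have h2 := gradLen_add_le (u + v) ((-1 : ℝ) • v) x
  rw [gradLen_smul] at h2
  have h3 : u + v + (-1 : ℝ) • v = u := by simp
  rw [h3, abs_neg, abs_one, one_mul] at h2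
  rw [abs_le]; constructor <;> linarith

/-- The local norm `(|∇u|^p + h |u|^p)^{1/p}(x)`. -/
def localNorm (p : ℝ) (h u : (Fin N → ℤ) → ℝ) (x : Fin N → ℤ) : ℝ :=
  energyDensity p h u x ^ (1 / p)

/-- The density of the derivative of `(1/p) ∑ (|∇u|^p + h |u|^p)`. -/
def dirichletDensity (p : ℝ) (h u v : (Fin N → ℤ) → ℝ) (x : Fin N → ℤ) : ℝ :=
  gradLen u x ^ (p - 2) * gradForm u v x + h x * |u x| ^ (p - 2) * u x * v x

section Local

variable {p : ℝ} {h : (Fin N → ℤ) → ℝ}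

theorem localNorm_nonneg (hh : ∀ x, 0 ≤ h x) (u : (Fin N → ℤ) → ℝ) (x : Fin N → ℤ) :
    0 ≤ localNorm p h u x :=
  Real.rpow_nonneg (energyDensity_nonneg p hh u x) _

theorem localNorm_rpow (hp : 2 ≤ p) (hh : ∀ x, 0 ≤ h x) (u : (Fin N → ℤ) → ℝ) (x : Fin N → ℤ) :
    localNorm p h u x ^ p = energyDensity p h u x := by
  rw [localNorm, ← Real.rpow_mul (energyDensity_nonneg p hh u x), one_div_mul_cancel (by linarith),
    Real.rpow_one]

theorem gradLen_le_localNorm (hp : 2 ≤ p) (hh : ∀ x, 0 ≤ h x) (u : (Fin N → ℤ) → ℝ)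
    (x : Fin N → ℤ) : gradLen u x ≤ localNorm p h u x := by
  rw [← Real.rpow_le_rpow_iff (gradLen_nonneg u x) (localNorm_nonneg hh u x)
    (show 0 < p by linarith), localNorm_rpow hp hh]
  exact le_add_of_nonneg_right (mul_nonneg (hh x) (Real.rpow_nonneg (abs_nonneg _) _))

theorem weight_rpow (hp : 2 ≤ p) (hh : ∀ x, 0 ≤ h x) (x : Fin N → ℤ) :
    (h x ^ (1 / p)) ^ p = h x := by
  rw [← Real.rpow_mul (hh x), one_div_mul_cancel (by linarith), Real.rpow_one]

theorem weight_mul_le_localNorm (hp : 2 ≤ p) (hh : ∀ x, 0 ≤ h x) (u : (Fin N → ℤ) → ℝ)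
    (x : Fin N → ℤ) : h x ^ (1 / p) * |u x| ≤ localNorm p h u x := by
  have hc : 0 ≤ h x ^ (1 / p) := Real.rpow_nonneg (hh x) _
  rw [← Real.rpow_le_rpow_iff (mul_nonneg hc (abs_nonneg _)) (localNorm_nonneg hh u x)
    (show 0 < p by linarith), localNorm_rpow hp hh, Real.mul_rpow hc (abs_nonneg _),
    weight_rpow hp hh]
  exact le_add_of_nonneg_left (Real.rpow_nonneg (gradLen_nonneg _ _) _)

theorem weight_rpow_mul_sq (hp : 2 ≤ p) (hh : ∀ x, 0 ≤ h x) (x : Fin N → ℤ) :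
    (h x ^ (1 / p)) ^ (p - 2) * (h x ^ (1 / p)) ^ 2 = h x := by
  have hc : 0 ≤ h x ^ (1 / p) := Real.rpow_nonneg (hh x) _
  rw [← Real.rpow_two, ← Real.rpow_add' hc (by linarith), sub_add_cancel, weight_rpow hp hh]

theorem dirichletDensity_eq (hp : 2 ≤ p) (hh : ∀ x, 0 ≤ h x) (u v : (Fin N → ℤ) → ℝ)
    (x : Fin N → ℤ) : dirichletDensity p h u v x = gradLen u x ^ (p - 2) * gradForm u v x +
      (h x ^ (1 / p) * |u x|) ^ (p - 2) * ((h x ^ (1 / p) * u x) * (h x ^ (1 / p) * v x)) := by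
  have hc : 0 ≤ h x ^ (1 / p) := Real.rpow_nonneg (hh x) _
  rw [dirichletDensity, Real.mul_rpow hc (abs_nonneg _)]
  nth_rewrite 1 [← weight_rpow_mul_sq hp hh x]
  ring

/-- Cauchy-Schwarz reduces both summands to the form `S^(p-1) b`, ready for Hölder with exponents `p
- 1` and `1`. -/
theorem abs_dirichletDensity_le (hp : 2 ≤ p) (hh : ∀ x, 0 ≤ h x) (u v : (Fin N → ℤ) → ℝ)
    (x : Fin N → ℤ) : |dirichletDensity p h u v x| ≤
      2 * (localNorm p h u x ^ (p - 1) * localNorm p h v x) := by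
  have hc : 0 ≤ h x ^ (1 / p) := Real.rpow_nonneg (hh x) _
  have hnu := localNorm_nonneg (p := p) hh u x
  have hnv := localNorm_nonneg (p := p) hh v x
  have key : ∀ {S b Γ : ℝ}, 0 ≤ S → 0 ≤ b → S ≤ localNorm p h u x → b ≤ localNorm p h v x →
      |Γ| ≤ S * b → |S ^ (p - 2) * Γ| ≤ localNorm p h u x ^ (p - 1) * localNorm p h v x := by
    intro S b Γ hS hb hSu hbv hΓ
    rw [abs_mul, abs_of_nonneg (Real.rpow_nonneg hS _)]
    calc S ^ (p - 2) * |Γ| ≤ S ^ (p - 2) * (S * b) :=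
          mul_le_mul_of_nonneg_left hΓ (Real.rpow_nonneg hS _)
      _ = S ^ (p - 1) * b := by
          rw [← mul_assoc]; congr 1
          rcases hS.eq_or_lt with rfl | hS
          · rw [mul_zero, Real.zero_rpow (by linarith)]
          · rw [← Real.rpow_add_one hS.ne']; congr 1; ring
      _ ≤ _ := mul_le_mul (Real.rpow_le_rpow hS hSu (by linarith)) hbv hb
          (Real.rpow_nonneg hnu _)
  rw [dirichletDensity_eq hp hh]
  have k1 := key (gradLen_nonneg u x) (gradLen_nonneg v x) (gradLen_le_localNorm hp hh u x)
    (gradLen_le_localNorm hp hh v x) (abs_gradForm_le u v x)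
  have k2 := key (mul_nonneg hc (abs_nonneg (u x))) (mul_nonneg hc (abs_nonneg (v x)))
    (weight_mul_le_localNorm hp hh u x) (weight_mul_le_localNorm hp hh v x)
    (Γ := (h x ^ (1 / p) * u x) * (h x ^ (1 / p) * v x))
    (by rw [abs_mul, abs_mul, abs_mul, abs_of_nonneg hc])
  exact (abs_add_le _ _).trans (by linarith)

theorem energyDensity_remainder_le (hp : 2 ≤ p) (hh : ∀ x, 0 ≤ h x) (u v : (Fin N → ℤ) → ℝ)
    (x : Fin N → ℤ) :
    |energyDensity p h (u + v) x - energyDensity p h u x - p * dirichletDensity p h u v x| ≤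
      2 * (p ^ 2 + p) *
        ((localNorm p h u x + localNorm p h v x) ^ (p - 2) * localNorm p h v x ^ (2 : ℝ)) := by
  have hc : 0 ≤ h x ^ (1 / p) := Real.rpow_nonneg (hh x) _
  have hnu := localNorm_nonneg (p := p) hh u x
  have hnv := localNorm_nonneg (p := p) hh v x
  have key : ∀ {S b W Γ : ℝ}, 0 ≤ S → 0 ≤ b → 0 ≤ W → S ≤ localNorm p h u x →
      b ≤ localNorm p h v x → |W - S| ≤ b → W ^ 2 = S ^ 2 + 2 * Γ + b ^ 2 →
      |W ^ p - S ^ p - p * (S ^ (p - 2) * Γ)| ≤ (p ^ 2 + p) *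
        ((localNorm p h u x + localNorm p h v x) ^ (p - 2) * localNorm p h v x ^ (2 : ℝ)) := by
    intro S b W Γ hS hb hW hSu hbv hWS hΓ
    refine (rpow_remainder_le hp hS hW hWS hΓ).trans ?_
    refine mul_le_mul_of_nonneg_left ?_ (by positivity)
    rw [Real.rpow_two]
    refine mul_le_mul ?_ (pow_le_pow_left₀ hb hbv 2) (sq_nonneg _) (by positivity)
    exact Real.rpow_le_rpow (by linarith) (by linarith) (by linarith)
  have k1 := key (gradLen_nonneg u x) (gradLen_nonneg v x) (gradLen_nonneg (u + v) x)
    (gradLen_le_localNorm hp hh u x) (gradLen_le_localNorm hp hh v x)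
    (abs_gradLen_add_sub_le u v x) (Γ := gradForm u v x)
    (by simp only [gradLen_sq]; exact gradForm_add_self u v x)
  have k2 := key (mul_nonneg hc (abs_nonneg (u x))) (mul_nonneg hc (abs_nonneg (v x)))
    (mul_nonneg hc (abs_nonneg ((u + v) x)))
    (weight_mul_le_localNorm hp hh u x) (weight_mul_le_localNorm hp hh v x)
    (Γ := (h x ^ (1 / p) * u x) * (h x ^ (1 / p) * v x))
    (by
      rw [← mul_sub, abs_mul, abs_of_nonneg hc]
      refine mul_le_mul_of_nonneg_left ?_ hc
      have := abs_abs_sub_abs_le_abs_sub ((u + v) x) (u x)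
      simpa using this)
    (by
      simp only [mul_pow, sq_abs, Pi.add_apply]; ring)
  rw [Real.mul_rpow hc (abs_nonneg _), Real.mul_rpow hc (abs_nonneg _), weight_rpow hp hh] at k2
  rw [dirichletDensity_eq hp hh]
  unfold energyDensity
  refine le_trans (le_of_eq_of_le ?_ (abs_add_le _ _)) ((add_le_add k1 k2).trans_eq ?_)
  · congr 1; ring
  · ring

end Local

section Energy

variable {p : ℝ} {h : (Fin N → ℤ) → ℝ} {hp : 2 ≤ p} {hh : BoundedBelow h}

theorem HSpace.norm_rpow (u : HSpace p h hp hh) : ‖u‖ ^ p = ∑' x, energyDensity p h u x := by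
  change ((∑' x, energyDensity p h u x) ^ (1 / p)) ^ p = _
  rw [← Real.rpow_mul (tsum_nonneg (energyDensity_nonneg p hh.nonneg _)),
    one_div_mul_cancel (by linarith), Real.rpow_one]

theorem HSpace.summable_localNorm_rpow (u : HSpace p h hp hh) :
    Summable fun x => localNorm p h u x ^ p := by
  simpa only [localNorm_rpow hp hh.nonneg] using u.summable

theorem HSpace.tsum_localNorm_rpow (u : HSpace p h hp hh) :
    ∑' x, localNorm p h u x ^ p = ‖u‖ ^ p := by
  simp only [localNorm_rpow hp hh.nonneg, HSpace.norm_rpow]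

theorem HSpace.coe_add (u v : HSpace p h hp hh) :
    ((u + v : HSpace p h hp hh) : (Fin N → ℤ) → ℝ) = (u : (Fin N → ℤ) → ℝ) + v := rfl

theorem HSpace.coe_smul (c : ℝ) (v : HSpace p h hp hh) :
    ((c • v : HSpace p h hp hh) : (Fin N → ℤ) → ℝ) = c • (v : (Fin N → ℤ) → ℝ) := rfl

theorem HSpace.summable_localNorm_mul (u v : HSpace p h hp hh) :
    Summable fun x => localNorm p h u x ^ (p - 1) * localNorm p h v x := by
  simpa using summable_rpow_mul_rpow (r := p - 1) (s := 1) (localNorm_nonneg hh.nonneg u)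
    (localNorm_nonneg hh.nonneg v) (by linarith) zero_le_one (by linarith) (by ring)
    u.summable_localNorm_rpow v.summable_localNorm_rpow

theorem HSpace.summable_dirichletDensity (u v : HSpace p h hp hh) :
    Summable (dirichletDensity p h u v) :=
  Summable.of_norm_bounded ((HSpace.summable_localNorm_mul u v).mul_left 2)
    fun x => abs_dirichletDensity_le hp hh.nonneg u v x

/-- The derivative of `u ↦ (1/p) ∑ (|∇u|^p + h |u|^p)` on `H`. -/
def dirichletForm (u : HSpace p h hp hh) : HSpace p h hp hh →L[ℝ] ℝ :=
  LinearMap.mkContinuous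
    { toFun := fun v => ∑' x, dirichletDensity p h u v x
      map_add' := fun v w => by
        rw [← Summable.tsum_add (HSpace.summable_dirichletDensity u v)
          (HSpace.summable_dirichletDensity u w)]
        refine tsum_congr fun x => ?_
        simp only [dirichletDensity, HSpace.coe_add, gradForm_add_right, Pi.add_apply]
        ring
      map_smul' := fun c v => by
        simp only [RingHom.id_apply, smul_eq_mul]
        rw [← tsum_mul_left]
        refine tsum_congr fun x => ?_
        simp only [dirichletDensity, HSpace.coe_smul, gradForm_smul_right, Pi.smul_apply,
          smul_eq_mul]
        ring }
    (2 * (2 * ‖u‖ ^ (p - 1))) fun v => by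
      refine (tsum_of_norm_bounded ((HSpace.summable_localNorm_mul u v).mul_left 2).hasSum
        fun x => abs_dirichletDensity_le hp hh.nonneg u v x).trans ?_
      rw [tsum_mul_left, mul_assoc]
      refine mul_le_mul_of_nonneg_left ?_ (by norm_num)
      simpa using tsum_rpow_mul_rpow_le (r := p - 1) (s := 1) (localNorm_nonneg hh.nonneg u)
        (localNorm_nonneg hh.nonneg v) (by linarith) one_pos (by linarith) (by ring)
        u.summable_localNorm_rpow v.summable_localNorm_rpow (norm_nonneg u) (norm_nonneg v)
        u.tsum_localNorm_rpow.le v.tsum_localNorm_rpow.le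

theorem dirichletForm_apply (u v : HSpace p h hp hh) :
    dirichletForm u v = ∑' x, dirichletDensity p h u v x := rfl

/-- The remainder is `O(‖v‖^2)`: Hölder with exponents `p - 2` and `2`, after Minkowski for the sum
of the local norms. -/
theorem hasFDerivAt_tsum_energyDensity (u : HSpace p h hp hh) :
    HasFDerivAt (fun v : HSpace p h hp hh => ∑' x, energyDensity p h v x)
      (p • dirichletForm u) u := by
  -- The constant of the local remainder times Hölder's `2`, with `‖u‖ + ‖v‖ ≤ ‖u‖ + 1`.
  set C := 2 * (p ^ 2 + p) * (2 * (‖u‖ + 1) ^ (p - 2)) with hC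
  have hp0 : 0 < p := by linarith
  have hC0 : 0 ≤ C := by positivity
  have hbound : ∀ v : HSpace p h hp hh, ‖v‖ ≤ 1 →
      |(∑' x, energyDensity p h (u + v : HSpace p h hp hh) x) - (∑' x, energyDensity p h u x) -
        p * dirichletForm u v| ≤ C * ‖v‖ ^ 2 := fun v hv => by
    have hMink := Real.Lp_add_le_tsum_of_nonneg (p := p) (by linarith)
      (localNorm_nonneg hh.nonneg u) (localNorm_nonneg hh.nonneg v)
      u.summable_localNorm_rpow v.summable_localNorm_rpow
    have hMle : ∑' x, (localNorm p h u x + localNorm p h v x) ^ p ≤ (‖u‖ + ‖v‖) ^ p := by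
      have h1 := hMink.2
      rw [u.tsum_localNorm_rpow, v.tsum_localNorm_rpow, ← Real.rpow_mul (norm_nonneg _),
        ← Real.rpow_mul (norm_nonneg _), mul_one_div_cancel hp0.ne', Real.rpow_one,
        Real.rpow_one] at h1
      have hnn : 0 ≤ ∑' x, (localNorm p h u x + localNorm p h v x) ^ p :=
        tsum_nonneg fun x => Real.rpow_nonneg (add_nonneg (localNorm_nonneg hh.nonneg u x)
          (localNorm_nonneg hh.nonneg v x)) _
      have h2 := Real.rpow_le_rpow (Real.rpow_nonneg hnn _) h1 hp0.le
      rwa [← Real.rpow_mul hnn, one_div_mul_cancel hp0.ne', Real.rpow_one] at h2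
    have hnn : ∀ x, 0 ≤ localNorm p h u x + localNorm p h v x := fun x =>
      add_nonneg (localNorm_nonneg hh.nonneg u x) (localNorm_nonneg hh.nonneg v x)
    have hsm := summable_rpow_mul_rpow (r := p - 2) (s := 2) hnn (localNorm_nonneg hh.nonneg v)
      (by linarith) (by norm_num) hp0 (by ring) hMink.1 v.summable_localNorm_rpow
    have hmix := tsum_rpow_mul_rpow_le (r := p - 2) (s := 2) hnn (localNorm_nonneg hh.nonneg v)
      (by linarith) (by norm_num) hp0 (by ring) hMink.1 v.summable_localNorm_rpow
      (A := ‖u‖ + ‖v‖) (B := ‖v‖) (by positivity) (norm_nonneg v) hMle v.tsum_localNorm_rpow.le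
    rw [dirichletForm_apply, ← tsum_mul_left,
      ← Summable.tsum_sub (u + v : HSpace p h hp hh).summable u.summable,
      ← Summable.tsum_sub ((u + v : HSpace p h hp hh).summable.sub u.summable)
        ((HSpace.summable_dirichletDensity u v).mul_left p)]
    rw [← Real.norm_eq_abs]
    refine le_trans (tsum_of_norm_bounded (hsm.mul_left (2 * (p ^ 2 + p))).hasSum
      fun x => energyDensity_remainder_le hp hh.nonneg u v x) ?_
    rw [tsum_mul_left, hC, mul_assoc (2 * (p ^ 2 + p)) (2 * (‖u‖ + 1) ^ (p - 2))]
    refine mul_le_mul_of_nonneg_left (hmix.trans ?_) (by positivity)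
    rw [Real.rpow_two]
    refine mul_le_mul_of_nonneg_right (mul_le_mul_of_nonneg_left ?_ (by norm_num)) (sq_nonneg _)
    exact Real.rpow_le_rpow (by positivity) (by linarith) (by linarith)
  rw [hasFDerivAt_iff_isLittleO_nhds_zero, Asymptotics.isLittleO_iff]
  intro c hc
  have hr : 0 < min 1 (c / (C + 1)) := by positivity
  filter_upwards [Metric.ball_mem_nhds (0 : HSpace p h hp hh) hr] with v hv
  rw [mem_ball_zero_iff] at hv
  refine (hbound v (hv.le.trans (min_le_left _ _))).trans ?_
  have h1 : ‖v‖ ≤ c / (C + 1) := hv.le.trans (min_le_right _ _)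
  rw [le_div_iff₀ (by positivity)] at h1
  nlinarith [norm_nonneg v]

end Energy

/-! ### Finiteness of balls in the lattice graph -/

theorem latticeGraph_adj {x y : Fin N → ℤ} :
    (latticeGraph N).Adj x y ↔ ∑ i, |x i - y i| = 1 := Iff.rfl

theorem sum_abs_sub_le_length {x y : Fin N → ℤ} (w : (latticeGraph N).Walk x y) :
    ∑ i, |x i - y i| ≤ w.length := by
  induction w with
  | nil => simp
  | @cons a b c hab w ih =>
    have h1 : ∑ i, |a i - c i| ≤ ∑ i, |a i - b i| + ∑ i, |b i - c i| := by
      rw [← Finset.sum_add_distrib]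
      exact Finset.sum_le_sum fun i _ => abs_sub_le _ _ _
    rw [latticeGraph_adj.1 hab] at h1
    rw [SimpleGraph.Walk.length_cons]
    push_cast
    linarith

/-- Induction on the `ℓ^1` distance: a step of one unit in a differing coordinate lowers it by one.
-/
theorem latticeGraph_reachable (x y : Fin N → ℤ) : (latticeGraph N).Reachable x y := by
  have key : ∀ (n : ℕ) (x : Fin N → ℤ), ∑ i, |x i - y i| = n → (latticeGraph N).Reachable x y := by
    intro n
    induction n with
    | zero =>
      intro x hx
      have : x = y := by
        funext i
        have := (Finset.sum_eq_zero_iff_of_nonneg fun i _ => abs_nonneg (x i - y i)).1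
          (by exact_mod_cast hx) i (Finset.mem_univ i)
        exact sub_eq_zero.1 (abs_eq_zero.1 this)
      rw [this]
    | succ n ih =>
      intro x hx
      obtain ⟨i, hi⟩ : ∃ i, x i ≠ y i := by
        by_contra hcon
        push Not at hcon
        simp only [hcon, sub_self, abs_zero, Finset.sum_const_zero] at hx
        omega
      obtain ⟨c, hc1, hc2⟩ : ∃ c : ℤ, |c - y i| + 1 = |x i - y i| ∧ |x i - c| = 1 := by
        rcases lt_or_gt_of_ne hi with h | h
        · exact ⟨x i + 1, by
            rw [abs_of_nonpos (by omega), abs_of_neg (by omega)]; omega, by simp⟩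
        · exact ⟨x i - 1, by
            rw [abs_of_nonneg (by omega), abs_of_pos (by omega)]; omega, by simp⟩
      have hadj : (latticeGraph N).Adj x (Function.update x i c) := by
        rw [latticeGraph_adj, Finset.sum_eq_single i]
        · simpa using hc2
        · intro j _ hj; simp [Function.update_of_ne hj]
        · simp
      refine hadj.reachable.trans (ih _ ?_)
      rw [← Finset.add_sum_erase _ _ (Finset.mem_univ i)] at hx ⊢
      rw [Finset.sum_congr rfl fun j hj => by
        rw [Function.update_of_ne (Finset.ne_of_mem_erase hj)], Function.update_self]
      push_cast at hx
      linarith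
  exact key (∑ i, |x i - y i|).toNat x
    (Int.toNat_of_nonneg (Finset.sum_nonneg fun _ _ => abs_nonneg _)).symm

theorem finite_setOf_dist_lt (x₀ : Fin N → ℤ) (n : ℕ) :
    {x | (latticeGraph N).dist x x₀ < n}.Finite := by
  refine (Set.finite_Icc (fun i => x₀ i - n) (fun i => x₀ i + n)).subset fun x hx => ?_
  -- `SimpleGraph.dist` is `0` between unreachable vertices, so connectedness is required to realize
  -- the distance by a walk.
  obtain ⟨w, hw⟩ := (latticeGraph_reachable x x₀).exists_walk_length_eq_dist
  have h1 := sum_abs_sub_le_length w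
  have h2 : ∀ i, |x i - x₀ i| ≤ n := fun i => by
    have := Finset.single_le_sum (f := fun i => |x i - x₀ i|) (fun j _ => abs_nonneg _)
      (Finset.mem_univ i)
    have hx' : (latticeGraph N).dist x x₀ < n := hx
    omega
  exact ⟨fun i => by have := abs_le.1 (h2 i); simp only; omega,
    fun i => by have := abs_le.1 (h2 i); simp only; omega⟩

/-- The form in which coercivity of the potential enters the compactness argument. -/
theorem finite_setOf_lt_of_tendsto {h : (Fin N → ℤ) → ℝ}
    (h3 : ∃ x₀ : Fin N → ℤ, Tendsto h
      (comap (fun x => (latticeGraph N).dist x x₀) atTop) atTop) (M : ℝ) :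
    {x | h x < M}.Finite := by
  obtain ⟨x₀, hx₀⟩ := h3
  have h1 := hx₀.eventually (eventually_ge_atTop M)
  rw [eventually_comap] at h1
  obtain ⟨n, hn⟩ := eventually_atTop.1 h1
  refine (finite_setOf_dist_lt x₀ n).subset fun x hx => ?_
  by_contra hcon
  exact absurd (hn _ (not_lt.1 hcon) x rfl) (not_le.2 hx)

/-! ### Functions in `ℓ^p` belong to `W^{1,p}` -/

theorem sum_neighborFinset (g : (Fin N → ℤ) → ℝ) (x : Fin N → ℤ) :
    ∑ y ∈ (latticeGraph N).neighborFinset x, g y =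
      ∑ e ∈ (latticeGraph N).neighborFinset 0, g (x + e) := by
  refine Finset.sum_bij' (fun y _ => y - x) (fun e _ => x + e) ?_ ?_ ?_ ?_ ?_
  · intro y hy
    rw [SimpleGraph.mem_neighborFinset, latticeGraph_adj] at hy ⊢
    simpa using hy
  · intro e he
    rw [SimpleGraph.mem_neighborFinset, latticeGraph_adj] at he ⊢
    simpa using he
  · intros; simp
  · intros; simp
  · intros; simp

theorem gradLen_le_sum (u : (Fin N → ℤ) → ℝ) (x : Fin N → ℤ) :
    gradLen u x ≤ ∑ e ∈ (latticeGraph N).neighborFinset 0, |u (x + e) - u x| := by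
  refine Real.sqrt_le_iff.2 ⟨Finset.sum_nonneg fun _ _ => abs_nonneg _, ?_⟩
  rw [gradForm, sum_neighborFinset]
  have h1 : ∑ e ∈ (latticeGraph N).neighborFinset 0, (u (x + e) - u x) * (u (x + e) - u x) =
      ∑ e ∈ (latticeGraph N).neighborFinset 0, |u (x + e) - u x| ^ 2 :=
    Finset.sum_congr rfl fun e _ => by rw [sq_abs, sq]
  have h2 : 0 ≤ ∑ e ∈ (latticeGraph N).neighborFinset 0, |u (x + e) - u x| ^ 2 := by positivity
  rw [h1]
  refine le_trans (by linarith) (Finset.sum_sq_le_sq_sum_of_nonneg fun i _ => abs_nonneg _)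

/-- The gradient at `x` involves finitely many translates of `w`, and translations preserve the
`ℓ^p` sum. -/
theorem exists_energyDensity_one_bound {p : ℝ} (hp : 2 ≤ p) :
    ∃ C : ℝ, 0 ≤ C ∧ ∀ w : (Fin N → ℤ) → ℝ, (Summable fun x => |w x| ^ p) →
      Summable (energyDensity p (fun _ => 1) w) ∧
        ∑' x, energyDensity p (fun _ => 1) w x ≤ C * ∑' x, |w x| ^ p := by
  set T := (latticeGraph N).neighborFinset 0 with hT
  have hp0 : 0 < p := by linarith
  -- The power mean inequality over the neighbours contributes `T.card ^ (p - 1)`, and splitting `|a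
  -- - b| ^ p` contributes `2 ^ p`.
  set D : ℝ := (T.card : ℝ) ^ (p - 1) * 2 ^ p with hD
  have hD0 : 0 ≤ D := by positivity
  refine ⟨D * (T.card * 2) + 1, by positivity, fun w hw => ?_⟩
  have hadd : ∀ a b : ℝ, |a - b| ^ p ≤ 2 ^ p * (|a| ^ p + |b| ^ p) := fun a b => by
    have hm : |a - b| ≤ 2 * max |a| |b| := by
      linarith [abs_sub a b, le_max_left |a| |b|, le_max_right |a| |b|]
    refine (Real.rpow_le_rpow (abs_nonneg _) hm hp0.le).trans ?_
    rw [Real.mul_rpow (by norm_num) (le_max_of_le_left (abs_nonneg _))]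
    refine mul_le_mul_of_nonneg_left ?_ (by positivity)
    have := Real.rpow_nonneg (abs_nonneg a) p
    have := Real.rpow_nonneg (abs_nonneg b) p
    rcases max_choice |a| |b| with hc | hc <;> rw [hc] <;> linarith
  have hle : ∀ x, energyDensity p (fun _ => 1) w x ≤
      D * ∑ e ∈ T, (|w (x + e)| ^ p + |w x| ^ p) + |w x| ^ p := fun x => by
    rw [energyDensity, one_mul]
    refine add_le_add_left ?_ _
    calc gradLen w x ^ p ≤ (∑ e ∈ T, |w (x + e) - w x|) ^ p :=
          Real.rpow_le_rpow (gradLen_nonneg _ _) (gradLen_le_sum w x) hp0.le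
      _ ≤ (T.card : ℝ) ^ (p - 1) * ∑ e ∈ T, |w (x + e) - w x| ^ p :=
          Real.rpow_sum_le_const_mul_sum_rpow T _ (by linarith)
      _ ≤ (T.card : ℝ) ^ (p - 1) * ∑ e ∈ T, 2 ^ p * (|w (x + e)| ^ p + |w x| ^ p) := by
          gcongr with e _
          exact hadd _ _
      _ = _ := by rw [← Finset.mul_sum, hD, mul_assoc]
  have hshift : ∀ e, Summable fun x => |w (x + e)| ^ p := fun e =>
    (Equiv.addRight e).summable_iff.2 hw
  have hshift' : ∀ e, ∑' x, |w (x + e)| ^ p = ∑' x, |w x| ^ p := fun e =>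
    (Equiv.addRight e).tsum_eq fun x => |w x| ^ p
  have hs1 : Summable fun x => ∑ e ∈ T, (|w (x + e)| ^ p + |w x| ^ p) :=
    summable_sum fun e _ => (hshift e).add hw
  have hs := (hs1.mul_left D).add hw
  have hres := Summable.of_nonneg_of_le (energyDensity_nonneg p (fun _ => zero_le_one) w) hle hs
  refine ⟨hres, (hres.tsum_le_tsum hle hs).trans_eq ?_⟩
  rw [Summable.tsum_add (hs1.mul_left D) hw, tsum_mul_left,
    Summable.tsum_finsetSum fun e _ => (hshift e).add hw,
    Finset.sum_congr rfl fun e _ => by rw [Summable.tsum_add (hshift e) hw, hshift' e]]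
  rw [Finset.sum_const, nsmul_eq_mul]
  ring

/-- Truncations to finite sets approximate, the error being controlled by a tail of the `ℓ^p` sum.
Membership of a limit in `H` thereby reduces to summability of `h |u|^p`. -/
theorem MemW1p.of_summable {p : ℝ} (hp : 2 ≤ p) {u : (Fin N → ℤ) → ℝ}
    (hu : Summable fun x => |u x| ^ p) : MemW1p p u := by
  obtain ⟨C, hC, hb⟩ := exists_energyDensity_one_bound (N := N) hp
  have hp0 : 0 < p := by linarith
  refine ⟨(hb u hu).1, fun ε hε => ?_⟩
  have hεp : 0 < ε ^ p := Real.rpow_pos_of_pos hε _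
  have htail := tendsto_tsum_compl_atTop_zero fun x => |u x| ^ p
  obtain ⟨S, hS⟩ := (htail.eventually (gt_mem_nhds (show 0 < ε ^ p / (C + 1) by positivity))).exists
  refine ⟨(S : Set (Fin N → ℤ)).indicator u, S.finite_toSet.subset Set.support_indicator_subset,
    ?_⟩
  have hrw : u - (S : Set (Fin N → ℤ)).indicator u = ((S : Set (Fin N → ℤ))ᶜ).indicator u := by
    rw [indicator_compl]
  have hpow : (fun x => |((S : Set (Fin N → ℤ))ᶜ).indicator u x| ^ p) =
      ((S : Set (Fin N → ℤ))ᶜ).indicator fun x => |u x| ^ p := by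
    funext x
    by_cases hx : x ∈ (S : Set (Fin N → ℤ))ᶜ
    · simp only [indicator_of_mem hx]
    · simp only [indicator_of_notMem hx, abs_zero, Real.zero_rpow hp0.ne']
  have hsum : Summable fun x => |((S : Set (Fin N → ℤ))ᶜ).indicator u x| ^ p := by
    rw [hpow]; exact hu.indicator _
  have htsum : ∑' x, |((S : Set (Fin N → ℤ))ᶜ).indicator u x| ^ p < ε ^ p / (C + 1) := by
    rw [hpow, ← tsum_subtype]
    exact hS
  rw [hrw, energyNorm]
  have hnn : 0 ≤ ∑' x, energyDensity p (fun _ => 1) (((S : Set (Fin N → ℤ))ᶜ).indicator u) x :=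
    tsum_nonneg (energyDensity_nonneg p (fun _ => zero_le_one) _)
  have hlt : ∑' x, energyDensity p (fun _ => 1) (((S : Set (Fin N → ℤ))ᶜ).indicator u) x <
      ε ^ p := by
    refine (hb _ hsum).2.trans_lt ?_
    rw [lt_div_iff₀ (by positivity)] at htsum
    have : 0 ≤ ∑' x, |((S : Set (Fin N → ℤ))ᶜ).indicator u x| ^ p :=
      tsum_nonneg fun x => Real.rpow_nonneg (abs_nonneg _) _
    nlinarith
  have := Real.rpow_lt_rpow hnn hlt (show 0 < 1 / p by positivity)
  rwa [← Real.rpow_mul hε.le, mul_one_div_cancel hp0.ne', Real.rpow_one] at this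

/-! ### The embedding of `H` into `ℓ^p` -/

section Embedding

variable {p : ℝ} {h : (Fin N → ℤ) → ℝ}

theorem summable_rpow_of_potential (hh : BoundedBelow h) {u : (Fin N → ℤ) → ℝ}
    (hu : Summable fun x => h x * |u x| ^ p) : Summable fun x => |u x| ^ p := by
  obtain ⟨h₀, h0, hle⟩ := hh
  refine Summable.of_nonneg_of_le (fun x => Real.rpow_nonneg (abs_nonneg _) _) (fun x => ?_)
    (hu.mul_left h₀⁻¹)
  rw [← mul_assoc]
  refine le_mul_of_one_le_left (Real.rpow_nonneg (abs_nonneg _) _) ?_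
  rw [← div_eq_inv_mul, one_le_div h0]
  exact hle x

/-- A function of finite energy, as an element of `H`. -/
def HSpace.ofSummable (hp : 2 ≤ p) (hh : BoundedBelow h) (u : (Fin N → ℤ) → ℝ)
    (hu : Summable fun x => h x * |u x| ^ p) : HSpace p h hp hh :=
  ⟨u, MemW1p.of_summable hp (summable_rpow_of_potential hh hu), hu⟩

/-- A multiple of the indicator function of a point, as an element of `H`. -/
def HSpace.single (hp : 2 ≤ p) (hh : BoundedBelow h) (x : Fin N → ℤ) (c : ℝ) : HSpace p h hp hh :=
  HSpace.ofSummable hp hh (Pi.single x c) (summable_of_hasFiniteSupport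
    ((Set.finite_singleton x).subset fun y hy => by
      by_contra hne
      rw [mem_singleton_iff] at hne
      apply hy
      simp [Pi.single_eq_of_ne hne, Real.zero_rpow (show p ≠ 0 by linarith)]))

variable {hp : 2 ≤ p} {hh : BoundedBelow h}

theorem HSpace.single_apply (x : Fin N → ℤ) (c : ℝ) (y : Fin N → ℤ) :
    (HSpace.single hp hh x c : HSpace p h hp hh) y = (Pi.single x c : (Fin N → ℤ) → ℝ) y := rfl

theorem tendsto_energyDensity {v : ℕ → (Fin N → ℤ) → ℝ} {u : (Fin N → ℤ) → ℝ} (hp : 2 ≤ p)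
    (hv : ∀ x, Tendsto (fun n => v n x) atTop (𝓝 (u x))) (x : Fin N → ℤ) :
    Tendsto (fun n => energyDensity p h (v n) x) atTop (𝓝 (energyDensity p h u x)) := by
  have hp0 : 0 ≤ p := by linarith
  unfold energyDensity gradLen gradForm
  refine Tendsto.add (Tendsto.rpow_const ?_ (Or.inr hp0))
    ((Tendsto.rpow_const (hv x).abs (Or.inr hp0)).const_mul _)
  refine (Tendsto.const_mul _ (tendsto_finsetSum _ fun y _ => ?_)).sqrt
  exact ((hv y).sub (hv x)).mul ((hv y).sub (hv x))

/-- The energy is lower semicontinuous under pointwise convergence. -/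
theorem sum_energyDensity_le_of_tendsto {v : ℕ → HSpace p h hp hh} {u : (Fin N → ℤ) → ℝ}
    (hv : ∀ x, Tendsto (fun n => v n x) atTop (𝓝 (u x))) {b : ℕ → ℝ} {B : ℝ}
    (hb : ∀ n, ∑' x, energyDensity p h (v n) x ≤ b n) (hB : Tendsto b atTop (𝓝 B))
    (S : Finset (Fin N → ℤ)) : ∑ x ∈ S, energyDensity p h u x ≤ B := by
  refine le_of_tendsto_of_tendsto'
    (tendsto_finsetSum S fun x _ => tendsto_energyDensity (h := h) hp hv x) hB fun n => ?_
  exact ((v n).summable.sum_le_tsum S fun x _ => energyDensity_nonneg p hh.nonneg _ x).trans (hb n)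

theorem summable_potential_of_sum_le {u : (Fin N → ℤ) → ℝ} (hh : BoundedBelow h) {B : ℝ}
    (hB : ∀ S : Finset (Fin N → ℤ), ∑ x ∈ S, energyDensity p h u x ≤ B) :
    Summable fun x => h x * |u x| ^ p :=
  ((summable_energyDensity_iff hh.nonneg u).1
    (summable_of_sum_le (energyDensity_nonneg p hh.nonneg u) hB)).2

variable [Fact (1 ≤ ENNReal.ofReal p)]

/-- The embedding of `H` into `ℓ^p`. -/
def toEll : HSpace p h hp hh →L[ℝ] Ell (Fin N → ℤ) p :=
  LinearMap.mkContinuousOfExistsBound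
    { toFun := fun u => ⟨fun x => u x, Ell.memℓp hp (summable_rpow_of_potential hh u.2.2)⟩
      map_add' := fun _ _ => rfl
      map_smul' := fun _ _ => rfl } (by
    obtain ⟨h₀, h0, hle⟩ := id hh
    have hp0 : 0 < p := by linarith
    refine ⟨h₀⁻¹ ^ (1 / p), fun u => ?_⟩
    rw [← Real.rpow_le_rpow_iff (norm_nonneg _) (by positivity) hp0, ← Ell.tsum_rpow hp,
      Real.mul_rpow (by positivity) (norm_nonneg _), ← Real.rpow_mul (by positivity),
      one_div_mul_cancel hp0.ne', Real.rpow_one, HSpace.norm_rpow, ← tsum_mul_left]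
    refine Summable.tsum_le_tsum (fun x => ?_) (summable_rpow_of_potential hh u.2.2)
      (u.summable.mul_left _)
    change |u x| ^ p ≤ _
    have hnn : 0 ≤ |u x| ^ p := Real.rpow_nonneg (abs_nonneg _) _
    rw [← div_eq_inv_mul, le_div_iff₀ h0, energyDensity]
    have h1 := mul_le_mul_of_nonneg_right (hle x) hnn
    have h2 := Real.rpow_nonneg (gradLen_nonneg (u : (Fin N → ℤ) → ℝ) x) p
    linarith)

/-- Pointwise convergence of a bounded sequence of `H` implies convergence in `ℓ^p` when the
potential is coercive. -/
theorem tendsto_toEll_of_tendsto (hfin : ∀ M : ℝ, {x | h x < M}.Finite)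
    {v : ℕ → HSpace p h hp hh} {u : HSpace p h hp hh} {B : ℝ} (hvB : ∀ n, ‖v n - u‖ ≤ B)
    (hv : ∀ x, Tendsto (fun n => v n x) atTop (𝓝 (u x))) :
    Tendsto (fun n => toEll (v n)) atTop (𝓝 (toEll u)) := by
  have hp0 : 0 < p := by linarith
  rw [tendsto_iff_norm_sub_tendsto_zero]
  have hB0 : 0 ≤ B := (norm_nonneg _).trans (hvB 0)
  suffices hmain : Tendsto (fun n => ‖toEll (v n) - toEll u‖ ^ p) atTop (𝓝 0) by
    have h1 := hmain.rpow_const (p := 1 / p) (Or.inr (by positivity))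
    simpa only [← Real.rpow_mul (norm_nonneg _), mul_one_div_cancel hp0.ne', Real.rpow_one,
      Real.zero_rpow (one_div_ne_zero hp0.ne')] using h1
  rw [Metric.tendsto_atTop]
  intro ε hε
  -- Off the finite set `{h < M}` one has `|v - u|^p ≤ M⁻¹ h |v - u|^p`, whose sum is at most `B ^ p
  -- / M`; on that set pointwise convergence suffices.
  obtain ⟨M, hM0, hM⟩ : ∃ M : ℝ, 0 < M ∧ B ^ p / M < ε / 2 := by
    refine ⟨2 * (B ^ p + 1) / ε, by positivity, ?_⟩
    have : 0 ≤ B ^ p := by positivity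
    rw [div_div_eq_mul_div, div_lt_div_iff₀ (by positivity) (by norm_num)]
    nlinarith
  set S := (hfin M).toFinset with hS
  have hlim : Tendsto (fun n => ∑ x ∈ S, |v n x - u x| ^ p) atTop (𝓝 0) := by
    have := tendsto_finsetSum S fun x _ =>
      ((((hv x).sub_const (u x)).abs).rpow_const (p := p) (Or.inr hp0.le))
    simpa [Real.zero_rpow hp0.ne'] using this
  obtain ⟨n₀, hn₀⟩ := (Metric.tendsto_atTop.1 hlim) (ε / 2) (by positivity)
  refine ⟨n₀, fun n hn => ?_⟩
  have h1 := hn₀ n hn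
  rw [Real.dist_eq, sub_zero, abs_of_nonneg (by positivity)] at h1 ⊢
  rw [← map_sub, ← Ell.tsum_rpow hp]
  have hterm : ∀ x, |toEll (v n - u) x| ^ p ≤
      (S : Set (Fin N → ℤ)).indicator (fun x => |v n x - u x| ^ p) x +
        M⁻¹ * energyDensity p h (v n - u : HSpace p h hp hh) x := fun x => by
    change |v n x - u x| ^ p ≤ _
    have hnn : 0 ≤ |v n x - u x| ^ p := Real.rpow_nonneg (abs_nonneg _) _
    have hdn := energyDensity_nonneg p hh.nonneg (v n - u : HSpace p h hp hh) x
    by_cases hx : x ∈ (S : Set (Fin N → ℤ))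
    · rw [indicator_of_mem hx]
      exact le_add_of_nonneg_right (by positivity)
    · rw [indicator_of_notMem hx, zero_add]
      have hMx : M ≤ h x := by simpa [hS] using hx
      rw [← div_eq_inv_mul, le_div_iff₀ hM0, energyDensity]
      change _ ≤ _ + h x * |v n x - u x| ^ p
      have h1 := mul_le_mul_of_nonneg_right hMx hnn
      have h2 := Real.rpow_nonneg
        (gradLen_nonneg ((v n - u : HSpace p h hp hh) : (Fin N → ℤ) → ℝ) x) p
      linarith
  have hs1 : Summable ((S : Set (Fin N → ℤ)).indicator (fun x => |v n x - u x| ^ p)) :=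
    summable_of_hasFiniteSupport (S.finite_toSet.subset Set.support_indicator_subset)
  have hs2 := (v n - u : HSpace p h hp hh).summable.mul_left M⁻¹
  refine ((Ell.summable_rpow hp _).tsum_le_tsum hterm (hs1.add hs2)).trans_lt ?_
  rw [Summable.tsum_add hs1 hs2, tsum_mul_left, ← HSpace.norm_rpow, ← sum_eq_tsum_indicator]
  have h2 : M⁻¹ * ‖v n - u‖ ^ p ≤ B ^ p / M := by
    rw [div_eq_inv_mul]
    exact mul_le_mul_of_nonneg_left (Real.rpow_le_rpow (norm_nonneg _) (hvB n) hp0.le)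
      (by positivity)
  linarith

/-- The compactness of the embedding of `H` into `ℓ^p` for a coercive potential. -/
theorem exists_subseq_tendsto_toEll (hfin : ∀ M : ℝ, {x | h x < M}.Finite)
    {v : ℕ → HSpace p h hp hh} {B : ℝ} (hvB : ∀ n, ‖v n‖ ≤ B) :
    ∃ (u : HSpace p h hp hh) (φ : ℕ → ℕ), StrictMono φ ∧
      (∀ x, Tendsto (fun n => v (φ n) x) atTop (𝓝 (u x))) ∧
      Tendsto (fun n => toEll (v (φ n))) atTop (𝓝 (toEll u)) := by
  have hp0 : 0 < p := by linarith
  set E : HSpace p h hp hh →L[ℝ] Ell (Fin N → ℤ) p := toEll with hE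
  -- The values at every site are bounded uniformly in `n`, so Tychonoff over the countable lattice
  -- yields a pointwise convergent subsequence.
  have hcpt : IsCompact (univ.pi fun _ : Fin N → ℤ => Icc (-(‖E‖ * B)) (‖E‖ * B)) :=
    isCompact_univ_pi fun _ => isCompact_Icc
  obtain ⟨u, -, φ, hφ, hlim⟩ := hcpt.tendsto_subseq (x := fun n => (v n : (Fin N → ℤ) → ℝ))
    (fun n x _ => abs_le.1 (by
      have h1 := Ell.abs_apply_le hp (E (v n)) x
      exact h1.trans ((E.le_opNorm _).trans
        (mul_le_mul_of_nonneg_left (hvB n) (norm_nonneg _)))))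
  have hpt : ∀ x, Tendsto (fun n => v (φ n) x) atTop (𝓝 (u x)) := fun x =>
    (tendsto_pi_nhds.1 hlim) x
  -- Fatou's lemma keeps the pointwise limit in `H`.
  have hsum := summable_potential_of_sum_le hh (sum_energyDensity_le_of_tendsto
    (v := fun n => v (φ n)) hpt (b := fun _ => B ^ p) (fun n => by
      rw [← HSpace.norm_rpow]
      exact Real.rpow_le_rpow (norm_nonneg _) (hvB _) hp0.le) tendsto_const_nhds)
  refine ⟨HSpace.ofSummable hp hh u hsum, φ, hφ, hpt, ?_⟩
  refine tendsto_toEll_of_tendsto hfin (v := fun n => v (φ n))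
    (B := B + ‖HSpace.ofSummable hp hh u hsum‖) (fun n => ?_) hpt
  exact (norm_sub_le _ _).trans (by linarith [hvB (φ n)])

end Embedding

/-! ### The nonlocal term -/

/-- The standing assumptions on the exponents and on the behaviour of `f` at the origin. -/
structure Admissible (N : ℕ) (p α : ℝ) (f : ℝ → ℝ) : Prop where
  pos : 0 < α
  lt_dim : α < N
  continuous : Continuous f
  isLittleO : f =o[𝓝[≠] 0] fun t : ℝ => |t| ^ (p - 1)

section Nonlocal

variable {p α θ : ℝ} {f : ℝ → ℝ} {h : (Fin N → ℤ) → ℝ} {hp : 2 ≤ p} {hh : BoundedBelow h}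

/-- The nonlocal energy `∑ (R_α * F(u)) F(u)`. -/
def nonlocalTerm (α : ℝ) (f : ℝ → ℝ) (u : HSpace p h hp hh) : ℝ :=
  ∑' x, greenConv α (fun y => primitive f (u y)) x * primitive f (u x)

/-- The form `∑ (R_α * F(u)) f(u) w`, half the derivative of the nonlocal energy. -/
def nonlocalForm (α : ℝ) (f : ℝ → ℝ) (u w : HSpace p h hp hh) : ℝ :=
  ∑' x, greenConv α (fun y => primitive f (u y)) x * f (u x) * w x

theorem Admissible.abs_green_le (hA : Admissible N p α f) (x y : Fin N → ℤ) :
    |green α x y| ≤ green α (0 : Fin N → ℤ) 0 := by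
  rw [abs_of_nonneg (green_nonneg hA.pos hA.lt_dim x y)]
  exact green_le_diag hA.pos hA.lt_dim x y

theorem Admissible.growth (hA : Admissible N p α f) (hp : 2 ≤ p) : GrowthBound f (p - 1) :=
  exists_growth_bound hA.continuous hA.isLittleO hp

theorem Admissible.growth_primitive (hA : Admissible N p α f) (hp : 2 ≤ p) :
    GrowthBound (primitive f) p :=
  exists_primitive_growth_bound hA.continuous hA.isLittleO hp

/-- `0 ≤ θ F(t) ≤ 2 f(t) t`, the condition of Ambrosetti and Rabinowitz. -/
def SuperlinearGrowth (θ : ℝ) (f : ℝ → ℝ) : Prop :=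
  ∀ t : ℝ, 0 ≤ θ * primitive f t ∧ θ * primitive f t ≤ 2 * f t * t

theorem SuperlinearGrowth.primitive_nonneg (hf : SuperlinearGrowth θ f) (hθ : 0 < θ) (t : ℝ) :
    0 ≤ primitive f t :=
  nonneg_of_mul_nonneg_right (hf t).1 hθ

theorem SuperlinearGrowth.mul_self_nonneg (hf : SuperlinearGrowth θ f) (t : ℝ) : 0 ≤ f t * t := by
  have := hf t; nlinarith

/-- The Ambrosetti-Rabinowitz condition says that `r ^ (-(θ / 2)) F(r s)` is nondecreasing in `r`.
The exponent is `θ / 2` because `F` occurs twice in the nonlocal term, which then gains `t ^ θ`. -/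
theorem SuperlinearGrowth.rpow_mul_primitive_le (hf : SuperlinearGrowth θ f)
    (hc : Continuous f) {t : ℝ} (ht : 1 ≤ t) (s : ℝ) :
    t ^ (θ / 2) * primitive f s ≤ primitive f (t * s) := by
  have hder : ∀ r : ℝ, 0 < r → HasDerivAt (fun r => r ^ (-(θ / 2)) * primitive f (r * s))
      (r ^ (-(θ / 2) - 1) * (f (r * s) * (r * s) - θ / 2 * primitive f (r * s))) r := fun r hr => by
    have h1 := Real.hasDerivAt_rpow_const (x := r) (p := -(θ / 2)) (Or.inl hr.ne')
    have h2 : HasDerivAt (fun r => primitive f (r * s)) (f (r * s) * s) r :=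
      HasDerivAt.comp (h₂ := primitive f) (h := fun r => r * s) r (hasDerivAt_primitive hc (r * s))
        (by simpa using (hasDerivAt_id r).mul_const s)
    refine (h1.mul h2).congr_deriv ?_
    have : r ^ (-(θ / 2)) = r ^ (-(θ / 2) - 1) * r := by
      rw [← Real.rpow_add_one hr.ne', sub_add_cancel]
    rw [this]; ring
  have hmono : MonotoneOn (fun r => r ^ (-(θ / 2)) * primitive f (r * s)) (Ici 1) := by
    have hpos : ∀ r ∈ Ici (1 : ℝ), 0 < r := fun r hr => lt_of_lt_of_le one_pos hr
    refine monotoneOn_of_deriv_nonneg (convex_Ici 1)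
      (fun r hr => (hder r (hpos r hr)).continuousAt.continuousWithinAt)
      (fun r hr => ((hder r (hpos r (interior_subset hr))).differentiableAt).differentiableWithinAt)
      fun r hr => ?_
    have hr0 := hpos r (interior_subset hr)
    rw [(hder r hr0).deriv]
    refine mul_nonneg (Real.rpow_nonneg hr0.le _) ?_
    linarith [(hf (r * s)).2]
  have h1 := hmono (mem_Ici.2 le_rfl) (mem_Ici.2 ht) ht
  simp only [Real.one_rpow, one_mul] at h1
  have ht0 : 0 < t := by linarith
  calc t ^ (θ / 2) * primitive f s
      ≤ t ^ (θ / 2) * (t ^ (-(θ / 2)) * primitive f (t * s)) :=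
        mul_le_mul_of_nonneg_left h1 (Real.rpow_nonneg ht0.le _)
    _ = primitive f (t * s) := by
        rw [← mul_assoc, ← Real.rpow_add ht0, add_neg_cancel, Real.rpow_zero, one_mul]

theorem nonlocalForm_smul_nonneg (hA : Admissible N p α f) (hf : SuperlinearGrowth θ f)
    (hθ : 0 < θ) (u : HSpace p h hp hh) {t : ℝ} (ht : 0 < t) :
    0 ≤ nonlocalForm α f (t • u) u := by
  refine tsum_nonneg fun x => ?_
  rw [mul_assoc]
  refine mul_nonneg (tsum_nonneg fun y => mul_nonneg (green_nonneg hA.pos hA.lt_dim x y)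
    (hf.primitive_nonneg hθ _)) ?_
  have := hf.mul_self_nonneg (t * u x)
  change 0 ≤ f (t * u x) * u x
  refine nonneg_of_mul_nonneg_right (a := t) ?_ ht
  linarith

/-- The monotonicity condition along the rays of `H`. -/
def RayMonotone (hp : 2 ≤ p) (hh : BoundedBelow h) (α : ℝ) (f : ℝ → ℝ) : Prop :=
  ∀ u : HSpace p h hp hh, u ≠ 0 →
    StrictMonoOn (fun t : ℝ => nonlocalForm α f (t • u) u / t ^ p) (Ioi 0)

theorem nonlocalForm_single (x : Fin N → ℤ) (s : ℝ) (hf0 : primitive f 0 = 0) :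
    nonlocalForm α f (HSpace.single hp hh x s) (HSpace.single hp hh x s) =
      green α x x * primitive f s * f s * s := by
  have hself : (HSpace.single hp hh x s : HSpace p h hp hh) x = s := by
    rw [HSpace.single_apply, Pi.single_eq_same]
  have hne : ∀ y, y ≠ x → (HSpace.single hp hh x s : HSpace p h hp hh) y = 0 := fun y hy => by
    rw [HSpace.single_apply, Pi.single_eq_of_ne hy]
  rw [nonlocalForm, tsum_eq_single x fun y hy => by rw [hne y hy, mul_zero], greenConv,
    tsum_eq_single x fun y hy => by rw [hne y hy, hf0, mul_zero], hself]

/-- Ray monotonicity tested on a point mass: a nonnegative strictly increasing function on `(0, ∞)`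
is positive at `1`, and its value there has both quantities as factors. -/
theorem green_diag_mul_primitive_pos (hA : Admissible N p α f) (hf : SuperlinearGrowth θ f)
    (hθ : 0 < θ) (hmono : RayMonotone hp hh α f) (x : Fin N → ℤ) {s : ℝ} (hs : s ≠ 0) :
    0 < green α x x ∧ 0 < primitive f s := by
  have hne : (HSpace.single hp hh x s : HSpace p h hp hh) ≠ 0 := fun hcon => by
    have : (HSpace.single hp hh x s : HSpace p h hp hh) x = (0 : HSpace p h hp hh) x := by
      rw [hcon]
    rw [HSpace.single_apply, Pi.single_eq_same] at this
    exact hs this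
  have h1 := hmono _ hne (show (1 / 2 : ℝ) ∈ Ioi 0 by norm_num) (show (1 : ℝ) ∈ Ioi 0 by norm_num)
    (by norm_num)
  have h2 : 0 ≤ nonlocalForm α f ((1 / 2 : ℝ) • HSpace.single hp hh x s : HSpace p h hp hh)
      (HSpace.single hp hh x s) / (1 / 2 : ℝ) ^ p :=
    div_nonneg (nonlocalForm_smul_nonneg hA hf hθ _ (by norm_num)) (by positivity)
  have h3 := h2.trans_lt h1
  simp only [one_smul, Real.one_rpow, div_one] at h3
  rw [nonlocalForm_single x s primitive_zero] at h3
  have hg := green_nonneg hA.pos hA.lt_dim x x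
  have hF := hf.primitive_nonneg hθ s
  refine ⟨lt_of_le_of_ne hg fun h0 => ?_, lt_of_le_of_ne hF fun h0 => ?_⟩ <;>
    rw [← h0] at h3 <;> simp at h3

/-- `F(u)` as an element of `ℓ^1`. -/
def Admissible.source [Fact (1 ≤ ENNReal.ofReal p)] (hA : Admissible N p α f)
    (u : HSpace p h hp hh) : EllOne (Fin N → ℤ) :=
  superposition hp (hA.growth_primitive hp) (toEll u)

variable [Fact (1 ≤ ENNReal.ofReal p)]

theorem nonlocalTerm_eq (hA : Admissible N p α f) (u : HSpace p h hp hh) :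
    nonlocalTerm α f u = kernelForm hA.abs_green_le (hA.source u) (hA.source u) := rfl

theorem nonlocalForm_eq (hA : Admissible N p α f) (u w : HSpace p h hp hh) :
    nonlocalForm α f u w = kernelForm hA.abs_green_le (hA.source u)
      (mulSuperposition hp (hA.growth hp) (toEll u) (toEll w)) := by
  rw [kernelForm_apply]
  exact tsum_congr fun x => mul_assoc _ _ _

theorem hasStrictFDerivAt_nonlocalTerm (hA : Admissible N p α f) (u : HSpace p h hp hh) :
    ∃ L : HSpace p h hp hh →L[ℝ] ℝ, (∀ w, L w = 2 * nonlocalForm α f u w) ∧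
      HasStrictFDerivAt (nonlocalTerm α f) L u := by
  have h1 := (hasStrictFDerivAt_kernelForm_superposition hA.abs_green_le
    (green_comm hA.pos hA.lt_dim) hp hA.continuous hA.isLittleO (hA.growth_primitive hp)
    (hA.growth hp) (toEll u)).comp u (toEll (p := p) (h := h) (hp := hp) (hh := hh)).hasStrictFDerivAt
  exact ⟨_, fun w => by rw [nonlocalForm_eq hA]; rfl, h1⟩

/-- Only `ℓ^p` convergence is assumed, which is what compactness provides; convergence in `H` is not
available. -/
theorem tendsto_nonlocalTerm (hA : Admissible N p α f) {v : ℕ → HSpace p h hp hh}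
    {u : HSpace p h hp hh} (hv : Tendsto (fun n => toEll (v n)) atTop (𝓝 (toEll u))) :
    Tendsto (fun n => nonlocalTerm α f (v n)) atTop (𝓝 (nonlocalTerm α f u)) := by
  simp only [nonlocalTerm_eq hA]
  have hcont : ContinuousAt (fun w : Ell (Fin N → ℤ) p => kernelForm hA.abs_green_le
      (superposition hp (hA.growth_primitive hp) w) (superposition hp (hA.growth_primitive hp) w))
      (toEll u) :=
    (hasStrictFDerivAt_kernelForm_superposition hA.abs_green_le
      (green_comm hA.pos hA.lt_dim) hp hA.continuous hA.isLittleO (hA.growth_primitive hp)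
      (hA.growth hp) (toEll u)).continuousAt
  exact Tendsto.comp (x := atTop) (y := 𝓝 (toEll u)) hcont hv

/-- Both `ℓ^1` arguments of the bilinear form have size `‖toEll u‖ ^ p`. The resulting order `2p`,
above the order `p` of the norm term, makes `J` positive near `0` on rays and keeps `nehari` away
from `0`. -/
theorem exists_nonlocal_bound (hA : Admissible N p α f) :
    ∃ C, 0 ≤ C ∧ ∀ u : HSpace p h hp hh, ‖toEll u‖ ≤ 1 →
      nonlocalTerm α f u ≤ C * (‖toEll u‖ ^ p) ^ 2 ∧
        nonlocalForm α f u u ≤ C * (‖toEll u‖ ^ p) ^ 2 := by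
  obtain ⟨C₁, hC₁, h₁⟩ := hA.growth_primitive hp 1
  obtain ⟨C₂, hC₂, h₂⟩ := hA.growth hp 1
  set R := green α (0 : Fin N → ℤ) 0 with hR
  have hR0 : 0 ≤ R := green_nonneg hA.pos hA.lt_dim 0 0
  refine ⟨R * C₁ * (C₁ + C₂), by positivity, fun u hu => ?_⟩
  set e := ‖toEll u‖ ^ p with he
  have he0 : 0 ≤ e := Real.rpow_nonneg (norm_nonneg _) _
  have hsmall : ∀ x, |toEll u x| ≤ 1 := fun x => (Ell.abs_apply_le hp _ x).trans hu
  have hnF : ‖hA.source u‖ ≤ C₁ * e := by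
    rw [EllOne.norm_eq, he, ← Ell.tsum_rpow hp, ← tsum_mul_left]
    exact Summable.tsum_le_tsum (fun x => h₁ _ (hsmall x)) (EllOne.summable_abs _)
      ((Ell.summable_rpow hp _).mul_left _)
  have hnf : ‖mulSuperposition hp (hA.growth hp) (toEll u) (toEll u)‖ ≤ C₂ * e := by
    rw [EllOne.norm_eq, he, ← Ell.tsum_rpow hp, ← tsum_mul_left]
    refine Summable.tsum_le_tsum (fun x => ?_) (EllOne.summable_abs _)
      ((Ell.summable_rpow hp _).mul_left _)
    rw [mulSuperposition_apply, abs_mul]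
    refine (mul_le_mul_of_nonneg_right (h₂ _ (hsmall x)) (abs_nonneg _)).trans_eq ?_
    rw [mul_assoc]
    congr 1
    nth_rewrite 2 [← Real.rpow_one |toEll u x|]
    rw [← Real.rpow_add' (abs_nonneg _) (by linarith), sub_add_cancel]
  have hbil : ∀ {a b : EllOne (Fin N → ℤ)} {c d : ℝ}, ‖a‖ ≤ c → ‖b‖ ≤ d →
      kernelForm hA.abs_green_le a b ≤ R * c * d := by
    intro a b c d hac hbd
    refine (le_abs_self _).trans ((abs_kernelForm_le _ a b).trans ?_)
    have hc : 0 ≤ c := (norm_nonneg a).trans hac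
    gcongr
  have hnn : 0 ≤ R * C₁ * e ^ 2 := by positivity
  constructor
  · rw [nonlocalTerm_eq hA]
    refine (hbil hnF hnF).trans ?_
    nlinarith [mul_nonneg hnn hC₂]
  · rw [nonlocalForm_eq hA]
    refine (hbil hnF hnf).trans ?_
    nlinarith [mul_nonneg hnn hC₁]

theorem rpow_mul_nonlocalTerm_le (hA : Admissible N p α f) (hf : SuperlinearGrowth θ f)
    (hθ : 0 < θ) (u : HSpace p h hp hh) {t : ℝ} (ht : 1 ≤ t) :
    t ^ θ * nonlocalTerm α f u ≤ nonlocalTerm α f (t • u) := by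
  have ht0 : 0 < t := by linarith
  have hnn : ∀ x, 0 ≤ (t ^ (θ / 2) • hA.source u) x := fun x =>
    mul_nonneg (Real.rpow_nonneg ht0.le _) (hf.primitive_nonneg hθ _)
  have hle : ∀ x, (t ^ (θ / 2) • hA.source u) x ≤ hA.source (t • u) x := fun x =>
    hf.rpow_mul_primitive_le hA.continuous ht (u x)
  have := kernelForm_mono hA.abs_green_le (green_nonneg hA.pos hA.lt_dim) hnn hle hnn hle
  rw [nonlocalTerm_eq hA, nonlocalTerm_eq hA]
  refine le_of_eq_of_le ?_ this
  simp only [map_smul, smul_apply, smul_eq_mul]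
  rw [← mul_assoc, ← Real.rpow_add ht0, add_halves]

theorem nonlocalTerm_le_nonlocalForm (hA : Admissible N p α f) (hf : SuperlinearGrowth θ f)
    (hθ : 0 < θ) (u : HSpace p h hp hh) :
    θ / 2 * nonlocalTerm α f u ≤ nonlocalForm α f u u := by
  have hF : ∀ x, 0 ≤ hA.source u x := fun x => hf.primitive_nonneg hθ (u x)
  have hnn : ∀ x, 0 ≤ ((θ / 2) • hA.source u) x := fun x =>
    mul_nonneg (by positivity) (hF x)
  have hle : ∀ x, ((θ / 2) • hA.source u) x ≤
      mulSuperposition hp (hA.growth hp) (toEll u) (toEll u) x := fun x => by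
    change θ / 2 * primitive f (u x) ≤ f (u x) * u x
    linarith [(hf (u x)).2]
  have := kernelForm_mono hA.abs_green_le (green_nonneg hA.pos hA.lt_dim) hF (fun x => le_rfl)
    hnn hle
  rw [nonlocalTerm_eq hA, nonlocalForm_eq hA]
  refine le_of_eq_of_le ?_ this
  simp only [map_smul, smul_eq_mul]

/-- All terms being nonnegative, the diagonal term at one site where `u` does not vanish is enough.
-/
theorem nonlocalTerm_pos (hA : Admissible N p α f) (hf : SuperlinearGrowth θ f)
    (hθ : 0 < θ) (hmono : RayMonotone hp hh α f) {u : HSpace p h hp hh} (hu : u ≠ 0) :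
    0 < nonlocalTerm α f u := by
  obtain ⟨x, hx⟩ : ∃ x, u x ≠ 0 := by
    by_contra hcon
    push Not at hcon
    exact hu (Subtype.ext (funext hcon))
  obtain ⟨h1, h2⟩ := green_diag_mul_primitive_pos hA hf hθ hmono x hx
  rw [nonlocalTerm_eq hA]
  refine lt_of_lt_of_le ?_ (diag_le_kernelForm hA.abs_green_le (green_nonneg hA.pos hA.lt_dim)
    (fun y => hf.primitive_nonneg hθ (u y)) (fun y => hf.primitive_nonneg hθ (u y)) x)
  exact mul_pos (mul_pos h1 h2) h2

end Nonlocal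

/-! ### The energy functional along rays -/

section Rays

variable {p α θ : ℝ} {f : ℝ → ℝ} {h : (Fin N → ℤ) → ℝ} {hp : 2 ≤ p} {hh : BoundedBelow h}

theorem energy_eq (α : ℝ) (f : ℝ → ℝ) (u : HSpace p h hp hh) :
    energy α f u = 1 / p * ‖u‖ ^ p - 1 / 2 * nonlocalTerm α f u := by
  rw [HSpace.norm_rpow]; rfl

theorem energy_smul (α : ℝ) (f : ℝ → ℝ) (u : HSpace p h hp hh) {t : ℝ} (ht : 0 ≤ t) :
    energy α f (t • u) = 1 / p * (t ^ p * ‖u‖ ^ p) - 1 / 2 * nonlocalTerm α f (t • u) := by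
  rw [energy_eq, norm_smul, Real.norm_of_nonneg ht, Real.mul_rpow ht (norm_nonneg _)]

theorem dirichletForm_smul_self (u : HSpace p h hp hh) {t : ℝ} (ht : 0 < t) :
    dirichletForm (t • u) u = t ^ (p - 1) * ‖u‖ ^ p := by
  rw [dirichletForm_apply, HSpace.norm_rpow, ← tsum_mul_left]
  refine tsum_congr fun x => ?_
  have hsplit : ∀ {s : ℝ}, 0 ≤ s → s ^ (p - 2) * s ^ 2 = s ^ p := fun hs => by
    rw [← Real.rpow_two, ← Real.rpow_add' hs (by linarith), sub_add_cancel]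
  have ht1 : t ^ (p - 1) = t ^ (p - 2) * t := by
    rw [← Real.rpow_add_one ht.ne']; congr 1; ring
  have hform : gradForm (t • (u : (Fin N → ℤ) → ℝ)) u x =
      t * gradLen (u : (Fin N → ℤ) → ℝ) x ^ 2 := by
    rw [gradLen_sq, gradForm, gradForm, Finset.mul_sum, Finset.mul_sum, Finset.mul_sum]
    refine Finset.sum_congr rfl fun y _ => ?_
    simp only [Pi.smul_apply, smul_eq_mul]; ring
  rw [dirichletDensity, energyDensity, HSpace.coe_smul, hform, gradLen_smul, abs_of_pos ht,
    Real.mul_rpow ht.le (gradLen_nonneg _ _), Pi.smul_apply, smul_eq_mul, abs_mul, abs_of_pos ht,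
    Real.mul_rpow ht.le (abs_nonneg _), ← hsplit (gradLen_nonneg _ _), ← hsplit (abs_nonneg _),
    sq_abs, ht1]
  ring

variable [Fact (1 ≤ ENNReal.ofReal p)]

/-! ### The derivative of the energy and the Nehari condition. -/

theorem hasFDerivAt_energy (hA : Admissible N p α f) (u : HSpace p h hp hh) :
    ∃ L : HSpace p h hp hh →L[ℝ] ℝ, (∀ w, L w = dirichletForm u w - nonlocalForm α f u w) ∧
      HasFDerivAt (energy α f) L u := by
  obtain ⟨L, hL, hD⟩ := hasStrictFDerivAt_nonlocalTerm hA u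
  have hp0 : p ≠ 0 := by linarith
  refine ⟨(1 / p) • (p • dirichletForm u) - (1 / 2 : ℝ) • L, fun w => ?_, ?_⟩
  · change 1 / p * (p * dirichletForm u w) - 1 / 2 * L w = _
    rw [hL]; field_simp
  · exact ((hasFDerivAt_tsum_energyDensity u).const_smul (1 / p)).sub
      (hD.hasFDerivAt.const_smul (1 / 2 : ℝ))

theorem continuous_energy (hA : Admissible N p α f) :
    Continuous (energy α f : HSpace p h hp hh → ℝ) :=
  continuous_iff_continuousAt.2 fun u => by
    obtain ⟨L, -, hL⟩ := hasFDerivAt_energy hA u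
    exact hL.continuousAt

theorem hasDerivAt_energy_smul (hA : Admissible N p α f) (u : HSpace p h hp hh) {t : ℝ}
    (ht : 0 < t) : HasDerivAt (fun s : ℝ => energy α f (s • u))
      (t ^ (p - 1) * ‖u‖ ^ p - nonlocalForm α f (t • u) u) t := by
  obtain ⟨L, hLw, hL⟩ := hasFDerivAt_energy hA (t • u)
  have h1 : HasDerivAt (fun s : ℝ => s • u) u t := by
    simpa using (hasDerivAt_id t).smul_const u
  refine (hL.comp_hasDerivAt t h1).congr_deriv ?_
  rw [hLw, dirichletForm_smul_self u ht]

theorem fderiv_energy_apply (hA : Admissible N p α f) (u w : HSpace p h hp hh) :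
    fderiv ℝ (energy α f) u w = dirichletForm u w - nonlocalForm α f u w := by
  obtain ⟨L, hLw, hL⟩ := hasFDerivAt_energy hA u
  rw [hL.fderiv, hLw]

theorem mem_nehari_iff (hA : Admissible N p α f) {u : HSpace p h hp hh} :
    u ∈ (nehari α f : Set (HSpace p h hp hh)) ↔ u ≠ 0 ∧ ‖u‖ ^ p = nonlocalForm α f u u := by
  have h1 := dirichletForm_smul_self u one_pos
  rw [one_smul, Real.one_rpow, one_mul] at h1
  rw [nehari, mem_ofPred_eq, fderiv_energy_apply hA, h1, sub_eq_zero]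

theorem smul_mem_nehari (hA : Admissible N p α f) {u : HSpace p h hp hh} (hu : u ≠ 0) {t : ℝ}
    (ht : 0 < t) (hmax : IsLocalMax (fun s : ℝ => energy α f (s • u)) t) :
    t • u ∈ (nehari α f : Set (HSpace p h hp hh)) := by
  refine ⟨smul_ne_zero ht.ne' hu, ?_⟩
  have h1 := hmax.hasDerivAt_eq_zero (hasDerivAt_energy_smul hA u ht)
  rw [map_smul, fderiv_energy_apply hA, dirichletForm_smul_self u ht, h1, smul_zero]

/-- The sign of the derivative at `s` is that of `‖u‖ ^ p - s * g s`, and `g 1 = ‖u‖ ^ p` on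
`nehari`. Since `g` is nonnegative and strictly increasing, `s * g s` lies below `g 1` for `s < 1`
and above it for `s > 1`. -/
theorem energy_smul_lt (hA : Admissible N p α f) (hf : SuperlinearGrowth θ f) (hθ : 0 < θ)
    (hmono : RayMonotone hp hh α f) {u : HSpace p h hp hh}
    (hu : u ∈ (nehari α f : Set (HSpace p h hp hh))) {t : ℝ} (ht : 0 < t) (ht1 : t ≠ 1) :
    energy α f (t • u) < energy α f u := by
  obtain ⟨hu0, hun⟩ := (mem_nehari_iff hA).1 hu
  have hg := hmono u hu0
  set g := fun t : ℝ => nonlocalForm α f (t • u) u / t ^ p with hgdef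
  have hg1 : g 1 = ‖u‖ ^ p := by simp [hgdef, hun]
  have hpos : 0 < ‖u‖ ^ p := Real.rpow_pos_of_pos (norm_pos_iff.2 hu0) _
  have hgn : ∀ s, 0 < s → 0 ≤ g s := fun s hs =>
    div_nonneg (nonlocalForm_smul_nonneg hA hf hθ u hs) (Real.rpow_nonneg hs.le _)
  have hder : ∀ s, 0 < s → HasDerivAt (fun s : ℝ => energy α f (s • u))
      (s ^ (p - 1) * (‖u‖ ^ p - s * g s)) s := fun s hs => by
    refine (hasDerivAt_energy_smul hA u hs).congr_deriv ?_
    have h1 : s ^ p = s ^ (p - 1) * s := by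
      rw [← Real.rpow_add_one hs.ne', sub_add_cancel]
    have h2 : 0 < s ^ p := Real.rpow_pos_of_pos hs _
    have h3 : nonlocalForm α f (s • u) u = s ^ p * g s := by
      simp only [hgdef]; rw [mul_div_cancel₀ _ h2.ne']
    rw [h3, h1]; ring
  have h1u : energy α f ((1 : ℝ) • u) = energy α f u := by rw [one_smul]
  rw [← h1u]
  rcases lt_or_gt_of_ne ht1 with hlt | hgt
  · refine strictMonoOn_of_deriv_pos (convex_Icc t 1)
      (fun s hs => (hder s (ht.trans_le hs.1)).continuousAt.continuousWithinAt)
      (fun s hs => ?_) (left_mem_Icc.2 hlt.le) (right_mem_Icc.2 hlt.le) hlt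
    rw [interior_Icc] at hs
    have hs0 : 0 < s := ht.trans hs.1
    rw [(hder s hs0).deriv]
    refine mul_pos (Real.rpow_pos_of_pos hs0 _) ?_
    have := hg (mem_Ioi.2 hs0) (mem_Ioi.2 one_pos) hs.2
    nlinarith [hgn s hs0, hs.2]
  · refine strictAntiOn_of_deriv_neg (convex_Icc 1 t)
      (fun s hs => (hder s (one_pos.trans_le hs.1)).continuousAt.continuousWithinAt)
      (fun s hs => ?_) (left_mem_Icc.2 hgt.le) (right_mem_Icc.2 hgt.le) hgt
    rw [interior_Icc] at hs
    have hs0 : 0 < s := one_pos.trans hs.1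
    rw [(hder s hs0).deriv]
    refine mul_neg_of_pos_of_neg (Real.rpow_pos_of_pos hs0 _) ?_
    have := hg (mem_Ioi.2 one_pos) (mem_Ioi.2 hs0) hs.1
    nlinarith [hgn s hs0, hs.1]

theorem energy_smul_le (hA : Admissible N p α f) (hf : SuperlinearGrowth θ f) (hθ : 0 < θ)
    (hmono : RayMonotone hp hh α f) {u : HSpace p h hp hh}
    (hu : u ∈ (nehari α f : Set (HSpace p h hp hh))) {t : ℝ} (ht : 0 < t) :
    energy α f (t • u) ≤ energy α f u := by
  by_cases h1 : t = 1
  · rw [h1, one_smul]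
  · exact (energy_smul_lt hA hf hθ hmono hu ht h1).le

/-! ### Projection of rays onto the Nehari set, and coercivity of the energy there. -/

theorem exists_energy_smul_pos (hA : Admissible N p α f) {u : HSpace p h hp hh} (hu : u ≠ 0) :
    ∃ t : ℝ, 0 < t ∧ 0 < energy α f (t • u) := by
  obtain ⟨C, hC, hb⟩ := exists_nonlocal_bound (h := h) (hp := hp) (hh := hh) hA
  have hp0 : 0 < p := by linarith
  have hn : 0 < ‖u‖ ^ p := Real.rpow_pos_of_pos (norm_pos_iff.2 hu) _
  set E := ‖toEll u‖ with hE
  have hE0 : 0 ≤ E := norm_nonneg _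
  have l1 : Tendsto (fun t : ℝ => t * E) (𝓝[>] 0) (𝓝 0) :=
    (Continuous.tendsto' (by fun_prop) 0 0 (by simp)).mono_left nhdsWithin_le_nhds
  have l2 : Tendsto (fun t : ℝ => 1 / 2 * C * (t ^ p * (E ^ p) ^ 2)) (𝓝[>] 0) (𝓝 0) := by
    have hc : Continuous fun t : ℝ => 1 / 2 * C * (t ^ p * (E ^ p) ^ 2) :=
      continuous_const.mul ((Real.continuous_rpow_const hp0.le).mul continuous_const)
    exact (hc.tendsto' 0 0 (by simp [Real.zero_rpow hp0.ne'])).mono_left nhdsWithin_le_nhds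
  obtain ⟨t, ht0, h1, h2⟩ := (eventually_mem_nhdsWithin.and
    ((l1.eventually (gt_mem_nhds one_pos)).and
      (l2.eventually (gt_mem_nhds (show 0 < 1 / p * ‖u‖ ^ p by positivity))))).exists
  have ht : (0 : ℝ) < t := ht0
  have hnorm : ‖toEll (t • u)‖ = t * E := by
    rw [map_smul, norm_smul, Real.norm_of_nonneg ht.le]
  refine ⟨t, ht, ?_⟩
  have h3 := (hb (t • u) (by rw [hnorm]; exact h1.le)).1
  rw [hnorm, Real.mul_rpow ht.le hE0] at h3
  rw [energy_smul α f u ht.le]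
  have htp : 0 < t ^ p := Real.rpow_pos_of_pos ht _
  have h4 := mul_lt_mul_of_pos_left h2 htp
  nlinarith

/-- On the ray `J` is `0` at the origin, positive somewhere and negative far out, so its maximum
over `[0, T]` is interior and hence critical along the ray. -/
theorem exists_smul_mem_nehari (hA : Admissible N p α f) (hf : SuperlinearGrowth θ f)
    (hθ : p < θ) (hmono : RayMonotone hp hh α f) {u : HSpace p h hp hh} (hu : u ≠ 0) :
    ∃ t : ℝ, 0 < t ∧ t • u ∈ (nehari α f : Set (HSpace p h hp hh)) := by
  have hp0 : 0 < p := by linarith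
  have hθ0 : 0 < θ := by linarith
  obtain ⟨t₀, ht₀, hpos⟩ := exists_energy_smul_pos hA hu
  have hd := nonlocalTerm_pos hA hf hθ0 hmono hu
  -- Chosen so that `T ^ θ` times half the nonlocal term exceeds `T ^ p ‖u‖ ^ p / p`.
  obtain ⟨T, hT1, hT⟩ : ∃ T : ℝ, max 1 t₀ < T ∧
      2 * (1 / p * ‖u‖ ^ p) / nonlocalTerm α f u < T ^ (θ - p) :=
    ((eventually_gt_atTop (max 1 t₀)).and ((tendsto_rpow_atTop (sub_pos.2 hθ)).eventually
      (eventually_gt_atTop _))).exists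
  have hT1' : 1 < T := (le_max_left _ _).trans_lt hT1
  have hT0 : t₀ < T := (le_max_right _ _).trans_lt hT1
  have hTpos : 0 < T := by linarith
  have hneg : energy α f (T • u) < 0 := by
    rw [energy_smul α f u hTpos.le]
    have h1 := rpow_mul_nonlocalTerm_le hA hf hθ0 u hT1'.le
    have h2 : T ^ θ = T ^ p * T ^ (θ - p) := by rw [← Real.rpow_add hTpos]; congr 1; ring
    rw [div_lt_iff₀ hd] at hT
    have h3 := mul_lt_mul_of_pos_left hT (Real.rpow_pos_of_pos hTpos p)
    rw [h2] at h1
    nlinarith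
  have hzero : energy α f ((0 : ℝ) • u) = 0 := by
    have h0 : nonlocalTerm α f (0 : HSpace p h hp hh) = 0 := by
      have : ∀ x, (0 : HSpace p h hp hh) x = 0 := fun _ => rfl
      simp [nonlocalTerm, this, primitive_zero]
    rw [zero_smul, energy_eq, norm_zero, Real.zero_rpow hp0.ne', h0]
    ring
  have hcont : Continuous fun s : ℝ => energy α f (s • u) :=
    (continuous_energy hA).comp (continuous_id.smul continuous_const)
  obtain ⟨t, htm, htmax⟩ := isCompact_Icc.exists_isMaxOn (nonempty_Icc.2 hTpos.le)
    hcont.continuousOn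
  have hge : energy α f (t₀ • u) ≤ energy α f (t • u) := htmax ⟨ht₀.le, hT0.le⟩
  have ht0 : 0 < t := lt_of_le_of_ne htm.1 fun h0 => by
    rw [← h0, hzero] at hge; linarith
  have htT : t < T := lt_of_le_of_ne htm.2 fun h0 => by
    rw [h0] at hge; linarith
  exact ⟨t, ht0, smul_mem_nehari hA hu ht0 (htmax.isLocalMax (Icc_mem_nhds ht0 htT))⟩

/-- On `nehari` the Ambrosetti-Rabinowitz condition bounds half the nonlocal term by `‖u‖ ^ p / θ`.
-/
theorem mul_norm_rpow_le_energy (hA : Admissible N p α f) (hf : SuperlinearGrowth θ f)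
    (hθ : p < θ) {u : HSpace p h hp hh} (hu : u ∈ (nehari α f : Set (HSpace p h hp hh))) :
    (1 / p - 1 / θ) * ‖u‖ ^ p ≤ energy α f u := by
  have hθ0 : 0 < θ := by linarith
  have h1 := nonlocalTerm_le_nonlocalForm hA hf hθ0 u
  rw [← ((mem_nehari_iff hA).1 hu).2] at h1
  have h2 := mul_le_mul_of_nonneg_left h1 (show 0 ≤ 1 / θ by positivity)
  have h3 : 1 / θ * (θ / 2 * nonlocalTerm α f u) = 1 / 2 * nonlocalTerm α f u := by field_simp
  rw [energy_eq]
  linarith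

/-! ### Existence of a minimizer on the Nehari manifold -/

/-- On `nehari`, `‖v‖ ^ p` is at most a constant times `‖toEll v‖ ^ p * ‖v‖ ^ p` once `‖toEll v‖ ≤
1`, so `‖toEll v‖` cannot tend to `0`. -/
theorem ne_zero_of_tendsto_nehari (hA : Admissible N p α f) {v : ℕ → HSpace p h hp hh}
    (hv : ∀ n, v n ∈ (nehari α f : Set (HSpace p h hp hh))) {u : HSpace p h hp hh}
    (hlim : Tendsto (fun n => toEll (v n)) atTop (𝓝 (toEll u))) : u ≠ 0 := by
  rintro rfl
  have hp0 : 0 < p := by linarith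
  obtain ⟨C, hC, hb⟩ := exists_nonlocal_bound (h := h) (hp := hp) (hh := hh) hA
  set E : HSpace p h hp hh →L[ℝ] Ell (Fin N → ℤ) p := toEll with hE
  rw [map_zero] at hlim
  have hn0 : Tendsto (fun n => ‖E (v n)‖) atTop (𝓝 0) := by simpa using hlim.norm
  have hn1 : Tendsto (fun n => C * ‖E‖ ^ p * ‖E (v n)‖ ^ p) atTop (𝓝 0) := by
    simpa [Real.zero_rpow hp0.ne'] using
      (hn0.rpow_const (p := p) (Or.inr hp0.le)).const_mul (C * ‖E‖ ^ p)
  obtain ⟨n, h1, h2⟩ := ((hn0.eventually (gt_mem_nhds one_pos)).and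
    (hn1.eventually (gt_mem_nhds one_pos))).exists
  obtain ⟨hne, heq⟩ := (mem_nehari_iff hA).1 (hv n)
  have hpos : 0 < ‖v n‖ ^ p := Real.rpow_pos_of_pos (norm_pos_iff.2 hne) _
  have h3 := (hb (v n) h1.le).2
  rw [← heq] at h3
  have h4 : ‖E (v n)‖ ^ p ≤ ‖E‖ ^ p * ‖v n‖ ^ p := by
    rw [← Real.mul_rpow (norm_nonneg _) (norm_nonneg _)]
    exact Real.rpow_le_rpow (norm_nonneg _) (E.le_opNorm _) hp0.le
  have h5 : 0 ≤ ‖E (v n)‖ ^ p := Real.rpow_nonneg (norm_nonneg _) _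
  have h6 : C * (‖E (v n)‖ ^ p) ^ 2 ≤ C * ‖E‖ ^ p * ‖E (v n)‖ ^ p * ‖v n‖ ^ p := by
    have := mul_le_mul_of_nonneg_left h4 (mul_nonneg hC h5)
    nlinarith
  have h7 := mul_lt_mul_of_pos_right h2 hpos
  linarith

theorem exists_isMinOn_nehari (hA : Admissible N p α f) (hf : SuperlinearGrowth θ f)
    (hθ : p < θ) (hmono : RayMonotone hp hh α f) (hfin : ∀ M : ℝ, {x | h x < M}.Finite) :
    ∃ u ∈ (nehari α f : Set (HSpace p h hp hh)), ∀ v ∈ (nehari α f : Set (HSpace p h hp hh)),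
      energy α f u ≤ energy α f v := by
  have hp0 : 0 < p := by linarith
  have hθ0 : 0 < θ := by linarith
  have hκ : 0 < 1 / p - 1 / θ := sub_pos.2 (one_div_lt_one_div_of_lt hp0 hθ)
  set A := energy α f '' (nehari α f : Set (HSpace p h hp hh)) with hAdef
  have hne : A.Nonempty := by
    have h1 : (HSpace.single hp hh 0 1 : HSpace p h hp hh) ≠ 0 := fun hcon => by
      have : (HSpace.single hp hh 0 1 : HSpace p h hp hh) 0 = (0 : HSpace p h hp hh) 0 := by
        rw [hcon]
      rw [HSpace.single_apply, Pi.single_eq_same] at this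
      exact one_ne_zero this
    obtain ⟨t, -, ht⟩ := exists_smul_mem_nehari hA hf hθ hmono h1
    exact ⟨_, _, ht, rfl⟩
  have hbdd : BddBelow A := ⟨0, by
    rintro _ ⟨v, hv, rfl⟩
    exact (mul_nonneg hκ.le (Real.rpow_nonneg (norm_nonneg _) _)).trans
      (mul_norm_rpow_le_energy hA hf hθ hv)⟩
  obtain ⟨a, hanti, halim, haA⟩ := exists_seq_tendsto_sInf hne hbdd
  choose v hv hva using haA
  have hbound : ∀ n, ‖v n‖ ≤ (a 0 / (1 / p - 1 / θ)) ^ (1 / p) := fun n => by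
    have h1 := mul_norm_rpow_le_energy hA hf hθ (hv n)
    rw [hva n] at h1
    have h2 : ‖v n‖ ^ p ≤ a 0 / (1 / p - 1 / θ) := by
      rw [le_div_iff₀ hκ]; linarith [hanti (Nat.zero_le n)]
    have h3 := Real.rpow_le_rpow (Real.rpow_nonneg (norm_nonneg _) _) h2
      (show 0 ≤ 1 / p by positivity)
    rwa [← Real.rpow_mul (norm_nonneg _), mul_one_div_cancel hp0.ne', Real.rpow_one] at h3
  obtain ⟨u, φ, hφ, hpt, hlim⟩ := exists_subseq_tendsto_toEll hfin hbound
  have hu : u ≠ 0 := ne_zero_of_tendsto_nehari hA (fun n => hv (φ n)) hlim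
  -- The norm is only semicontinuous, so the limit may leave `nehari` and is moved back along its
  -- ray.
  obtain ⟨t, ht, htu⟩ := exists_smul_mem_nehari hA hf hθ hmono hu
  refine ⟨t • u, htu, fun w hw => ?_⟩
  refine le_trans ?_ (csInf_le hbdd ⟨w, hw, rfl⟩)
  have hDlim : Tendsto (fun n => nonlocalTerm α f (t • v (φ n))) atTop
      (𝓝 (nonlocalTerm α f (t • u))) := by
    refine tendsto_nonlocalTerm hA ?_
    simp only [map_smul]
    exact hlim.const_smul t
  -- Each `v (φ n)` maximizes `J` on its ray, so `J (t • v (φ n)) ≤ a (φ n)`; this bounds the energy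
  -- sums, and Fatou applies.
  have hlsc := sum_energyDensity_le_of_tendsto (v := fun n => t • v (φ n))
    (u := (t • u : HSpace p h hp hh)) (fun x => (hpt x).const_mul t)
    (b := fun n => p * (a (φ n) + 1 / 2 * nonlocalTerm α f (t • v (φ n))))
    (fun n => by
      have h1 := energy_smul_le hA hf hθ0 hmono (hv (φ n)) ht
      rw [hva, energy_eq, HSpace.norm_rpow] at h1
      have h2 := mul_le_mul_of_nonneg_left h1 hp0.le
      rw [mul_sub, ← mul_assoc, mul_one_div_cancel hp0.ne', one_mul] at h2
      rw [mul_add]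
      linarith)
    (((halim.comp hφ.tendsto_atTop).add (hDlim.const_mul (1 / 2))).const_mul p)
  have hΦ : ‖t • u‖ ^ p ≤ p * (sInf A + 1 / 2 * nonlocalTerm α f (t • u)) := by
    rw [HSpace.norm_rpow]
    exact (t • u : HSpace p h hp hh).summable.tsum_le_of_sum_le hlsc
  have h2 := mul_le_mul_of_nonneg_left hΦ (show 0 ≤ 1 / p by positivity)
  rw [← mul_assoc, one_div_mul_cancel hp0.ne', one_mul] at h2
  rw [energy_eq]
  linarith

/-! ### Minimizers on the Nehari manifold are critical points -/

/-- A substitute for Lagrange multipliers: a descent direction `v` at `u` would lower the maximum of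
`J` along the ray through `u + s v`, for small `s > 0`, below the minimum over `nehari`. -/
theorem dirichletForm_sub_nonlocalForm_nonneg (hA : Admissible N p α f)
    (hf : SuperlinearGrowth θ f) (hθ : 0 < θ) (hmono : RayMonotone hp hh α f)
    {u : HSpace p h hp hh} (hu : u ∈ (nehari α f : Set (HSpace p h hp hh)))
    (hmin : ∀ w ∈ (nehari α f : Set (HSpace p h hp hh)), energy α f u ≤ energy α f w)
    (v : HSpace p h hp hh) : 0 ≤ dirichletForm u v - nonlocalForm α f u v := by
  by_contra hcon
  set a := dirichletForm u v with ha
  set b := nonlocalForm α f u v with hb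
  have hp0 : 0 < p := by linarith
  -- The gap `b - a = 4ε` absorbs an error `2ε` from the norm term and `ε / 2` from half the
  -- nonlocal term.
  set ε := (b - a) / 4 with hε
  have hε0 : 0 < ε := by rw [hε]; linarith
  obtain ⟨L, hL, hD⟩ := hasStrictFDerivAt_nonlocalTerm hA u
  have hv1 : 0 < ‖v‖ + 1 := by positivity
  have hDev := (hasStrictFDerivAt_iff_isLittleO.1 hD).def (c := ε / (‖v‖ + 1)) (by positivity)
  have hmap : Tendsto (fun q : ℝ × ℝ => (q.1 • (u + q.2 • v), q.1 • u)) (𝓝 (1, 0)) (𝓝 (u, u)) := by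
    refine Continuous.tendsto' (by fun_prop) _ _ (by simp)
  have hpow : ∀ᶠ q : ℝ × ℝ in 𝓝 (1, 0), q.1 ^ (p - 1) * (a + ε) < a + 2 * ε := by
    have : Tendsto (fun q : ℝ × ℝ => q.1 ^ (p - 1) * (a + ε)) (𝓝 (1, 0)) (𝓝 (a + ε)) := by
      have hc : Continuous fun q : ℝ × ℝ => q.1 ^ (p - 1) * (a + ε) :=
        ((Real.continuous_rpow_const (by linarith)).comp continuous_fst).mul continuous_const
      exact hc.tendsto' _ _ (by simp)
    exact this.eventually (gt_mem_nhds (by linarith))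
  obtain ⟨r, hr, hball⟩ := Metric.eventually_nhds_iff.1 ((hmap.eventually hDev).and hpow)
  set δ := min (r / 2) (1 / 2) with hδ
  have hδ0 : 0 < δ := by positivity
  have hδr : δ < r := (min_le_left _ _).trans_lt (by linarith)
  have hδ1 : δ ≤ 1 / 2 := min_le_right _ _
  have hcE := continuous_energy (h := h) (hp := hp) (hh := hh) hA
  -- By continuity, the strict maximality of `J` at `u` on its ray persists at each fixed multiple
  -- of the perturbed point; this will make the maximum over `[1 - δ, 1 + δ]` interior.
  have hend : ∀ c : ℝ, 0 < c → c ≠ 1 →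
      ∀ᶠ s in 𝓝 (0 : ℝ), energy α f (c • (u + s • v)) < energy α f (u + s • v) := by
    intro c hc hc1
    have h1 : ContinuousAt (fun s : ℝ => energy α f (c • (u + s • v))) 0 :=
      (hcE.comp (by fun_prop : Continuous fun s : ℝ => c • (u + s • v))).continuousAt
    have h2 : ContinuousAt (fun s : ℝ => energy α f (u + s • v)) 0 :=
      (hcE.comp (by fun_prop : Continuous fun s : ℝ => u + s • v)).continuousAt
    refine h1.eventually_lt h2 ?_
    simpa using energy_smul_lt hA hf hθ hmono hu hc hc1
  have hΦ : ∀ᶠ s in 𝓝 (0 : ℝ), ‖‖u + s • v‖ ^ p - ‖u‖ ^ p - s * (p * a)‖ ≤ p * ε * ‖s‖ := by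
    have h1 : HasDerivAt (fun s : ℝ => u + s • v) v 0 := by
      simpa using ((hasDerivAt_id (0 : ℝ)).smul_const v).const_add u
    have h0 : u + (0 : ℝ) • v = u := by simp
    have h2 : HasFDerivAt (fun w : HSpace p h hp hh => ‖w‖ ^ p) (p • dirichletForm u)
        (u + (0 : ℝ) • v) := by
      rw [h0]
      simp only [HSpace.norm_rpow]
      exact hasFDerivAt_tsum_energyDensity u
    have h3 := h2.comp_hasDerivAt (0 : ℝ) h1
    have h4 := (hasDerivAt_iff_isLittleO_nhds_zero.1 h3).def (c := p * ε) (by positivity)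
    filter_upwards [h4] with s hs
    simpa [ha] using hs
  obtain ⟨s, hs0, hsr, hs1, hs2, hs3⟩ := ((eventually_mem_nhdsWithin (a := (0 : ℝ)) (s := Ioi 0)).and
    (nhdsWithin_le_nhds ((gt_mem_nhds hr).and ((hend (1 - δ) (by linarith) (by linarith)).and
      ((hend (1 + δ) (by linarith) (by linarith)).and hΦ))))).exists
  have hs : (0 : ℝ) < s := hs0
  set w := u + s • v with hw
  have hw0 : w ≠ 0 := fun h0 => by
    rw [h0, smul_zero] at hs1; exact lt_irrefl _ hs1
  have hcont : Continuous fun c : ℝ => energy α f (c • w) := hcE.comp (by fun_prop)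
  obtain ⟨t, htm, htmax⟩ := (isCompact_Icc (a := 1 - δ) (b := 1 + δ)).exists_isMaxOn
    (nonempty_Icc.2 (by linarith)) hcont.continuousOn
  have hge : energy α f w ≤ energy α f (t • w) := by
    have : energy α f ((1 : ℝ) • w) ≤ energy α f (t • w) :=
      htmax (show (1 : ℝ) ∈ Icc (1 - δ) (1 + δ) from ⟨by linarith, by linarith⟩)
    rwa [one_smul] at this
  have ht1 : 1 - δ < t := lt_of_le_of_ne htm.1 fun h0 => by rw [← h0] at hge; linarith
  have ht2 : t < 1 + δ := lt_of_le_of_ne htm.2 fun h0 => by rw [h0] at hge; linarith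
  have ht : 0 < t := by linarith
  have hmem := smul_mem_nehari hA hw0 ht (htmax.isLocalMax (Icc_mem_nhds ht1 ht2))
  -- This is `J (t • u) ≤ J u ≤ J (t • w)`; the rest derives the opposite strict inequality.
  have hle := (energy_smul_le hA hf hθ hmono hu ht).trans (hmin _ hmem)
  rw [energy_smul α f u ht.le, energy_smul α f w ht.le] at hle
  -- `t` depends on `s` without control beyond `|t - 1| < δ`, so the estimate must be uniform over
  -- pairs near `(1, 0)`; strict differentiability gives this.
  obtain ⟨hd, hq⟩ := hball (y := (t, s)) (by
    rw [Prod.dist_eq, max_lt_iff, Real.dist_eq, Real.dist_eq, sub_zero, abs_of_pos hs]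
    exact ⟨abs_lt.2 ⟨by linarith, by linarith⟩, hsr⟩)
  simp only at hd hq
  rw [← hw] at hd
  have hdiff : t • w - t • u = (t * s) • v := by
    rw [hw, smul_add, smul_smul]; abel
  rw [hdiff, map_smul, hL, norm_smul,
    Real.norm_of_nonneg (mul_pos ht hs).le, smul_eq_mul] at hd
  have hd1 := (abs_le.1 hd).1
  have hd2 : ε / (‖v‖ + 1) * (t * s * ‖v‖) ≤ ε * (t * s) := by
    have h1 : ‖v‖ / (‖v‖ + 1) ≤ 1 := (div_le_one hv1).2 (by linarith)
    calc ε / (‖v‖ + 1) * (t * s * ‖v‖) = ε * (t * s) * (‖v‖ / (‖v‖ + 1)) := by ring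
      _ ≤ ε * (t * s) * 1 := mul_le_mul_of_nonneg_left h1 (by positivity)
      _ = _ := mul_one _
  have hx := (abs_le.1 hs3).2
  rw [Real.norm_of_nonneg hs.le] at hx
  have htp : t ^ p = t * t ^ (p - 1) := by
    rw [mul_comm, ← Real.rpow_add_one ht.ne', sub_add_cancel]
  have hx2 : 1 / p * (t ^ p * (‖w‖ ^ p - ‖u‖ ^ p)) ≤ t * s * (a + 2 * ε) := by
    have e1 : ‖w‖ ^ p - ‖u‖ ^ p ≤ p * (s * (a + ε)) := by linarith
    calc 1 / p * (t ^ p * (‖w‖ ^ p - ‖u‖ ^ p)) ≤ 1 / p * (t ^ p * (p * (s * (a + ε)))) := by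
          gcongr
      _ = t * s * (t ^ (p - 1) * (a + ε)) := by rw [htp]; field_simp
      _ ≤ _ := mul_le_mul_of_nonneg_left hq.le (by positivity)
  have hts : 0 < t * s := by positivity
  have hbε : b = a + 4 * ε := by rw [hε]; ring
  rw [← hb, hbε] at hd1
  nlinarith [mul_pos hts hε0]

/-- The one-sided inequality for `v` and `-v`, and linearity of the derivative. -/
theorem dirichletForm_eq_nonlocalForm (hA : Admissible N p α f)
    (hf : SuperlinearGrowth θ f) (hθ : 0 < θ) (hmono : RayMonotone hp hh α f)
    {u : HSpace p h hp hh} (hu : u ∈ (nehari α f : Set (HSpace p h hp hh)))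
    (hmin : ∀ w ∈ (nehari α f : Set (HSpace p h hp hh)), energy α f u ≤ energy α f w)
    (v : HSpace p h hp hh) : dirichletForm u v = nonlocalForm α f u v := by
  have key := dirichletForm_sub_nonlocalForm_nonneg hA hf hθ hmono hu hmin
  have h1 := key v
  have h2 := key (-v)
  rw [← fderiv_energy_apply hA] at h1 h2
  rw [map_neg] at h2
  have h3 : fderiv ℝ (energy α f) u v = 0 := by linarith
  rw [fderiv_energy_apply hA] at h3
  linarith

end Rays

/-! ### The pointwise equation -/

theorem gradForm_single_self (u : (Fin N → ℤ) → ℝ) (x : Fin N → ℤ) :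
    gradForm u (Pi.single x 1) x =
      -(1 / 2 * ∑ y ∈ (latticeGraph N).neighborFinset x, (u y - u x)) := by
  rw [gradForm, ← mul_neg, ← Finset.sum_neg_distrib]
  congr 1
  refine Finset.sum_congr rfl fun y hy => ?_
  have hne : y ≠ x := ((SimpleGraph.mem_neighborFinset _ _ _).1 hy).ne'
  rw [Pi.single_eq_same, Pi.single_eq_of_ne hne]
  ring

theorem gradForm_single_of_adj (u : (Fin N → ℤ) → ℝ) {x y : Fin N → ℤ}
    (hxy : (latticeGraph N).Adj x y) :
    gradForm u (Pi.single x 1) y = -(1 / 2 * (u y - u x)) := by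
  rw [gradForm, Finset.sum_eq_single x]
  · rw [Pi.single_eq_same, Pi.single_eq_of_ne hxy.ne']
    ring
  · intro z _ hz
    rw [Pi.single_eq_of_ne hz, Pi.single_eq_of_ne hxy.ne']
    ring
  · intro hx
    exact absurd ((SimpleGraph.mem_neighborFinset _ _ _).2 hxy.symm) hx

theorem gradForm_single_of_not_adj (u : (Fin N → ℤ) → ℝ) {x y : Fin N → ℤ} (hne : y ≠ x)
    (hxy : ¬(latticeGraph N).Adj x y) : gradForm u (Pi.single x 1) y = 0 := by
  rw [gradForm, Finset.sum_eq_zero, mul_zero]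
  intro z hz
  have hzx : z ≠ x := by
    rintro rfl
    exact hxy ((SimpleGraph.mem_neighborFinset _ _ _).1 hz).symm
  rw [Pi.single_eq_of_ne hzx, Pi.single_eq_of_ne hne]
  ring

/-- Summation by parts against the indicator function of a point. -/
theorem tsum_gradForm_single (p : ℝ) (u : (Fin N → ℤ) → ℝ) (x : Fin N → ℤ) :
    ∑' y, gradLen u y ^ (p - 2) * gradForm u (Pi.single x 1) y = -pLaplacian p u x := by
  classical
  have hx : x ∉ (latticeGraph N).neighborFinset x := by simp
  rw [tsum_eq_sum (s := insert x ((latticeGraph N).neighborFinset x)), Finset.sum_insert hx,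
    gradForm_single_self, pLaplacian]
  -- Every edge at `x` is counted once from `x` and once from its other end `y`, which produces the
  -- symmetric weight of `pLaplacian`.
  · have hnb : ∑ y ∈ (latticeGraph N).neighborFinset x,
        gradLen u y ^ (p - 2) * gradForm u (Pi.single x 1) y =
        ∑ y ∈ (latticeGraph N).neighborFinset x, gradLen u y ^ (p - 2) * -(1 / 2 * (u y - u x)) :=
      Finset.sum_congr rfl fun y hy => by
        rw [gradForm_single_of_adj u ((SimpleGraph.mem_neighborFinset _ _ _).1 hy)]
    rw [hnb]
    simp only [Finset.mul_sum, ← Finset.sum_neg_distrib, ← Finset.sum_add_distrib]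
    exact Finset.sum_congr rfl fun y _ => by ring
  · intro y hy
    rw [Finset.mem_insert, SimpleGraph.mem_neighborFinset, not_or] at hy
    rw [gradForm_single_of_not_adj u hy.1 hy.2, mul_zero]

section

variable {p α : ℝ} {f : ℝ → ℝ} {h : (Fin N → ℤ) → ℝ} {hp : 2 ≤ p} {hh : BoundedBelow h}

theorem dirichletForm_single (u : HSpace p h hp hh) (x : Fin N → ℤ) :
    dirichletForm u (HSpace.single hp hh x 1) =
      -pLaplacian p u x + h x * |u x| ^ (p - 2) * u x := by
  have hs1 : Summable fun y => h y * |u y| ^ (p - 2) * u y * (Pi.single x 1 : (Fin N → ℤ) → ℝ) y :=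
    summable_of_hasFiniteSupport ((Set.finite_singleton x).subset fun y hy => by
      by_contra hne
      rw [mem_singleton_iff] at hne
      apply hy
      simp [Pi.single_eq_of_ne hne])
  have hs2 : Summable fun y => gradLen (u : (Fin N → ℤ) → ℝ) y ^ (p - 2) *
      gradForm u (Pi.single x 1) y := by
    refine ((HSpace.summable_dirichletDensity u (HSpace.single hp hh x 1)).sub hs1).congr
      fun y => ?_
    exact add_sub_cancel_right _ _
  rw [dirichletForm_apply]
  refine (Summable.tsum_add hs2 hs1).trans ?_
  rw [tsum_gradForm_single, tsum_eq_single x fun y hy => by rw [Pi.single_eq_of_ne hy, mul_zero],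
    Pi.single_eq_same, mul_one]

theorem nonlocalForm_single_right (u : HSpace p h hp hh) (x : Fin N → ℤ) :
    nonlocalForm α f u (HSpace.single hp hh x 1) =
      greenConv α (fun y => primitive f (u y)) x * f (u x) := by
  rw [nonlocalForm, tsum_eq_single x fun y hy => by
    rw [HSpace.single_apply, Pi.single_eq_of_ne hy, mul_zero], HSpace.single_apply,
    Pi.single_eq_same, mul_one]

/-- Existence of a ground state, which solves the equation pointwise. -/
theorem exists_groundState (hA : Admissible N p α f) {θ : ℝ} (hf : SuperlinearGrowth θ f)
    (hθ : p < θ) (hmono : RayMonotone hp hh α f) (hfin : ∀ M : ℝ, {x | h x < M}.Finite) :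
    ∃ u : HSpace p h hp hh, IsGroundState α f u ∧ SolvesEquation p α h f u := by
  -- The normed structure on `ℓ^p` depends on `1 ≤ p`.
  have : Fact (1 ≤ ENNReal.ofReal p) := ⟨by
    rw [← ENNReal.ofReal_one]; exact ENNReal.ofReal_le_ofReal (by linarith)⟩
  obtain ⟨u, hu, hmin⟩ := exists_isMinOn_nehari hA hf hθ hmono hfin
  have hcrit := dirichletForm_eq_nonlocalForm hA hf (by linarith) hmono hu hmin
  refine ⟨u, ⟨hu.1, ?_, ?_⟩, fun x => ?_⟩
  · obtain ⟨L, hLw, hL⟩ := hasFDerivAt_energy hA u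
    refine hL.congr_fderiv (ContinuousLinearMap.ext fun w => ?_)
    rw [hLw, hcrit, sub_self]
    rfl
  · exact IsLeast.isGLB ⟨⟨u, hu, rfl⟩, by rintro _ ⟨w, hw, rfl⟩; exact hmin w hw⟩
  · rw [← dirichletForm_single u x, hcrit, nonlocalForm_single_right]

end

end LatticeChoquard

end

theorem theorem1p2 {N : ℕ} (p α : ℝ) (hp : 2 ≤ p) (hα₀ : 0 < α) (hαN : α < N)
    (h : (Fin N → ℤ) → ℝ) (f : ℝ → ℝ)
    (h1 : LatticeChoquard.BoundedBelow h)
    (h3 : ∃ x₀ : Fin N → ℤ, Filter.Tendsto h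
      (Filter.comap (fun x => (LatticeChoquard.latticeGraph N).dist x x₀) Filter.atTop)
      Filter.atTop)
    (f1_cont : Continuous f)
    (f1_zero : f =o[nhdsWithin 0 {0}ᶜ] fun t : ℝ => |t| ^ (p - 1))
    (f2 : ∃ C > (0 : ℝ), ∃ τ : ℝ, (N + α) * p / (2 * N) < τ ∧
      ∀ t : ℝ, |f t| ≤ C * (1 + |t| ^ (τ - 1)))
    (f3 : ∃ θ : ℝ, p < θ ∧ ∀ t : ℝ, 0 ≤ θ * LatticeChoquard.primitive f t ∧
      θ * LatticeChoquard.primitive f t ≤ 2 * f t * t)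
    (f4 : ∀ u : LatticeChoquard.HSpace p h hp h1, u ≠ 0 →
      StrictMonoOn (fun t : ℝ =>
        (∑' x, LatticeChoquard.greenConv α
          (fun y => LatticeChoquard.primitive f (t * u y)) x * f (t * u x) * u x) / t ^ p)
        (Set.Ioi 0)) :
    ∃ u : LatticeChoquard.HSpace p h hp h1,
      LatticeChoquard.IsGroundState α f u ∧ LatticeChoquard.SolvesEquation p α h f u := by
  obtain ⟨θ, hθ, hf⟩ := f3
  exact LatticeChoquard.exists_groundState ⟨hα₀, hαN, f1_cont, f1_zero⟩ hf hθ f4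
    (LatticeChoquard.finite_setOf_lt_of_tendsto h3)
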